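/- Let $E$ be a Borel space, that is, a topological space homeomorphic to a Borel subset of a compact metric space, with its Borel $\sigma$-algebra. Let $A$ be a nonempty compact metric space with its Borel $\sigma$-algebra, and let $T\in(0,\infty)$. Let $\lambda(x,a,dy)$ be a measure transition kernel from $E\times A$ to $E$ with $\sup_{x\in E,a\in A}\lambda(x,a,E)<\infty$ which is Feller: for every bounded continuous $\phi:E\to\mathbb R$ the map $(x,a)\mapsto\int_E\phi(y)\,\lambda(x,a,dy)$ is continuous. Let $f:[0,T]\times E\times A\to\mathbb R$ and $g:E\to\mathbb R$ be upper semicontinuous and bounded. For a bounded Borel function $\phi$ on $E$ put $\mathcal L^a_E\phi(x)=\int_E(\phi(y)-\phi(x))\,\lambda(x,a,dy)$. *Control problem.* Let $\Omega=E\times\Omega'$, where $\Omega'$ is the set of sequences $(T_n,E_n)_{n\ge1}$ in $((0,\infty)\times E)\cup\{(\infty,\Delta)\}$ with $T_n\le T_{n+1}$, and $T_n<T_{n+1}$ whenever $T_n<\infty$. Let $E_0$ be the projection on the first factor, $T_0=0$, $T_\infty=\lim_n T_n$, $X_s=E_n$ for $T_n\le s<T_{n+1}$, and $X_s=\Delta$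 for $s\ge T_\infty$. Let $p=\sum_{n\ge1,\,T_n<\infty}\delta_{(T_n,E_n)}$, let $\mathcal F_s$ be the $\sigma$-algebra generated by $E_0$ and the variables $p((0,r]\times B)$, $r\in(0,s]$, $B\subset E$ Borel, and let $\mathcal F_\infty=\bigvee_s\mathcal F_s$. An admissible control is a Borel map $\alpha:[0,T]\times E\to A$; for times $s>T$ put $\alpha(s,x)=\alpha(T,x)$ (this convention does not affect the quantities below). For $(t,x)\in[0,T]\times E$, let $\mathbb P^{t,x}_\alpha$ be the (unique) probability on $(\Omega,\mathcal F_\infty)$ under which $E_0=x$ almost surely and the $(\mathcal F_s)$-compensator of $p$ is $1_{[t,T_\infty)}(s)\,\lambda(X_{s-},\alpha(s,X_{s-}),dy)\,ds$. Set $$J(t,x,\alpha)=\mathbb E^{t,x}_\alpha\Big[\int_t^Tf(s,X_s,\alpha(s,X_s))\,ds+g(X_T)\Big],\qquad V(t,x)=\sup_\alpha J(t,x,\alpha).$$ A control $\alpha$ is optimal if $J(t,x,\alpha)=V(t,x)$ for all $(t,x)\in[0,T]\times E$. *HJB equation.* A bounded Borel function $v:[0,T]\times E\to\mathbb R$ is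 a solution of $$-\frac{\partial v}{\partial t}(t,x)=\sup_{a\in A}\big(\mathcal L^a_Ev(t,x)+f(t,x,a)\big),\qquad v(T,x)=g(x),$$ if the right-hand side of the first equation is Borel measurable in $(t,x)$ and, for every $x\in E$, $v(T,x)=g(x)$, the map $t\mapsto v(t,x)$ is absolutely continuous on $[0,T]$, and the first equation holds for almost every $t\in[0,T]$ (the exceptional null set may depend on $x$). **Theorem.** The measures $\mathbb P^{t,x}_\alpha$ exist, and $\sup_\alpha J(t,x,\alpha)<\infty$ for all $(t,x)\in[0,T]\times E$. The HJB equation has exactly one bounded upper semicontinuous solution $v:[0,T]\times E\to\mathbb R$, and $v(t,x)=V(t,x)$ for all $(t,x)\in[0,T]\times E$. Moreover, every Borel map $\alpha:[0,T]\times E\to A$ satisfying $$\mathcal L^{\alpha(t,x)}_Ev(t,x)+f(t,x,\alpha(t,x))=\sup_{a\in A}\big(\mathcal L^a_Ev(t,x)+f(t,x,a)\big)\qquad\text{for all }(t,x)\in[0,T]\times E$$ is an optimal control, and such an $\alpha$ exists. -/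

import Mathlib

open MeasureTheory ProbabilityTheory Set
open scoped NNReal ENNReal

universe u

namespace JumpControl

/-! ### Spaces of functions and topological Borel spaces -/

/-- A topological Borel space: a topological space homeomorphic to a Borel subset of a
compact metric space. -/
def IsTopologicalBorelSpace (E : Type u) [TopologicalSpace E] : Prop :=
  ∃ (K : Type u) (_ : MetricSpace K) (_ : CompactSpace K) (e : E → K),
    Topology.IsEmbedding e ∧ MeasurableSet[borel K] (range e)

/-- Upper semicontinuous and bounded real functions. -/
def IsUSCBounded {S : Type*} [TopologicalSpace S] (φ : S → ℝ) : Prop :=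
  UpperSemicontinuous φ ∧ ∃ C : ℝ, ∀ z, |φ z| ≤ C

/-- Feller property of a transition kernel `lam(x, a, dy)`. -/
def IsFeller {E A : Type*} [TopologicalSpace E] [MeasurableSpace E] [TopologicalSpace A]
    [MeasurableSpace A] (lam : Kernel (E × A) E) : Prop :=
  ∀ φ : BoundedContinuousFunction E ℝ, Continuous fun p : E × A => ∫ y, φ y ∂(lam p)

/-! ### The canonical space of marked point processes -/

/-- The jump time encoded by a coordinate: `none` stands for the pair `(∞, Δ)`. -/
noncomputable def timeOf {E : Type*} (j : Option (ℝ≥0 × E)) : ℝ≥0∞ :=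
  j.elim ⊤ fun p => (p.1 : ℝ≥0∞)

/-- The sample space `Ω = E × Ω'`: an initial point `e` together with a sequence
`(t₁, e₁), (t₂, e₂), …` in `((0,∞) × E) ∪ {(∞, Δ)}` (indexed from `0` below) such that
`tₙ ≤ tₙ₊₁`, and `tₙ < tₙ₊₁` whenever `tₙ < ∞`. -/
structure JumpPath (E : Type*) where
  init : E
  jump : ℕ → Option (ℝ≥0 × E)
  pos : ∀ n, 0 < timeOf (jump n)
  mono : ∀ n, timeOf (jump n) ≤ timeOf (jump (n + 1))
  strict : ∀ n, timeOf (jump n) < ⊤ → timeOf (jump n) < timeOf (jump (n + 1))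

namespace JumpPath

variable {E : Type*}

/-- The times `T₀ = 0, T₁, T₂, …`. -/
noncomputable def time (ω : JumpPath E) : ℕ → ℝ≥0∞
  | 0 => 0
  | n + 1 => timeOf (ω.jump n)

/-- The marks `E₀, E₁, E₂, …` (`none` stands for `Δ`). -/
def mark (ω : JumpPath E) : ℕ → Option E
  | 0 => some ω.init
  | n + 1 => (ω.jump n).map Prod.snd

/-- The explosion time `T_∞ = lim Tₙ`. -/
noncomputable def explosionTime (ω : JumpPath E) : ℝ≥0∞ := ⨆ n, ω.time n

open Classical in
/-- The right-continuous state process: `X_s = Eₙ` for `Tₙ ≤ s < Tₙ₊₁`, and `X_s = Δ` for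
`s ≥ T_∞`. -/
noncomputable def state (ω : JumpPath E) (s : ℝ≥0) : Option E :=
  if h : ∃ n, ω.time n ≤ s ∧ (s : ℝ≥0∞) < ω.time (n + 1) then ω.mark (Nat.find h) else none

open Classical in
/-- The left limits `X_{s-}` of the state process for `s < T_∞`: `E₀` on `[0, T₁]` and `Eₙ` on
`(Tₙ, Tₙ₊₁]`. -/
noncomputable def leftState (ω : JumpPath E) (s : ℝ≥0) : Option E :=
  if h : ∃ n, (n = 0 ∨ ω.time n < s) ∧ (s : ℝ≥0∞) ≤ ω.time (n + 1)
  then ω.mark (Nat.find h) else none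

variable [MeasurableSpace E]

/-- The random measure `p(ds dy) = ∑_{n ≥ 1, Tₙ < ∞} δ_{(Tₙ, Eₙ)}(ds dy)`. -/
noncomputable def jumpMeasure (ω : JumpPath E) : Measure (ℝ≥0 × E) :=
  Measure.sum fun n => (ω.jump n).elim 0 Measure.dirac

variable (E) in
/-- The σ-algebra `𝓕_t`, generated by the initial point and by the counting variables
`N(s, B) = p((0, s] × B)`, for `s ∈ (0, t]` and `B` Borel. -/
@[reducible]
noncomputable def sigmaAlgebra (t : ℝ≥0) : MeasurableSpace (JumpPath E) :=
  MeasurableSpace.comap JumpPath.init inferInstance ⊔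
    ⨆ s ∈ Ioc (0 : ℝ≥0) t, ⨆ B ∈ {B : Set E | MeasurableSet B},
      MeasurableSpace.comap (fun ω : JumpPath E => ω.jumpMeasure (Ioc 0 s ×ˢ B)) inferInstance

/-- The sample space carries the σ-algebra `𝓕_∞` generated by all the `𝓕_t`. -/
noncomputable instance : MeasurableSpace (JumpPath E) := ⨆ t, sigmaAlgebra E t

variable (E) in
/-- The natural filtration `(𝓕_t)_{t ≥ 0}`. -/
noncomputable def filtration : Filtration ℝ≥0 (inferInstance : MeasurableSpace (JumpPath E)) where
  seq := sigmaAlgebra E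
  mono' := fun _ _ hst => sup_le_sup_left
    (biSup_mono fun _ hr => ⟨hr.1, hr.2.trans hst⟩) _
  le' := fun t => le_iSup (sigmaAlgebra E) t

end JumpPath

/-! ### Jump processes with a given rate -/

/-- `P` is the law of the pure jump Markov process started at time `t` with initial law `μ` and
with time-dependent rate transition measure `ν(s, x, dy)`: `P` is a probability measure on `𝓕_∞`,
the initial point has law `μ`, and the compensator (dual predictable projection) of the random
measure `p` is `1_{[t, T_∞)}(s) ν(s, X_{s-}, dy) ds`, which means that
`𝔼 ∫∫ H dp = 𝔼 ∫_{[t, T_∞)} ∫ H(s, y) ν(s, X_{s-}, dy) ds`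
for every nonnegative `H` measurable for (predictable σ-algebra) `⊗` (Borel σ-algebra of `E`).
(The explicit random measure on the right-hand side is itself predictable.) -/
structure IsJumpLaw {E : Type*} [MeasurableSpace E] (t : ℝ≥0) (μ : Measure E)
    (ν : Kernel (ℝ≥0 × E) E) (P : Measure (JumpPath E)) : Prop where
  isProbability : IsProbabilityMeasure P
  init_law : P.map JumpPath.init = μ
  compensator : ∀ H : (ℝ≥0 × JumpPath E) × E → ℝ≥0∞,
    @Measurable _ _ ((JumpPath.filtration E).predictable.prod inferInstance) _ H →
    ∫⁻ ω, ∫⁻ q, H ((q.1, ω), q.2) ∂ω.jumpMeasure ∂P =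
      ∫⁻ ω, (∫⁻ s in {s : ℝ | (t : ℝ) ≤ s ∧ ENNReal.ofReal s < ω.explosionTime},
        (ω.leftState s.toNNReal).elim 0
          fun x => ∫⁻ y, H ((s.toNNReal, ω), y) ∂ν (s.toNNReal, x)) ∂P

/-! ### The control problem -/

section Control

variable {E A : Type*} [MeasurableSpace E] [MeasurableSpace A] {T : ℝ} (hT : 0 < T)

/-- The projection of the real line onto `[0,T]`. -/
noncomputable def clamp (s : ℝ) : Icc (0 : ℝ) T := projIcc 0 T hT.le s

variable (E A T) in
/-- Admissible (feedback) control laws: the Borel maps `α : [0,T] × E → A`. -/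
def Control : Type _ := {α : Icc (0 : ℝ) T × E → A // Measurable α}

instance : CoeFun (Control E A T) fun _ => Icc (0 : ℝ) T × E → A := ⟨Subtype.val⟩

theorem measurable_controlMap (α : Control E A T) :
    Measurable fun p : ℝ≥0 × E => (p.2, α (clamp hT (p.1 : ℝ), p.2)) := by
  have h : Measurable (clamp hT) := (continuous_projIcc (h := hT.le)).measurable
  exact measurable_snd.prodMk (α.2.comp
    ((h.comp (measurable_coe_nnreal_real.comp measurable_fst)).prodMk measurable_snd))

/-- The controlled rate `ν^α(s, x, dy) = lam(x, α(s, x), dy)`. After the horizon `T`, which is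
irrelevant for the control problem, the control law is frozen at time `T`. -/
noncomputable def controlledRate (lam : Kernel (E × A) E) (α : Control E A T) :
    Kernel (ℝ≥0 × E) E :=
  lam.comap (fun p => (p.2, α (clamp hT (p.1 : ℝ), p.2))) (measurable_controlMap hT α)

/-- `P` is the law of the process started from `x` at time `t` and controlled by `α`. -/
def IsControlledLaw (lam : Kernel (E × A) E) (t : Icc (0 : ℝ) T) (x : E) (α : Control E A T)
    (P : Measure (JumpPath E)) : Prop :=
  IsJumpLaw (t : ℝ).toNNReal (Measure.dirac x) (controlledRate hT lam α) P

open Classical in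
/-- The probability `ℙ^{t,x}_α`: the (unique) law satisfying `IsControlledLaw`. -/
noncomputable def controlledLaw (lam : Kernel (E × A) E) (t : Icc (0 : ℝ) T) (x : E)
    (α : Control E A T) : Measure (JumpPath E) :=
  if h : ∃ P, IsControlledLaw hT lam t x α P then h.choose else 0

/-- The gain functional
`J(t, x, α) = 𝔼^{t,x}_α [∫_t^T f(s, X_s, α(s, X_s)) ds + g(X_T)]`. -/
noncomputable def gain (lam : Kernel (E × A) E) (f : Icc (0 : ℝ) T × E × A → ℝ) (g : E → ℝ)
    (t : Icc (0 : ℝ) T) (x : E) (α : Control E A T) : ℝ :=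
  ∫ ω : JumpPath E,
    ((∫ s in (t : ℝ)..T,
        (ω.state s.toNNReal).elim 0 fun y => f (clamp hT s, y, α (clamp hT s, y))) +
      (ω.state T.toNNReal).elim 0 g) ∂(controlledLaw hT lam t x α)

/-- The value function `V(t, x) = sup_α J(t, x, α)`. -/
noncomputable def value (lam : Kernel (E × A) E) (f : Icc (0 : ℝ) T × E × A → ℝ) (g : E → ℝ)
    (t : Icc (0 : ℝ) T) (x : E) : ℝ :=
  ⨆ α : Control E A T, gain hT lam f g t x α

/-- An optimal control attains the value function from every starting time and point. -/
def IsOptimalControl (lam : Kernel (E × A) E) (f : Icc (0 : ℝ) T × E × A → ℝ) (g : E → ℝ)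
    (α : Control E A T) : Prop :=
  ∀ t x, gain hT lam f g t x α = value hT lam f g t x

/-- `𝓛^a_E v(t, x) + f(t, x, a)` where
`𝓛^a_E φ(x) = ∫ (φ(y) - φ(x)) lam(x, a, dy)`. -/
noncomputable def hamiltonian (lam : Kernel (E × A) E) (f : Icc (0 : ℝ) T × E × A → ℝ)
    (v : Icc (0 : ℝ) T × E → ℝ) (t : Icc (0 : ℝ) T) (x : E) (a : A) : ℝ :=
  (∫ y, (v (t, y) - v (t, x)) ∂(lam (x, a))) + f (t, x, a)

/-- Solutions of the HJB equation
`-∂v/∂t (t, x) = sup_a (𝓛^a_E v(t, x) + f(t, x, a))`, `v(T, x) = g(x)`. -/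
structure IsHJBSolution (lam : Kernel (E × A) E) (f : Icc (0 : ℝ) T × E × A → ℝ) (g : E → ℝ)
    (v : Icc (0 : ℝ) T × E → ℝ) : Prop where
  measurable : Measurable v
  bounded : ∃ C : ℝ, ∀ z, |v z| ≤ C
  measurable_sup : Measurable fun z : Icc (0 : ℝ) T × E => ⨆ a, hamiltonian lam f v z.1 z.2 a
  terminal : ∀ x, v (⟨T, right_mem_Icc.2 hT.le⟩, x) = g x
  absolutelyContinuous : ∀ x, AbsolutelyContinuousOnInterval (fun s => v (clamp hT s, x)) 0 T
  equation : ∀ x, ∀ᵐ s ∂(volume.restrict (Icc (0 : ℝ) T)),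
    HasDerivAt (fun r => v (clamp hT r, x)) (-(⨆ a, hamiltonian lam f v (clamp hT s) x a)) s

/-- The feedback law `α` attains the supremum in the HJB Hamiltonian at every `(t, x)`. -/
def AttainsHamiltonian (lam : Kernel (E × A) E) (f : Icc (0 : ℝ) T × E × A → ℝ)
    (v : Icc (0 : ℝ) T × E → ℝ) (α : Control E A T) : Prop :=
  ∀ t x, hamiltonian lam f v t x (α (t, x)) = ⨆ a, hamiltonian lam f v t x a

end Control

end JumpControl

/-! The proof is a verification argument: a solution of the HJB equation is built by hand, and
Dynkin's formula shows that every bounded usc solution is the value function, which also gives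
uniqueness.

Laws. A jump law with rates bounded by `L` comes from the Markov chain of jump times and marks
(`chainKernel`, run by the Ionescu-Tulcea theorem). Its compensator is computed jump by jump in
`exists_isJumpLaw`: a predictable integrand evaluated up to the next jump sees only the earlier
jumps, so conditioning on them and Fubini reduce the formula to the tail of the next jump time.

Dynkin. The compensator formula with integrand `1` bounds the mean number of jumps up to `T` by `L(T
- t)`; hence almost surely nothing jumps up to time `t` and no explosion occurs up to `T`. A
function absolutely continuous in time telescopes along such a path, and compensating its jumps
gives `dynkin_formula`.

Existence of a solution. The term `-v(x) lam(x,a,E)` in the generator need not preserve upper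
semicontinuity. Adding an atom at `x` completes the rate to the constant mass `L`
(`uniformizedRate`), so that the Hamiltonian becomes a positive integral of `v`, plus `f`, minus `L
v`. The factor `exp(Lt)` absorbs `-L v`. What remains is a fixed point equation for the integrated
`bellman` operator, which preserves bounded usc functions: positive weakly continuous kernels do
(`upperSemicontinuous_integral`), and so does a supremum over a compact set (`IsUSCBounded.iSup`).
Each Picard step halves the norm weighted by `exp(2L(T - t))`, and uniform limits of usc functions
are usc.

Verification. For a solution `w` and a control `α`, Dynkin's formula represents `w(t,x)` as the gain
of `α` with `f` increased by the nonnegative gap between the supremum of the Hamiltonian and its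
value at `α`. Thus `gain ≤ w`, with equality if `α` attains the supremum everywhere. A Borel
maximizer exists because `A` is a continuous image of the Cantor set, on which the least maximizer
can be chosen. -/

namespace JumpControl

/-! ### Jump times and marks of a path -/

namespace JumpPath

variable {E : Type*}

/-- The mark `Eₙ`, replaced by the initial point when it is `Δ`. -/
def markD (ω : JumpPath E) (n : ℕ) : E := (ω.mark n).getD ω.init

@[simp] lemma time_zero (ω : JumpPath E) : ω.time 0 = 0 := rfl

lemma time_succ (ω : JumpPath E) (n : ℕ) : ω.time (n + 1) = timeOf (ω.jump n) := rfl

@[simp] lemma markD_zero (ω : JumpPath E) : ω.markD 0 = ω.init := rfl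

lemma time_lt_time_succ (ω : JumpPath E) {n : ℕ} (h : ω.time n < ⊤) :
    ω.time n < ω.time (n + 1) := by
  cases n with
  | zero => exact ω.pos 0
  | succ n => exact ω.strict n h

lemma time_le_time_succ (ω : JumpPath E) (n : ℕ) : ω.time n ≤ ω.time (n + 1) := by
  cases n with
  | zero => exact (ω.pos 0).le
  | succ n => exact ω.mono n

lemma time_monotone (ω : JumpPath E) : Monotone ω.time :=
  monotone_nat_of_le_succ ω.time_le_time_succ

lemma jump_eq_none_of_time {ω : JumpPath E} {n : ℕ} (h : ω.time (n + 1) = ⊤) :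
    ω.jump n = none := by
  rw [time_succ] at h
  cases hj : ω.jump n with
  | none => rfl
  | some p => simp [hj, timeOf] at h

lemma jump_eq_some_of_time {ω : JumpPath E} {n : ℕ} (h : ω.time (n + 1) < ⊤) :
    ω.jump n = some ((ω.time (n + 1)).toNNReal, ω.markD (n + 1)) := by
  rw [time_succ] at *
  cases hj : ω.jump n with
  | none => simp [hj, timeOf] at h
  | some p => simp [timeOf, markD, mark, hj]

lemma mark_eq_some {ω : JumpPath E} {n : ℕ} (h : ω.time n < ⊤) :
    ω.mark n = some (ω.markD n) := by
  cases n with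
  | zero => rfl
  | succ n => simp [mark, jump_eq_some_of_time h]

lemma markD_eq_init {ω : JumpPath E} {n : ℕ} (h : ω.time n = ⊤) : ω.markD n = ω.init := by
  cases n with
  | zero => rfl
  | succ n => simp [markD, mark, jump_eq_none_of_time h]

/-- Uniqueness of the index makes the choice by `Nat.find` in `leftState` harmless: any admissible
index computes the left limit. -/
lemma eq_of_mem_interval_left {ω : JumpPath E} {s : ℝ≥0∞} {n m : ℕ}
    (hn : (n = 0 ∨ ω.time n < s) ∧ s ≤ ω.time (n + 1))
    (hm : (m = 0 ∨ ω.time m < s) ∧ s ≤ ω.time (m + 1)) : n = m := by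
  have key : ∀ {n m : ℕ}, s ≤ ω.time (n + 1) → (m = 0 ∨ ω.time m < s) → ¬ n < m := by
    intro n m h1 h2 hlt
    rcases h2 with rfl | h2
    · omega
    · exact absurd (h1.trans (ω.time_monotone hlt)) (not_le.2 h2)
  have h1 := key hn.2 hm.1
  have h2 := key hm.2 hn.1
  omega

lemma eq_of_mem_interval_right {ω : JumpPath E} {s : ℝ≥0∞} {n m : ℕ}
    (hn : ω.time n ≤ s ∧ s < ω.time (n + 1)) (hm : ω.time m ≤ s ∧ s < ω.time (m + 1)) :
    n = m := by
  have key : ∀ {n m : ℕ}, s < ω.time (n + 1) → ω.time m ≤ s → ¬ n < m := by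
    intro n m h1 h2 hlt
    exact absurd (h1.trans_le (ω.time_monotone hlt)) (not_lt.2 h2)
  have h1 := key hn.2 hm.1
  have h2 := key hm.2 hn.1
  omega

lemma leftState_eq {ω : JumpPath E} {s : ℝ≥0} {n : ℕ}
    (hn : (n = 0 ∨ ω.time n < s) ∧ (s : ℝ≥0∞) ≤ ω.time (n + 1)) :
    ω.leftState s = some (ω.markD n) := by
  have h : ∃ n, (n = 0 ∨ ω.time n < s) ∧ (s : ℝ≥0∞) ≤ ω.time (n + 1) := ⟨n, hn⟩
  classical
  have hfind := eq_of_mem_interval_left (Nat.find_spec h) hn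
  rw [leftState, dif_pos h]
  have hlt : ω.time n < ⊤ := by
    rcases hn.1 with rfl | h'
    · simp
    · exact h'.trans_le le_top
  rw [← mark_eq_some hlt, ← hfind]

lemma state_eq {ω : JumpPath E} {s : ℝ≥0} {n : ℕ}
    (hn : ω.time n ≤ s ∧ (s : ℝ≥0∞) < ω.time (n + 1)) :
    ω.state s = some (ω.markD n) := by
  have h : ∃ n, ω.time n ≤ s ∧ (s : ℝ≥0∞) < ω.time (n + 1) := ⟨n, hn⟩
  classical
  have hfind := eq_of_mem_interval_right (Nat.find_spec h) hn
  rw [state, dif_pos h]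
  have hlt : ω.time n < ⊤ := hn.1.trans_lt ENNReal.coe_lt_top
  rw [← mark_eq_some hlt, ← hfind]

lemma exists_interval_right {ω : JumpPath E} {s : ℝ≥0∞} {m : ℕ} (h : s < ω.time m) :
    ∃ n < m, ω.time n ≤ s ∧ s < ω.time (n + 1) := by
  classical
  have hex : ∃ m, s < ω.time m := ⟨m, h⟩
  have h1 := Nat.find_spec hex
  have h2 : Nat.find hex ≤ m := Nat.find_min' hex h
  obtain ⟨k, hk⟩ : ∃ k, Nat.find hex = k + 1 := by
    refine Nat.exists_eq_succ_of_ne_zero fun h0 => ?_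
    rw [h0] at h1
    simp at h1
  have h3 : ¬ s < ω.time k := Nat.find_min hex (by omega)
  exact ⟨k, by omega, not_lt.1 h3, hk ▸ h1⟩

lemma exists_interval_left {ω : JumpPath E} {s : ℝ≥0∞} {m : ℕ} (h : s ≤ ω.time m) :
    ∃ n, (n = 0 ∨ ω.time n < s) ∧ s ≤ ω.time (n + 1) := by
  classical
  have hex : ∃ m, s ≤ ω.time (m + 1) := ⟨m, h.trans (ω.time_le_time_succ m)⟩
  refine ⟨Nat.find hex, ?_, Nat.find_spec hex⟩
  rcases Nat.eq_zero_or_pos (Nat.find hex) with h0 | h0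
  · exact Or.inl h0
  · right
    obtain ⟨k, hk⟩ := Nat.exists_eq_succ_of_ne_zero h0.ne'
    have := Nat.find_min hex (m := k) (by omega)
    rw [hk]
    exact not_le.1 this

/-- Finite jump times increase strictly, so `s ≤ T_{n+1}` already forces `s < T_{n+2}`. Hence the
left intervals exhaust exactly the times before explosion. -/
lemma lt_explosionTime_iff {ω : JumpPath E} {s : ℝ≥0} :
    (s : ℝ≥0∞) < ω.explosionTime ↔
      ∃ n, (n = 0 ∨ ω.time n < s) ∧ (s : ℝ≥0∞) ≤ ω.time (n + 1) := by
  constructor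
  · intro h
    obtain ⟨m, hm⟩ := lt_iSup_iff.1 h
    exact exists_interval_left hm.le
  · rintro ⟨n, -, hn⟩
    refine lt_of_lt_of_le ?_ (le_iSup ω.time (n + 2))
    rcases eq_or_ne (ω.time (n + 1)) ⊤ with h | h
    · have := ω.time_le_time_succ (n + 1)
      rw [h, top_le_iff] at this
      rw [this]
      exact ENNReal.coe_lt_top
    · exact hn.trans_lt (ω.time_lt_time_succ (lt_top_iff_ne_top.2 h))

/-- The left limit `X_{s-}`, replaced by the initial point when it is `Δ`. -/
noncomputable def leftMark (ω : JumpPath E) (s : ℝ≥0) : E := (ω.leftState s).getD ω.init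

/-- The state `X_s`, replaced by the initial point when it is `Δ`. -/
noncomputable def stateMark (ω : JumpPath E) (s : ℝ≥0) : E := (ω.state s).getD ω.init

lemma leftState_eq_some {ω : JumpPath E} {s : ℝ≥0} (h : (s : ℝ≥0∞) < ω.explosionTime) :
    ω.leftState s = some (ω.leftMark s) := by
  obtain ⟨n, hn⟩ := lt_explosionTime_iff.1 h
  simp [leftMark, leftState_eq hn]

lemma state_eq_some {ω : JumpPath E} {s : ℝ≥0} (h : (s : ℝ≥0∞) < ω.explosionTime) :
    ω.state s = some (ω.stateMark s) := by
  obtain ⟨m, hm⟩ := lt_iSup_iff.1 h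
  obtain ⟨n, -, hn⟩ := exists_interval_right hm
  simp [stateMark, state_eq hn]

lemma leftMark_eq_stateMark {ω : JumpPath E} {s : ℝ≥0} (h : (s : ℝ≥0∞) < ω.explosionTime)
    (hs : ∀ n, ω.time n ≠ s) : ω.leftMark s = ω.stateMark s := by
  obtain ⟨n, hn⟩ := lt_explosionTime_iff.1 h
  have hr : ω.time n ≤ s ∧ (s : ℝ≥0∞) < ω.time (n + 1) := by
    refine ⟨?_, lt_of_le_of_ne hn.2 (hs _).symm⟩
    rcases hn.1 with rfl | h'
    · simp
    · exact h'.le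
  simp [leftMark, stateMark, leftState_eq hn, state_eq hr]

/-- Preimages become countable unions over the index, the form from which measurability is read off.
-/
lemma leftMark_mem_iff {ω : JumpPath E} {s : ℝ≥0} {B : Set E} :
    ω.leftMark s ∈ B ↔
      (∃ n, ((n = 0 ∨ ω.time n < s) ∧ (s : ℝ≥0∞) ≤ ω.time (n + 1)) ∧ ω.markD n ∈ B) ∨
      ((¬ ∃ n, (n = 0 ∨ ω.time n < s) ∧ (s : ℝ≥0∞) ≤ ω.time (n + 1)) ∧ ω.init ∈ B) := by
  by_cases h : ∃ n, (n = 0 ∨ ω.time n < s) ∧ (s : ℝ≥0∞) ≤ ω.time (n + 1)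
  · obtain ⟨n, hn⟩ := h
    have h1 : ω.leftMark s = ω.markD n := by simp [leftMark, leftState_eq hn]
    rw [h1]
    constructor
    · exact fun hB => Or.inl ⟨n, hn, hB⟩
    · rintro (⟨m, hm, hB⟩ | ⟨h', -⟩)
      · rwa [eq_of_mem_interval_left hn hm]
      · exact absurd ⟨n, hn⟩ h'
  · have h1 : ω.leftMark s = ω.init := by simp [leftMark, leftState, dif_neg h]
    rw [h1]
    constructor
    · exact fun hB => Or.inr ⟨h, hB⟩
    · rintro (⟨m, hm, hB⟩ | ⟨-, hB⟩)
      · exact absurd ⟨m, hm⟩ h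
      · exact hB

lemma stateMark_mem_iff {ω : JumpPath E} {s : ℝ≥0} {B : Set E} :
    ω.stateMark s ∈ B ↔
      (∃ n, (ω.time n ≤ s ∧ (s : ℝ≥0∞) < ω.time (n + 1)) ∧ ω.markD n ∈ B) ∨
      ((¬ ∃ n, ω.time n ≤ s ∧ (s : ℝ≥0∞) < ω.time (n + 1)) ∧ ω.init ∈ B) := by
  by_cases h : ∃ n, ω.time n ≤ s ∧ (s : ℝ≥0∞) < ω.time (n + 1)
  · obtain ⟨n, hn⟩ := h
    have h1 : ω.stateMark s = ω.markD n := by simp [stateMark, state_eq hn]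
    rw [h1]
    constructor
    · exact fun hB => Or.inl ⟨n, hn, hB⟩
    · rintro (⟨m, hm, hB⟩ | ⟨h', -⟩)
      · rwa [eq_of_mem_interval_right hn hm]
      · exact absurd ⟨n, hn⟩ h'
  · have h1 : ω.stateMark s = ω.init := by simp [stateMark, state, dif_neg h]
    rw [h1]
    constructor
    · exact fun hB => Or.inr ⟨h, hB⟩
    · rintro (⟨m, hm, hB⟩ | ⟨-, hB⟩)
      · exact absurd ⟨m, hm⟩ h
      · exact hB

/-! ### Measurability of jump times, marks and states -/

variable [MeasurableSpace E]

open Classical in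
lemma jumpMeasure_Ioc_prod (ω : JumpPath E) (s : ℝ≥0) {B : Set E} (hB : MeasurableSet B) :
    ω.jumpMeasure (Ioc 0 s ×ˢ B) =
      ∑' n, if ω.time (n + 1) ≤ s ∧ ω.markD (n + 1) ∈ B then 1 else 0 := by
  rw [jumpMeasure, Measure.sum_apply _ (measurableSet_Ioc.prod hB)]
  congr 1 with n
  rcases eq_or_ne (ω.time (n + 1)) ⊤ with h | h
  · simp [jump_eq_none_of_time h, h]
  · have hj := jump_eq_some_of_time (lt_top_iff_ne_top.2 h)
    have hpos : 0 < ω.time (n + 1) := ω.pos n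
    have hp : 0 < (ω.time (n + 1)).toNNReal := ENNReal.toNNReal_pos hpos.ne' h
    rw [hj, Option.elim_some, Measure.dirac_apply' _ (measurableSet_Ioc.prod hB)]
    have h1 : (ω.time (n + 1)).toNNReal ≤ s ↔ ω.time (n + 1) ≤ s := by
      rw [← ENNReal.coe_le_coe, ENNReal.coe_toNNReal h]
    simp [indicator, hp, h1]

open Classical in
lemma jumpMeasure_Ioc_prod_eq_sum (ω : JumpPath E) {s : ℝ≥0} {n : ℕ}
    (hn : ω.time n ≤ s ∧ (s : ℝ≥0∞) < ω.time (n + 1)) {B : Set E} (hB : MeasurableSet B) :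
    ω.jumpMeasure (Ioc 0 s ×ˢ B) =
      ∑ k ∈ Finset.range n, if ω.markD (k + 1) ∈ B then 1 else 0 := by
  rw [jumpMeasure_Ioc_prod ω s hB, tsum_eq_sum (s := Finset.range n)]
  · refine Finset.sum_congr rfl fun k hk => ?_
    have : ω.time (k + 1) ≤ s := (ω.time_monotone (Finset.mem_range.1 hk)).trans hn.1
    simp [this]
  · intro k hk
    rw [Finset.mem_range, not_lt] at hk
    have : ¬ ω.time (k + 1) ≤ s :=
      not_le.2 (hn.2.trans_le (ω.time_monotone (by omega)))
    simp [this]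

/-- The filtration knows only counting variables; this recovers the jump times from them as stopping
times. -/
lemma time_succ_le_iff (ω : JumpPath E) (s : ℝ≥0) (n : ℕ) :
    ω.time (n + 1) ≤ s ↔ ((n : ℝ≥0∞) + 1) ≤ ω.jumpMeasure (Ioc 0 s ×ˢ univ) := by
  classical
  rw [jumpMeasure_Ioc_prod ω s MeasurableSet.univ]
  simp only [mem_univ, and_true]
  constructor
  · intro h
    refine le_trans (le_of_eq ?_) (ENNReal.sum_le_tsum (Finset.range (n + 1)))
    rw [Finset.sum_congr rfl (g := fun _ => (1 : ℝ≥0∞))]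
    · simp
    · intro k hk
      rw [if_pos]
      exact (ω.time_monotone (by have := Finset.mem_range.1 hk; omega)).trans h
  · intro h
    by_contra hlt
    rw [tsum_eq_sum (s := Finset.range n)] at h
    · have h2 : ∑ k ∈ Finset.range n, (if ω.time (k + 1) ≤ s then (1 : ℝ≥0∞) else 0) ≤ n := by
        refine (Finset.sum_le_card_nsmul _ _ 1 ?_).trans (by simp)
        intro k _
        split_ifs <;> simp
      have h3 := h.trans h2
      norm_cast at h3
      omega
    · intro k hk
      rw [Finset.mem_range, not_lt] at hk
      rw [if_neg]
      exact fun h' => hlt ((ω.time_monotone (by omega)).trans h')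

lemma measurable_init_sigmaAlgebra (t : ℝ≥0) :
    Measurable[sigmaAlgebra E t] (JumpPath.init : JumpPath E → E) :=
  Measurable.of_comap_le le_sup_left

lemma measurable_jumpMeasure_sigmaAlgebra {s t : ℝ≥0} (hst : s ≤ t) {B : Set E}
    (hB : MeasurableSet B) :
    Measurable[sigmaAlgebra E t] fun ω : JumpPath E => ω.jumpMeasure (Ioc 0 s ×ˢ B) := by
  rcases eq_or_ne s 0 with rfl | hs
  · simp
  · refine Measurable.of_comap_le (le_sup_of_le_right ?_)
    exact (le_iSup₂_of_le B hB le_rfl).trans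
      (le_iSup₂_of_le (f := fun s (_ : s ∈ Ioc (0 : ℝ≥0) t) => ⨆ B ∈ {B : Set E | MeasurableSet B},
        MeasurableSpace.comap (fun ω : JumpPath E => ω.jumpMeasure (Ioc 0 s ×ˢ B)) inferInstance)
        s ⟨pos_of_ne_zero hs, hst⟩ le_rfl)

lemma measurableSet_time_le {s t : ℝ≥0} (hst : s ≤ t) (n : ℕ) :
    MeasurableSet[sigmaAlgebra E t] {ω : JumpPath E | ω.time n ≤ s} := by
  cases n with
  | zero => simp
  | succ n =>
    simp_rw [time_succ_le_iff]
    exact measurableSet_le measurable_const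
      (measurable_jumpMeasure_sigmaAlgebra hst MeasurableSet.univ)

/-- The mark of a jump is detected by whether the counter of jumps into `B` increases between two
rational times that isolate this jump. -/
lemma measurableSet_time_le_mark (t : ℝ≥0) (n : ℕ) {B : Set E} (hB : MeasurableSet B) :
    MeasurableSet[sigmaAlgebra E t] {ω : JumpPath E | ω.time n ≤ t ∧ ω.markD n ∈ B} := by
  cases n with
  | zero =>
    convert measurable_init_sigmaAlgebra t hB using 1
    ext; simp
  | succ n =>
    -- Capping the rational times at `t` keeps the counters measurable with respect to the
    -- information at time `t`.
    let c : ℚ → ℝ≥0 := fun i => min t (Real.toNNReal i)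
    have hc : ∀ i, c i ≤ t := fun i => min_le_left _ _
    have heq : {ω : JumpPath E | ω.time (n + 1) ≤ t ∧ ω.markD (n + 1) ∈ B} =
        ⋃ (i : ℚ) (j : ℚ), {ω : JumpPath E | ω.time n ≤ c i} ∩ {ω | ω.time (n + 1) ≤ c i}ᶜ ∩
          ({ω | ω.time (n + 1) ≤ c j} ∩ {ω | ω.time (n + 2) ≤ c j}ᶜ) ∩
          {ω | ω.jumpMeasure (Ioc 0 (c i) ×ˢ B) < ω.jumpMeasure (Ioc 0 (c j) ×ˢ B)} := by
      classical
      have key : ∀ (ω : JumpPath E) (i j : ℚ), ω.time n ≤ c i → ¬ ω.time (n + 1) ≤ c i →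
          ω.time (n + 1) ≤ c j → ¬ ω.time (n + 2) ≤ c j →
          (ω.jumpMeasure (Ioc 0 (c i) ×ˢ B) < ω.jumpMeasure (Ioc 0 (c j) ×ˢ B) ↔
            ω.markD (n + 1) ∈ B) := by
        intro ω i j h1 h2 h3 h4
        rw [jumpMeasure_Ioc_prod_eq_sum ω ⟨h1, not_le.1 h2⟩ hB,
          jumpMeasure_Ioc_prod_eq_sum ω ⟨h3, not_le.1 h4⟩ hB, Finset.sum_range_succ]
        split_ifs with h
        · refine iff_of_true (ENNReal.lt_add_right (ne_top_of_le_ne_top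
            (ENNReal.natCast_ne_top n) ?_) one_ne_zero) h
          refine (Finset.sum_le_card_nsmul _ _ 1 ?_).trans (by simp)
          intro k _
          split_ifs <;> simp
        · simp [h]
      ext ω
      simp only [mem_ofPred_eq, mem_iUnion, mem_inter_iff, mem_compl_iff]
      constructor
      · rintro ⟨ht, hm⟩
        have hfin : ω.time (n + 1) < ⊤ := ht.trans_lt ENNReal.coe_lt_top
        obtain ⟨i, -, hi1, hi2⟩ := ENNReal.lt_iff_exists_rat_btwn.1
          (ω.time_lt_time_succ ((ω.time_le_time_succ n).trans_lt hfin))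
        obtain ⟨j, -, hj1, hj2⟩ := ENNReal.lt_iff_exists_rat_btwn.1 (ω.time_lt_time_succ hfin)
        have hci : (c i : ℝ≥0∞) = min (t : ℝ≥0∞) (Real.toNNReal i) := by simp [c]
        have hcj : (c j : ℝ≥0∞) = min (t : ℝ≥0∞) (Real.toNNReal j) := by simp [c]
        have a1 : ω.time n ≤ c i := by
          rw [hci]; exact le_min ((ω.time_le_time_succ n).trans ht) hi1.le
        have a2 : ¬ ω.time (n + 1) ≤ c i := by
          rw [hci, not_le]; exact (min_le_right _ _).trans_lt hi2
        have a3 : ω.time (n + 1) ≤ c j := by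
          rw [hcj]; exact le_min ht hj1.le
        have a4 : ¬ ω.time (n + 2) ≤ c j := by
          rw [hcj, not_le]; exact (min_le_right _ _).trans_lt hj2
        exact ⟨i, j, ⟨⟨a1, a2⟩, a3, a4⟩, (key ω i j a1 a2 a3 a4).2 hm⟩
      · rintro ⟨i, j, ⟨⟨a1, a2⟩, a3, a4⟩, h⟩
        exact ⟨a3.trans (by exact_mod_cast hc j), (key ω i j a1 a2 a3 a4).1 h⟩
    rw [heq]
    refine MeasurableSet.iUnion fun i => MeasurableSet.iUnion fun j => ?_
    refine (((measurableSet_time_le (hc i) n).inter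
      (measurableSet_time_le (hc i) (n + 1)).compl).inter
      ((measurableSet_time_le (hc j) (n + 1)).inter
      (measurableSet_time_le (hc j) (n + 2)).compl)).inter ?_
    exact measurableSet_lt (measurable_jumpMeasure_sigmaAlgebra (hc i) hB)
      (measurable_jumpMeasure_sigmaAlgebra (hc j) hB)

lemma sigmaAlgebra_le (t : ℝ≥0) :
    sigmaAlgebra E t ≤ (inferInstance : MeasurableSpace (JumpPath E)) :=
  le_iSup (sigmaAlgebra E) t

lemma measurable_init : Measurable (JumpPath.init : JumpPath E → E) :=
  (measurable_init_sigmaAlgebra 0).mono (sigmaAlgebra_le 0) le_rfl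

lemma measurable_time (n : ℕ) : Measurable fun ω : JumpPath E => ω.time n := by
  refine measurable_of_Iic fun c => ?_
  rcases eq_or_ne c ⊤ with rfl | hc
  · simp
  · lift c to ℝ≥0 using hc
    exact sigmaAlgebra_le c _ (measurableSet_time_le le_rfl n)

lemma measurable_markD (n : ℕ) : Measurable fun ω : JumpPath E => ω.markD n := by
  intro B hB
  have heq : (fun ω : JumpPath E => ω.markD n) ⁻¹' B =
      (⋃ k : ℕ, {ω : JumpPath E | ω.time n ≤ (k : ℝ≥0) ∧ ω.markD n ∈ B}) ∪
        ({ω | ω.time n = ⊤} ∩ JumpPath.init ⁻¹' B) := by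
    ext ω
    simp only [mem_preimage, mem_union, mem_iUnion, mem_ofPred_eq, mem_inter_iff]
    constructor
    · intro h
      rcases eq_or_ne (ω.time n) ⊤ with ht | ht
      · exact Or.inr ⟨ht, markD_eq_init ht ▸ h⟩
      · obtain ⟨k, hk⟩ := ENNReal.exists_nat_gt ht
        exact Or.inl ⟨k, by simpa using hk.le, h⟩
    · rintro (⟨k, -, h⟩ | ⟨ht, h⟩)
      · exact h
      · rwa [markD_eq_init ht]
  rw [heq]
  refine (MeasurableSet.iUnion fun k =>
    sigmaAlgebra_le _ _ (measurableSet_time_le_mark _ n hB)).union ?_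
  exact (measurable_time n (measurableSet_singleton ⊤)).inter (measurable_init hB)

lemma measurable_stateMark :
    Measurable fun z : ℝ≥0 × JumpPath E => z.2.stateMark z.1 := by
  intro B hB
  have hs : Measurable fun z : ℝ≥0 × JumpPath E => (z.1 : ℝ≥0∞) :=
    measurable_coe_nnreal_ennreal.comp measurable_fst
  have hI : ∀ n, MeasurableSet {z : ℝ≥0 × JumpPath E |
      z.2.time n ≤ z.1 ∧ (z.1 : ℝ≥0∞) < z.2.time (n + 1)} := fun n =>
    (measurableSet_le ((measurable_time n).comp measurable_snd) hs).inter
      (measurableSet_lt hs ((measurable_time (n + 1)).comp measurable_snd))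
  have heq : (fun z : ℝ≥0 × JumpPath E => z.2.stateMark z.1) ⁻¹' B =
      (⋃ n, {z : ℝ≥0 × JumpPath E | z.2.time n ≤ z.1 ∧ (z.1 : ℝ≥0∞) < z.2.time (n + 1)} ∩
        (fun z => z.2.markD n) ⁻¹' B) ∪
      ((⋃ n, {z : ℝ≥0 × JumpPath E | z.2.time n ≤ z.1 ∧ (z.1 : ℝ≥0∞) < z.2.time (n + 1)})ᶜ ∩
        (fun z => z.2.init) ⁻¹' B) := by
    ext z
    simp only [mem_preimage, stateMark_mem_iff, mem_union, mem_iUnion, mem_inter_iff,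
      mem_ofPred_eq, mem_compl_iff]
  rw [heq]
  exact (MeasurableSet.iUnion fun n =>
    (hI n).inter (((measurable_markD n).comp measurable_snd) hB)).union
    ((MeasurableSet.iUnion hI).compl.inter ((measurable_init.comp measurable_snd) hB))

lemma measurableSet_predictable_init {B : Set E} (hB : MeasurableSet B) :
    MeasurableSet[(filtration E).predictable] {z : ℝ≥0 × JumpPath E | z.2.init ∈ B} := by
  have heq : {z : ℝ≥0 × JumpPath E | z.2.init ∈ B} =
      ({⊥} ×ˢ (JumpPath.init ⁻¹' B)) ∪ (Ioi 0 ×ˢ (JumpPath.init ⁻¹' B)) := by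
    ext ⟨s, ω⟩
    rcases eq_zero_or_pos s with rfl | hs
    · simp
    · simp [hs]
  rw [heq]
  exact (measurableSet_predictable_singleton_bot_prod (measurable_init_sigmaAlgebra _ hB)).union
    (measurableSet_predictable_Ioi_prod (measurable_init_sigmaAlgebra _ hB))

lemma measurableSet_predictable_time_lt_mark (n : ℕ) {B : Set E} (hB : MeasurableSet B) :
    MeasurableSet[(filtration E).predictable]
      {z : ℝ≥0 × JumpPath E | z.2.time n < z.1 ∧ z.2.markD n ∈ B} := by
  have heq : {z : ℝ≥0 × JumpPath E | z.2.time n < z.1 ∧ z.2.markD n ∈ B} =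
      ⋃ i : ℚ, Ioi (Real.toNNReal i) ×ˢ
        {ω : JumpPath E | ω.time n ≤ Real.toNNReal i ∧ ω.markD n ∈ B} := by
    ext ⟨s, ω⟩
    simp only [mem_ofPred_eq, mem_iUnion, mem_prod, mem_Ioi]
    constructor
    · rintro ⟨h, hB⟩
      obtain ⟨i, -, h1, h2⟩ := ENNReal.lt_iff_exists_rat_btwn.1 h
      exact ⟨i, by exact_mod_cast h2, h1.le, hB⟩
    · rintro ⟨i, h1, h2, hB⟩
      exact ⟨h2.trans_lt (by exact_mod_cast h1), hB⟩
  rw [heq]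
  exact MeasurableSet.iUnion fun i =>
    measurableSet_predictable_Ioi_prod (measurableSet_time_le_mark _ n hB)

lemma measurableSet_predictable_time_lt (n : ℕ) :
    MeasurableSet[(filtration E).predictable] {z : ℝ≥0 × JumpPath E | z.2.time n < z.1} := by
  simpa using measurableSet_predictable_time_lt_mark (E := E) n MeasurableSet.univ

lemma measurable_fst_predictable :
    Measurable[(filtration E).predictable] (Prod.fst : ℝ≥0 × JumpPath E → ℝ≥0) := by
  rw [BorelSpace.measurable_eq (α := ℝ≥0), borel_eq_generateFrom_Ioi]
  refine @measurable_generateFrom _ _ (_) _ _ ?_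
  rintro _ ⟨c, rfl⟩
  have : (Prod.fst : ℝ≥0 × JumpPath E → ℝ≥0) ⁻¹' Ioi c = Ioi c ×ˢ univ := by
    ext; simp
  rw [this]
  exact measurableSet_predictable_Ioi_prod MeasurableSet.univ

/-- The intervals `(Tₙ, Tₙ₊₁]` are open on the left, hence predictable. This is what admits
integrands depending on `X_{s-}` in the compensator formula. -/
lemma measurable_leftMark :
    Measurable[(filtration E).predictable] fun z : ℝ≥0 × JumpPath E => z.2.leftMark z.1 := by
  intro B hB
  let I : ℕ → Set (ℝ≥0 × JumpPath E) := fun n =>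
    {z | (n = 0 ∨ z.2.time n < z.1) ∧ (z.1 : ℝ≥0∞) ≤ z.2.time (n + 1)}
  have hle : ∀ n, MeasurableSet[(filtration E).predictable]
      {z : ℝ≥0 × JumpPath E | (z.1 : ℝ≥0∞) ≤ z.2.time n} := fun n => by
    have := (measurableSet_predictable_time_lt (E := E) n).compl
    simpa only [compl_ofPred, not_lt] using this
  have hI : ∀ n, MeasurableSet[(filtration E).predictable] (I n ∩ {z | z.2.markD n ∈ B}) := by
    intro n
    cases n with
    | zero =>
      convert (hle 1).inter (measurableSet_predictable_init hB) using 1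
      ext z; simp [I]
    | succ n =>
      convert (hle (n + 2)).inter (measurableSet_predictable_time_lt_mark (n + 1) hB) using 1
      ext z; simp [I]; tauto
  have hI' : ∀ n, MeasurableSet[(filtration E).predictable] (I n) := by
    intro n
    cases n with
    | zero => convert hle 1 using 1; ext z; simp [I]
    | succ n =>
      convert (hle (n + 2)).inter (measurableSet_predictable_time_lt (n + 1)) using 1
      ext z; simp [I]; tauto
  have heq : (fun z : ℝ≥0 × JumpPath E => z.2.leftMark z.1) ⁻¹' B =
      (⋃ n, I n ∩ {z | z.2.markD n ∈ B}) ∪ ((⋃ n, I n)ᶜ ∩ {z | z.2.init ∈ B}) := by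
    ext z
    simp only [mem_preimage, leftMark_mem_iff, mem_union, mem_iUnion, mem_inter_iff,
      mem_ofPred_eq, mem_compl_iff, I]
  rw [heq]
  exact (MeasurableSet.iUnion hI).union
    ((MeasurableSet.iUnion hI').compl.inter (measurableSet_predictable_init hB))

lemma predictable_le :
    (filtration E).predictable ≤ (inferInstance : MeasurableSpace (ℝ≥0 × JumpPath E)) := by
  refine MeasurableSpace.generateFrom_le ?_
  rintro _ (⟨A, hA, rfl⟩ | ⟨i, A, hA, rfl⟩)
  · exact (measurableSet_singleton _).prod (sigmaAlgebra_le _ _ hA)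
  · exact measurableSet_Ioi.prod (sigmaAlgebra_le _ _ hA)

/-! ### Predictable events only see the strict past -/

/-- The sets that do not separate two given points form a σ-algebra, so generators suffice. -/
lemma mem_iff_mem_of_generateFrom {α : Type*} {C : Set (Set α)} {x y : α}
    (h : ∀ s ∈ C, (x ∈ s ↔ y ∈ s)) {s : Set α}
    (hs : MeasurableSet[MeasurableSpace.generateFrom C] s) : x ∈ s ↔ y ∈ s := by
  induction s, hs using MeasurableSpace.generateFrom_induction with
  | hC t ht _ => exact h t ht
  | empty => simp
  | compl t _ ih => simp [ih]
  | iUnion f _ ih => simp [ih]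

/-- When both paths have their next jump after `q`, every counter up to time `q` depends only on the
shared jumps. -/
lemma mem_iff_of_sigmaAlgebra {ω ω' : JumpPath E} {n : ℕ} {q : ℝ≥0} (hi : ω.init = ω'.init)
    (hj : ∀ k < n, ω.jump k = ω'.jump k) (h : (q : ℝ≥0∞) < ω.time (n + 1))
    (h' : (q : ℝ≥0∞) < ω'.time (n + 1)) {F : Set (JumpPath E)}
    (hF : MeasurableSet[sigmaAlgebra E q] F) : ω ∈ F ↔ ω' ∈ F := by
  have hle : sigmaAlgebra E q ≤ MeasurableSpace.generateFrom {F | ω ∈ F ↔ ω' ∈ F} := by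
    refine sup_le ?_ (iSup₂_le fun s hs => iSup₂_le fun B hB => ?_)
    · rintro _ ⟨B, -, rfl⟩
      exact MeasurableSpace.measurableSet_generateFrom (by simp [hi])
    · rintro _ ⟨D, -, rfl⟩
      refine MeasurableSpace.measurableSet_generateFrom ?_
      have heq : ω.jumpMeasure (Ioc 0 s ×ˢ B) = ω'.jumpMeasure (Ioc 0 s ×ˢ B) := by
        classical
        rw [jumpMeasure_Ioc_prod ω s hB, jumpMeasure_Ioc_prod ω' s hB]
        congr 1 with k
        rcases lt_or_ge k n with hk | hk
        · have h1 : ω.time (k + 1) = ω'.time (k + 1) := by simp [time_succ, hj k hk]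
          have h2 : ω.markD (k + 1) = ω'.markD (k + 1) := by simp [markD, mark, hj k hk, hi]
          rw [h1, h2]
        · have hs' : (s : ℝ≥0∞) ≤ q := by exact_mod_cast hs.2
          have h1 : ¬ ω.time (k + 1) ≤ s :=
            not_le.2 ((hs'.trans_lt h).trans_le (ω.time_monotone (by omega)))
          have h2 : ¬ ω'.time (k + 1) ≤ s :=
            not_le.2 ((hs'.trans_lt h').trans_le (ω'.time_monotone (by omega)))
          simp [h1, h2]
      simp [heq]
  exact mem_iff_mem_of_generateFrom (fun s hs => hs) (hle _ hF)

/-- A generator `(q, ∞) × F` containing time `s` has `q < s`, so the strict inequality required at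
`q` follows even when `s` is itself the next jump time. -/
lemma mem_iff_of_predictable {ω ω' : JumpPath E} {n : ℕ} {s : ℝ≥0} (hi : ω.init = ω'.init)
    (hj : ∀ k < n, ω.jump k = ω'.jump k) (h : (s : ℝ≥0∞) ≤ ω.time (n + 1))
    (h' : (s : ℝ≥0∞) ≤ ω'.time (n + 1)) {D : Set (ℝ≥0 × JumpPath E)}
    (hD : MeasurableSet[(filtration E).predictable] D) : (s, ω) ∈ D ↔ (s, ω') ∈ D := by
  refine mem_iff_mem_of_generateFrom ?_ hD
  rintro _ (⟨A, hA, rfl⟩ | ⟨q, A, hA, rfl⟩)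
  · have hpos : ∀ ω : JumpPath E, ((⊥ : ℝ≥0) : ℝ≥0∞) < ω.time (n + 1) := fun ω => ω.pos n
    simp only [mem_prod]
    exact and_congr_right fun _ => mem_iff_of_sigmaAlgebra hi hj (hpos ω) (hpos ω') hA
  · simp only [mem_prod]
    refine and_congr_right fun hq => ?_
    have hq' : (q : ℝ≥0∞) < s := by exact_mod_cast hq
    exact mem_iff_of_sigmaAlgebra hi hj (hq'.trans_le h) (hq'.trans_le h') hA

lemma apply_eq_of_predictable {ω ω' : JumpPath E} {n : ℕ} {s : ℝ≥0} (hi : ω.init = ω'.init)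
    (hj : ∀ k < n, ω.jump k = ω'.jump k) (h : (s : ℝ≥0∞) ≤ ω.time (n + 1))
    (h' : (s : ℝ≥0∞) ≤ ω'.time (n + 1)) {H : (ℝ≥0 × JumpPath E) × E → ℝ≥0∞}
    (hH : @Measurable _ _ ((filtration E).predictable.prod inferInstance) _ H) (y : E) :
    H ((s, ω), y) = H ((s, ω'), y) := by
  have hsec : @Measurable _ _ (filtration E).predictable _ fun z => H (z, y) :=
    hH.comp (@measurable_prodMk_right _ _ (filtration E).predictable _ y)
  have := (mem_iff_of_predictable hi hj h h'
    (hsec (measurableSet_singleton (H ((s, ω'), y))))).2 rfl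
  exact this

end JumpPath

end JumpControl

namespace JumpControl

/-! ### Exponential survival functions -/

lemma integral_eq_sub_of_absolutelyContinuousOnInterval {f f' : ℝ → ℝ} {a b : ℝ}
    (hf : AbsolutelyContinuousOnInterval f a b)
    (hf' : ∀ᵐ x, x ∈ uIoc a b → HasDerivAt f (f' x) x) :
    ∫ x in a..b, f' x = f b - f a := by
  rw [← hf.integral_deriv_eq_sub]
  refine intervalIntegral.integral_congr_ae ?_
  filter_upwards [hf'] with x hx hxm
  exact (hx hxm).deriv.symm

lemma intervalIntegrable_of_measurable_bounded {c : ℝ → ℝ} (hc : Measurable c) {L : ℝ}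
    (hL : ∀ u, |c u| ≤ L) (a b : ℝ) : IntervalIntegrable c volume a b :=
  (intervalIntegrable_const (c := L)).mono_fun hc.aestronglyMeasurable
    (Filter.Eventually.of_forall fun u => by
      simpa using (hL u).trans (le_abs_self L))

/-- Yields the Lipschitz bound, hence the absolute continuity, of the survival function of a bounded
measurable rate. -/
lemma exp_neg_integral_sub_le {c : ℝ → ℝ} (hc : Measurable c) (h0 : ∀ u, 0 ≤ c u) {L : ℝ}
    (hL : ∀ u, c u ≤ L) {s x y : ℝ} (hsx : s ≤ x) (hxy : x ≤ y) :
    |Real.exp (-∫ u in s..x, c u) - Real.exp (-∫ u in s..y, c u)| ≤ L * (y - x) := by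
  have hi := intervalIntegrable_of_measurable_bounded hc
    (fun u => (abs_of_nonneg (h0 u)).trans_le (hL u))
  have hadd := intervalIntegral.integral_add_adjacent_intervals (hi s x) (hi x y)
  have h1 : 0 ≤ ∫ u in s..x, c u := intervalIntegral.integral_nonneg hsx fun u _ => h0 u
  have h2 : 0 ≤ ∫ u in x..y, c u := intervalIntegral.integral_nonneg hxy fun u _ => h0 u
  have h3 : ∫ u in x..y, c u ≤ L * (y - x) := by
    have := intervalIntegral.integral_mono_on hxy (hi x y)
      (intervalIntegrable_const (c := L)) fun u _ => hL u
    simpa [mul_comm] using this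
  rw [← hadd, neg_add, Real.exp_add]
  have h4 := Real.add_one_le_exp (-∫ u in x..y, c u)
  have h5 : Real.exp (-∫ u in s..x, c u) ≤ 1 := Real.exp_le_one_iff.2 (by linarith)
  have h6 := Real.exp_pos (-∫ u in s..x, c u)
  have h7 : Real.exp (-∫ u in x..y, c u) ≤ 1 := Real.exp_le_one_iff.2 (by linarith)
  rw [abs_of_nonneg (by nlinarith)]
  nlinarith

/-- The rate is only measurable, so the exponential is differentiable only almost everywhere;
absolute continuity still allows the fundamental theorem of calculus. -/
lemma integral_rate_mul_exp_neg {c : ℝ → ℝ} (hc : Measurable c) (h0 : ∀ u, 0 ≤ c u) {L : ℝ}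
    (hL : ∀ u, c u ≤ L) {s b : ℝ} (hsb : s ≤ b) :
    ∫ r in s..b, c r * Real.exp (-∫ u in s..r, c u) = 1 - Real.exp (-∫ u in s..b, c u) := by
  have hi := intervalIntegrable_of_measurable_bounded hc
    (fun u => (abs_of_nonneg (h0 u)).trans_le (hL u))
  have hL0 : 0 ≤ L := (h0 0).trans (hL 0)
  have hAC : AbsolutelyContinuousOnInterval (fun r => Real.exp (-∫ u in s..r, c u)) s b := by
    refine LipschitzOnWith.absolutelyContinuousOnInterval (K := L.toNNReal) ?_
    refine LipschitzOnWith.of_dist_le_mul fun x hx y hy => ?_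
    rw [uIcc_of_le hsb] at hx hy
    rw [Real.coe_toNNReal L hL0, Real.dist_eq, Real.dist_eq]
    rcases le_total x y with hxy | hxy
    · rw [abs_sub_comm x y, abs_of_nonneg (sub_nonneg.2 hxy)]
      exact exp_neg_integral_sub_le hc h0 hL hx.1 hxy
    · rw [abs_sub_comm, abs_of_nonneg (sub_nonneg.2 hxy)]
      exact exp_neg_integral_sub_le hc h0 hL hy.1 hxy
  have hd : ∀ᵐ x, x ∈ uIoc s b → HasDerivAt (fun r => Real.exp (-∫ u in s..r, c u))
      (-(c x * Real.exp (-∫ u in s..x, c u))) x := by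
    filter_upwards [(hi s b).ae_hasDerivAt_integral] with x hx hxm
    have h1 : HasDerivAt (fun r => Real.exp (-∫ u in s..r, c u))
        (Real.exp (-∫ u in s..x, c u) * -c x) x :=
      (hx (uIoc_subset_uIcc hxm) s left_mem_uIcc).neg.exp
    convert h1 using 1
    ring
  have h := integral_eq_sub_of_absolutelyContinuousOnInterval hAC hd
  rw [intervalIntegral.integral_neg] at h
  simp at h
  linarith

/-! ### The law of the next jump -/

section NextJump

variable {E : Type*} [MeasurableSpace E]

/-- Lebesgue measure on `[t, ∞)`. -/
noncomputable def timeMeasure (t : ℝ≥0) : Measure ℝ≥0 :=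
  (volume.restrict (Ici (t : ℝ))).map Real.toNNReal

instance (t : ℝ≥0) : SFinite (timeMeasure t) := by unfold timeMeasure; infer_instance

lemma lintegral_timeMeasure (t : ℝ≥0) {F : ℝ≥0 → ℝ≥0∞} (hF : Measurable F) :
    ∫⁻ u, F u ∂timeMeasure t = ∫⁻ u in Ici (t : ℝ), F u.toNNReal :=
  lintegral_map hF measurable_real_toNNReal

instance (t : ℝ≥0) : NullSingletonClass (timeMeasure t) := by
  refine ⟨fun a => ?_⟩
  rw [timeMeasure, Measure.map_apply measurable_real_toNNReal (measurableSet_singleton a),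
    Measure.restrict_apply (measurable_real_toNNReal (measurableSet_singleton a))]
  refine measure_mono_null (t := {(a : ℝ)}) ?_ (by simp)
  rintro u ⟨hu, hut⟩
  have h0 : 0 ≤ u := t.2.trans hut
  rw [mem_preimage, mem_singleton_iff] at hu
  simp [← hu, h0]

open Classical in
-- The endpoint `r` is null, so the open interval can be traded for the half-open one of interval
-- integrals.
lemma lintegral_timeMeasure_Ioo (t : ℝ≥0) {F : ℝ≥0 → ℝ≥0∞} (hF : Measurable F) {s r : ℝ≥0} :
    ∫⁻ u, (if s < u ∧ u < r then F u else 0) ∂timeMeasure t =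
      ∫⁻ u in Ioc (s : ℝ) r, (if (t : ℝ) ≤ u then F u.toNNReal else 0) := by
  have hm : MeasurableSet {u : ℝ≥0 | s < u ∧ u < r} := measurableSet_Ioo
  rw [lintegral_timeMeasure t (Measurable.ite hm hF measurable_const),
    ← lintegral_indicator measurableSet_Ici, ← lintegral_indicator measurableSet_Ioc]
  refine lintegral_congr_ae ?_
  filter_upwards [Measure.ae_ne volume (r : ℝ)] with u hu
  simp only [indicator, mem_Ici, mem_Ioc]
  by_cases ht : (t : ℝ) ≤ u
  · have h0 : 0 ≤ u := t.2.trans ht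
    have h1 : (s < u.toNNReal ∧ u.toNNReal < r) ↔ ((s : ℝ) < u ∧ u ≤ r) := by
      lift u to ℝ≥0 using h0
      simp only [Real.toNNReal_coe, NNReal.coe_lt_coe, NNReal.coe_le_coe]
      have : u ≠ r := by exact_mod_cast hu
      exact and_congr_right fun _ => ⟨le_of_lt, fun h => lt_of_le_of_ne h this⟩
    simp [ht, h1]
  · simp [ht]

variable (t : ℝ≥0) (ν : Kernel (ℝ≥0 × E) E)

open Classical in
/-- The cumulated rate at the point `z.2` on the time interval `(z.1, r)`. -/
noncomputable def cumRate (z : ℝ≥0∞ × E) (r : ℝ≥0) : ℝ≥0∞ :=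
  ∫⁻ u : ℝ≥0, (if z.1 < u ∧ u < r then ν (u, z.2) univ else 0) ∂timeMeasure t

/-- The probability that there is no jump in `(z.1, r)` when starting at time `z.1` in `z.2`. -/
noncomputable def survival (z : ℝ≥0∞ × E) (r : ℝ≥0) : ℝ≥0∞ :=
  ENNReal.ofReal (Real.exp (-(cumRate t ν z r).toReal))

lemma measurable_survival : Measurable fun p : (ℝ≥0∞ × E) × ℝ≥0 => survival t ν p.1 p.2 := by
  have hc : Measurable fun p : (ℝ≥0∞ × E) × ℝ≥0 => cumRate t ν p.1 p.2 := by
    classical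
    refine Measurable.lintegral_prod_right' (f := fun q : ((ℝ≥0∞ × E) × ℝ≥0) × ℝ≥0 =>
      if q.1.1.1 < q.2 ∧ q.2 < q.1.2 then ν (q.2, q.1.1.2) univ else 0) ?_
    have h1 : MeasurableSet {q : ((ℝ≥0∞ × E) × ℝ≥0) × ℝ≥0 | q.1.1.1 < q.2} :=
      measurableSet_lt (by fun_prop) (by fun_prop)
    have h2 : MeasurableSet {q : ((ℝ≥0∞ × E) × ℝ≥0) × ℝ≥0 | q.2 < q.1.2} :=
      measurableSet_lt (by fun_prop) (by fun_prop)
    refine Measurable.ite (h1.inter h2) ?_ measurable_const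
    · exact (ν.measurable_coe MeasurableSet.univ).comp (by fun_prop)
  exact (Real.measurable_exp.comp hc.ennreal_toReal.neg).ennreal_ofReal

variable {ν} in
-- Either the next jump falls in `(s, r)` or it does not: the density of the jump time integrates to
-- one minus the survival probability.
lemma survival_add_lintegral {L : ℝ≥0} (hν : ∀ p, ν p univ ≤ L) {s r : ℝ≥0} (hsr : s ≤ r)
    (x : E) :
    (∫⁻ u : ℝ≥0, (if (s : ℝ≥0∞) < u ∧ u < r then
      survival t ν (s, x) u * ν (u, x) univ else 0) ∂timeMeasure t) + survival t ν (s, x) r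
      = 1 := by
  classical
  -- The rate is switched off before time `t`, which encodes that integration is against
  -- `timeMeasure t`.
  let c : ℝ → ℝ := fun u => if (t : ℝ) ≤ u then (ν (u.toNNReal, x) univ).toReal else 0
  have hνm : Measurable fun u : ℝ≥0 => ν (u, x) univ :=
    (ν.measurable_coe MeasurableSet.univ).comp measurable_prodMk_right
  have hνfin : ∀ p, ν p univ ≠ ⊤ := fun p => ne_top_of_le_ne_top ENNReal.coe_ne_top (hν p)
  have hc : Measurable c := Measurable.ite measurableSet_Ici
    (hνm.comp measurable_real_toNNReal).ennreal_toReal measurable_const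
  have hc0 : ∀ u, 0 ≤ c u := fun u => by
    simp only [c]; split_ifs <;> simp
  have hcL : ∀ u, c u ≤ (L : ℝ) := fun u => by
    simp only [c]
    split_ifs
    · exact ENNReal.toReal_le_coe_of_le_coe (hν _)
    · exact L.2
  have hi := intervalIntegrable_of_measurable_bounded hc
    (fun u => (abs_of_nonneg (hc0 u)).trans_le (hcL u))
  have hofReal : ∀ u, ENNReal.ofReal (c u) =
      if (t : ℝ) ≤ u then ν (u.toNNReal, x) univ else 0 := fun u => by
    simp only [c]
    split_ifs
    · exact ENNReal.ofReal_toReal (hνfin _)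
    · simp
  have hcum : ∀ b : ℝ≥0, s ≤ b → cumRate t ν (s, x) b = ENNReal.ofReal (∫ u in (s : ℝ)..b, c u) := by
    intro b hb
    have hb' : (s : ℝ) ≤ b := hb
    rw [intervalIntegral.integral_of_le hb', ofReal_integral_eq_lintegral_ofReal
      ((intervalIntegrable_iff_integrableOn_Ioc_of_le hb').1 (hi s b))
      (Filter.Eventually.of_forall hc0), cumRate]
    simp only [ENNReal.coe_lt_coe, hofReal]
    exact lintegral_timeMeasure_Ioo t hνm
  have hsurv : ∀ b : ℝ≥0, s ≤ b → survival t ν (s, x) b =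
      ENNReal.ofReal (Real.exp (-∫ u in (s : ℝ)..b, c u)) := by
    intro b hb
    have hb' : (s : ℝ) ≤ b := hb
    rw [survival, hcum b hb, ENNReal.toReal_ofReal
      (intervalIntegral.integral_nonneg hb' fun u _ => hc0 u)]
  have hsr' : (s : ℝ) ≤ r := hsr
  have hcont : Continuous fun b => Real.exp (-∫ u in (s : ℝ)..b, c u) :=
    Real.continuous_exp.comp (intervalIntegral.continuous_primitive hi _).neg
  have hint : IntervalIntegrable (fun b => c b * Real.exp (-∫ u in (s : ℝ)..b, c u)) volume s r :=
    (hi s r).mul_continuousOn hcont.continuousOn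
  have hkey : (∫⁻ u : ℝ≥0, (if (s : ℝ≥0∞) < u ∧ u < r then
      survival t ν (s, x) u * ν (u, x) univ else 0) ∂timeMeasure t) =
      ENNReal.ofReal (∫ b in (s : ℝ)..r, c b * Real.exp (-∫ u in (s : ℝ)..b, c u)) := by
    rw [intervalIntegral.integral_of_le hsr', ofReal_integral_eq_lintegral_ofReal
      ((intervalIntegrable_iff_integrableOn_Ioc_of_le hsr').1 hint)
      (Filter.Eventually.of_forall fun b => mul_nonneg (hc0 b) (Real.exp_pos _).le)]
    simp only [ENNReal.coe_lt_coe]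
    rw [lintegral_timeMeasure_Ioo t (F := fun u => survival t ν (s, x) u * ν (u, x) univ)
      (((measurable_survival t ν).comp measurable_prodMk_left).mul hνm)]
    refine setLIntegral_congr_fun measurableSet_Ioc fun u hu => ?_
    have hu0 : 0 ≤ u := s.2.trans hu.1.le
    rw [ENNReal.ofReal_mul (hc0 u), hofReal, mul_comm]
    split_ifs
    · rw [hsurv _ (by rw [← NNReal.coe_le_coe, Real.coe_toNNReal u hu0]; exact hu.1.le),
        Real.coe_toNNReal u hu0]
    · simp
  rw [hkey, hsurv r hsr, integral_rate_mul_exp_neg hc hc0 hcL hsr', ← ENNReal.ofReal_add]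
  · simp
  · rw [sub_nonneg]
    exact Real.exp_le_one_iff.2 (neg_nonpos.2
      (intervalIntegral.integral_nonneg hsr' fun u _ => hc0 u))
  · exact (Real.exp_pos _).le

open Classical in
/-- The sub-Markov law of the next jump time and of the next mark, starting at time `z.1` in the
point `z.2`. -/
noncomputable def jumpKernel [IsFiniteKernel ν] : Kernel (ℝ≥0∞ × E) (ℝ≥0 × E) :=
  Kernel.withDensity ((Kernel.const (ℝ≥0∞ × E) (timeMeasure t)) ⊗ₖ
    (ν.comap (fun q : (ℝ≥0∞ × E) × ℝ≥0 => (q.2, q.1.2)) (by fun_prop)))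
    fun z p => if z.1 < p.1 then survival t ν z p.1 else 0

open Classical in
lemma lintegral_jumpKernel [IsFiniteKernel ν] (z : ℝ≥0∞ × E) {F : ℝ≥0 × E → ℝ≥0∞}
    (hF : Measurable F) :
    ∫⁻ p, F p ∂jumpKernel t ν z = ∫⁻ r : ℝ≥0, (if z.1 < r then survival t ν z r *
      ∫⁻ y, F (r, y) ∂ν (r, z.2) else 0) ∂timeMeasure t := by
  have hm : Measurable (Function.uncurry fun (z : ℝ≥0∞ × E) (p : ℝ≥0 × E) =>
      if z.1 < p.1 then survival t ν z p.1 else 0) := by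
    refine Measurable.ite (measurableSet_lt (by fun_prop) (by fun_prop)) ?_ measurable_const
    exact (measurable_survival t ν).comp (f := fun q : (ℝ≥0∞ × E) × (ℝ≥0 × E) => (q.1, q.2.1))
      (by fun_prop)
  rw [jumpKernel, Kernel.lintegral_withDensity _ hm _ hF, Kernel.lintegral_compProd]
  · rw [Kernel.lintegral_const]
    refine lintegral_congr fun r => ?_
    rw [Kernel.comap_apply]
    dsimp only
    split_ifs
    · exact lintegral_const_mul _ (hF.comp measurable_prodMk_left)
    · simp
  · exact (hm.comp measurable_prodMk_left).mul hF

variable {ν} in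
-- Monotone convergence over the horizons `s + n`, on each of which `survival_add_lintegral` bounds
-- the mass by one. From `⊤` there is no later time, and the mass vanishes.
lemma jumpKernel_univ_le [IsFiniteKernel ν] {L : ℝ≥0} (hν : ∀ p, ν p univ ≤ L)
    (z : ℝ≥0∞ × E) : jumpKernel t ν z univ ≤ 1 := by
  classical
  rw [← lintegral_one, lintegral_jumpKernel t ν z measurable_const]
  simp only [lintegral_one]
  obtain ⟨s, x⟩ := z
  rcases eq_or_ne s ⊤ with rfl | hs
  · simp
  lift s to ℝ≥0 using hs
  have hνm : Measurable fun u : ℝ≥0 => ν (u, x) univ :=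
    (ν.measurable_coe MeasurableSet.univ).comp measurable_prodMk_right
  have hsup : ∀ r : ℝ≥0, (if ((s : ℝ≥0∞), x).1 < r then
      survival t ν (s, x) r * ν (r, x) univ else 0) =
      ⨆ n : ℕ, if (s : ℝ≥0∞) < r ∧ r < (s + n : ℝ≥0) then
        survival t ν (s, x) r * ν (r, x) univ else 0 := by
    intro r
    refine le_antisymm ?_ (iSup_le fun n => ?_)
    · obtain ⟨n, hn⟩ := exists_nat_gt r
      refine le_iSup_of_le n ?_
      have : r < s + n := hn.trans_le le_add_self
      simp [this]
    · split_ifs <;> simp_all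
  simp_rw [hsup]
  rw [lintegral_iSup]
  · refine iSup_le fun n => ?_
    rw [← survival_add_lintegral t hν (le_self_add : s ≤ s + n) x]
    exact le_self_add
  · intro n
    have h1 : MeasurableSet {r : ℝ≥0 | (s : ℝ≥0∞) < r} :=
      measurableSet_lt (by fun_prop) (by fun_prop)
    have h2 : MeasurableSet {r : ℝ≥0 | r < (s + n : ℝ≥0)} :=
      measurableSet_lt (by fun_prop) (by fun_prop)
    refine Measurable.ite (h1.inter h2) ?_ measurable_const
    · exact ((measurable_survival t ν).comp measurable_prodMk_left).mul hνm
  · intro n m hnm r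
    have : r < s + n → r < s + m := fun h => h.trans_le (by gcongr)
    by_cases h : (s : ℝ≥0∞) < r ∧ r < s + n
    · simp [h.1, h.2, this h.2]
    · simp only [h, if_false]; exact zero_le

/-- The Markov kernel of the chain `(Tₙ, Eₙ)`. -/
noncomputable def chainKernel [IsFiniteKernel ν] : Kernel (ℝ≥0∞ × E) (ℝ≥0∞ × E) :=
  (jumpKernel t ν).map (fun p => ((p.1 : ℝ≥0∞), p.2)) +
    -- The missing mass is the probability of no further jump; it is placed at time `⊤`, where the
    -- chain then stays.
    Kernel.withDensity (Kernel.deterministic (fun z : ℝ≥0∞ × E => ((⊤ : ℝ≥0∞), z.2))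
      (by fun_prop)) fun z _ => 1 - jumpKernel t ν z univ

lemma lintegral_chainKernel [IsFiniteKernel ν] (z : ℝ≥0∞ × E) {F : ℝ≥0∞ × E → ℝ≥0∞}
    (hF : Measurable F) :
    ∫⁻ p, F p ∂chainKernel t ν z = ∫⁻ p, F (p.1, p.2) ∂jumpKernel t ν z +
      (1 - jumpKernel t ν z univ) * F (⊤, z.2) := by
  have hd : Measurable (Function.uncurry fun (z : ℝ≥0∞ × E) (_ : ℝ≥0∞ × E) =>
      1 - jumpKernel t ν z univ) :=
    measurable_const.sub (((jumpKernel t ν).measurable_coe MeasurableSet.univ).comp measurable_fst)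
  rw [chainKernel, add_apply, lintegral_add_measure,
    Kernel.lintegral_map _ (by fun_prop) _ hF,
    Kernel.lintegral_withDensity _ hd _ hF,
    Kernel.lintegral_deterministic' (f := fun p => (1 - jumpKernel t ν z univ) * F p) _
      (measurable_const.mul hF)]

variable {ν} in
lemma isMarkovKernel_chainKernel [IsFiniteKernel ν] {L : ℝ≥0} (hν : ∀ p, ν p univ ≤ L) :
    IsMarkovKernel (chainKernel t ν) := by
  refine ⟨fun z => ⟨?_⟩⟩
  rw [← lintegral_one, lintegral_chainKernel t ν z measurable_const]
  simp [jumpKernel_univ_le t hν z]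

variable {ν} in
/-- The chain kernel charges only times after the present one. -/
lemma ae_chainKernel [IsFiniteKernel ν] (z : ℝ≥0∞ × E) :
    ∀ᵐ p ∂chainKernel t ν z, z.1 < p.1 ∨ p.1 = ⊤ := by
  classical
  have hm : MeasurableSet {p : ℝ≥0∞ × E | ¬ (z.1 < p.1 ∨ p.1 = ⊤)} :=
    ((measurableSet_lt measurable_const measurable_fst).union
      (measurable_fst (measurableSet_singleton ⊤))).compl
  rw [ae_iff, ← lintegral_indicator_one hm, lintegral_chainKernel t ν z
    (measurable_one.indicator hm), lintegral_jumpKernel t ν z]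
  · rw [lintegral_eq_zero_of_ae_eq_zero]
    · simp
    · refine Filter.Eventually.of_forall fun r => ?_
      by_cases h : z.1 < r <;> simp [h]
  · exact (measurable_one.indicator hm).comp (by fun_prop)

variable {ν} in
-- The tail of the next jump time. It is the identity that turns the density of a jump into its
-- compensator.
lemma chainKernel_le [IsFiniteKernel ν] {L : ℝ≥0} (hν : ∀ p, ν p univ ≤ L) (z : ℝ≥0∞ × E)
    {r : ℝ≥0} (hr : z.1 < r) : chainKernel t ν z {p | (r : ℝ≥0∞) ≤ p.1} = survival t ν z r := by
  classical
  obtain ⟨s, x⟩ := z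
  have hs : s ≠ ⊤ := hr.ne_top
  change s < r at hr
  lift s to ℝ≥0 using hs
  have hr' : s < r := by exact_mod_cast hr
  have := isMarkovKernel_chainKernel t hν
  have hm : MeasurableSet {p : ℝ≥0∞ × E | p.1 < r} :=
    measurableSet_lt measurable_fst measurable_const
  have h1 : chainKernel t ν (s, x) {p | p.1 < r} + survival t ν (s, x) r = 1 := by
    rw [← survival_add_lintegral t hν hr'.le x]
    congr 1
    rw [← lintegral_indicator_one hm, lintegral_chainKernel t ν _ (measurable_one.indicator hm),
      lintegral_jumpKernel t ν _ (F := fun p : ℝ≥0 × E =>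
        {p : ℝ≥0∞ × E | p.1 < r}.indicator 1 ((p.1 : ℝ≥0∞), p.2))
        ((measurable_one.indicator hm).comp (by fun_prop))]
    simp only [indicator, mem_ofPred_eq, not_top_lt, if_false, mul_zero, add_zero]
    refine lintegral_congr fun u => ?_
    by_cases h1 : s < u <;> by_cases h2 : u < r <;> simp [h1, h2]
  have h2 : {p : ℝ≥0∞ × E | (r : ℝ≥0∞) ≤ p.1} = {p : ℝ≥0∞ × E | p.1 < r}ᶜ := by
    ext; simp
  have h3 := prob_compl_eq_one_sub (μ := chainKernel t ν (s, x)) hm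
  rw [h2, h3, ← h1, ENNReal.add_sub_cancel_left (measure_ne_top _ _)]

end NextJump

end JumpControl

namespace JumpControl

/-! ### Markov chains -/

section MarkovChain

variable {S : Type*} [MeasurableSpace S]

/-- The kernels of a homogeneous Markov chain, depending on the whole past. -/
noncomputable def pastKernel (κ : Kernel S S) (n : ℕ) :
    Kernel ((i : Finset.Iic n) → (fun _ : ℕ => S) i) ((fun _ : ℕ => S) (n + 1)) :=
  κ.comap (fun w => w ⟨n, by simp⟩) (by fun_prop)

instance (κ : Kernel S S) [IsMarkovKernel κ] (n : ℕ) : IsMarkovKernel (pastKernel κ n) := by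
  unfold pastKernel; infer_instance

/-- The law of the Markov chain with transition kernel `κ` and initial point `z`. -/
noncomputable def chainMeasure (κ : Kernel S S) [IsMarkovKernel κ] (z : S) : Measure (ℕ → S) :=
  Kernel.traj (X := fun _ => S) (pastKernel κ) 0 fun _ => z

instance (κ : Kernel S S) [IsMarkovKernel κ] (z : S) :
    IsProbabilityMeasure (chainMeasure κ z) := by
  unfold chainMeasure; infer_instance

/-- The sequence `ξ` with its terms of index above `n` replaced by `z`. -/
def truncate (z : S) (n : ℕ) (ξ : ℕ → S) : ℕ → S := fun k => if k ≤ n then ξ k else z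

/-- The Markov property at step `n`. Functionals of the past are expressed through `truncate`, so
that they live on whole sequences and can be fed to `toPath`. -/
lemma lintegral_chainMeasure (κ : Kernel S S) [IsMarkovKernel κ] (z z' : S) (n : ℕ)
    {F : (ℕ → S) × S → ℝ≥0∞} (hF : Measurable F) :
    ∫⁻ ξ, F (truncate z' n ξ, ξ (n + 1)) ∂chainMeasure κ z =
      ∫⁻ ξ, ∫⁻ p, F (truncate z' n ξ, p) ∂κ (ξ n) ∂chainMeasure κ z := by
  let ext : ((i : Finset.Iic n) → S) → ℕ → S :=
    fun w k => if h : k ≤ n then w ⟨k, Finset.mem_Iic.2 h⟩ else z'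
  have hext : Measurable ext := by
    refine measurable_pi_lambda _ fun k => ?_
    by_cases h : k ≤ n
    · simp only [ext, h, dif_pos]; fun_prop
    · simp only [ext, dif_neg h]; fun_prop
  have htr : ∀ ξ : ℕ → S, truncate z' n ξ = ext (Preorder.frestrictLe (π := fun _ => S) n ξ) := by
    intro ξ; ext k
    by_cases h : k ≤ n <;> simp [truncate, ext, h, Preorder.frestrictLe]
  have hG : Measurable fun q : ((i : Finset.Iic n) → S) × S => F (ext q.1, q.2) :=
    hF.comp ((hext.comp measurable_fst).prodMk measurable_snd)
  have h := Kernel.partialTraj_compProd_eq_map_traj (X := fun _ => S) (κ := pastKernel κ)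
    (Nat.zero_le n) (x₀ := fun _ => z)
  have h' := Kernel.traj_map_frestrictLe_apply (X := fun _ => S) (κ := pastKernel κ)
    0 n (fun _ => z)
  have hfr : Measurable (Preorder.frestrictLe (π := fun _ : ℕ => S) n) :=
    Preorder.measurable_frestrictLe n
  calc ∫⁻ ξ, F (truncate z' n ξ, ξ (n + 1)) ∂chainMeasure κ z
      = ∫⁻ q, F (ext q.1, q.2) ∂(chainMeasure κ z).map
          (fun ξ => (Preorder.frestrictLe (π := fun _ => S) n ξ, ξ (n + 1))) := by
        rw [lintegral_map hG (hfr.prodMk (measurable_pi_apply _))]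
        simp only [htr]
    _ = ∫⁻ w, ∫⁻ p, F (ext w, p) ∂pastKernel κ n w
          ∂(chainMeasure κ z).map (Preorder.frestrictLe (π := fun _ => S) n) := by
        rw [chainMeasure, ← h, h', Measure.lintegral_compProd hG]
    _ = _ := by
        rw [lintegral_map _ hfr]
        · simp only [htr]
          rfl
        · exact hG.lintegral_kernel_prod_right'

lemma ae_chainMeasure_zero [MeasurableSingletonClass S] (κ : Kernel S S) [IsMarkovKernel κ]
    (z : S) : ∀ᵐ ξ ∂chainMeasure κ z, ξ 0 = z := by
  have h' := Kernel.traj_map_frestrictLe_apply (X := fun _ => S) (κ := pastKernel κ)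
    0 0 (fun _ => z)
  rw [Kernel.partialTraj_self, Kernel.id_apply] at h'
  have hm : Measurable fun w : (i : Finset.Iic 0) → S => w ⟨0, by simp⟩ := by fun_prop
  have h2 := congrArg (Measure.map fun w : (i : Finset.Iic 0) → S => w ⟨0, by simp⟩) h'
  rw [Measure.map_map hm (Preorder.measurable_frestrictLe 0), Measure.map_dirac' hm] at h2
  have h3 : ∀ᵐ p ∂(chainMeasure κ z).map (fun ξ => ξ 0), p = z := by
    have h4 : (chainMeasure κ z).map (fun ξ => ξ 0) = Measure.dirac z := h2
    rw [h4, ae_dirac_eq]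
    simp
  exact ae_of_ae_map (measurable_pi_apply 0).aemeasurable h3

end MarkovChain

/-! ### Paths driven by the chain of jump times and marks -/

section ChainPath

variable {E : Type*}

open Classical in
/-- The path with initial point `x` whose jumps are read off from a sequence of times and
marks, up to the first failure of strict monotonicity of the times. -/
noncomputable def toPath (x : E) (ξ : ℕ → ℝ≥0∞ × E) : JumpPath E where
  init := x
  jump n := if (∀ k ≤ n, (ξ k).1 < (ξ (k + 1)).1) ∧ (ξ (n + 1)).1 < ⊤ then
    some ((ξ (n + 1)).1.toNNReal, (ξ (n + 1)).2) else none
  pos n := by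
    split_ifs with h
    · have h1 := h.1 n le_rfl
      simpa [timeOf, ENNReal.coe_toNNReal h.2.ne] using zero_le.trans_lt h1
    · simp [timeOf]
  mono n := by
    by_cases h : (∀ k ≤ n + 1, (ξ k).1 < (ξ (k + 1)).1) ∧ (ξ (n + 2)).1 < ⊤
    · have h1 := h.1 (n + 1) le_rfl
      have h2 : (∀ k ≤ n, (ξ k).1 < (ξ (k + 1)).1) ∧ (ξ (n + 1)).1 < ⊤ :=
        ⟨fun k hk => h.1 k (by omega), h1.trans h.2⟩
      rw [if_pos h, if_pos h2]
      simpa [timeOf, ENNReal.coe_toNNReal h.2.ne, ENNReal.coe_toNNReal h2.2.ne] using h1.le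
    · rw [if_neg h]
      exact le_top
  strict n hn := by
    by_cases h : (∀ k ≤ n + 1, (ξ k).1 < (ξ (k + 1)).1) ∧ (ξ (n + 2)).1 < ⊤
    · have h1 := h.1 (n + 1) le_rfl
      have h2 : (∀ k ≤ n, (ξ k).1 < (ξ (k + 1)).1) ∧ (ξ (n + 1)).1 < ⊤ :=
        ⟨fun k hk => h.1 k (by omega), h1.trans h.2⟩
      rw [if_pos h, if_pos h2]
      simpa [timeOf, ENNReal.coe_toNNReal h.2.ne, ENNReal.coe_toNNReal h2.2.ne] using h1
    · rw [if_neg h]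
      exact hn

@[simp] lemma init_toPath (x : E) (ξ : ℕ → ℝ≥0∞ × E) : (toPath x ξ).init = x := rfl

open Classical in
lemma time_toPath_succ (x : E) (ξ : ℕ → ℝ≥0∞ × E) (n : ℕ) :
    (toPath x ξ).time (n + 1) =
      if ∀ k ≤ n, (ξ k).1 < (ξ (k + 1)).1 then (ξ (n + 1)).1 else ⊤ := by
  simp only [JumpPath.time_succ, toPath]
  by_cases h : ∀ k ≤ n, (ξ k).1 < (ξ (k + 1)).1
  · rcases eq_or_ne (ξ (n + 1)).1 ⊤ with h' | h'
    · simp [h', timeOf]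
    · rw [if_pos ⟨h, h'.lt_top⟩, if_pos h]
      simp [timeOf, h']
  · simp [h, timeOf]

lemma markD_toPath_succ {x : E} {ξ : ℕ → ℝ≥0∞ × E} {n : ℕ}
    (h : (toPath x ξ).time (n + 1) < ⊤) : (toPath x ξ).markD (n + 1) = (ξ (n + 1)).2 := by
  classical
  rw [time_toPath_succ] at h
  split_ifs at h with h'
  · simp only [JumpPath.markD, JumpPath.mark, toPath]
    rw [if_pos ⟨h', h⟩]
    rfl
  · simp at h

/-- The sequences of times and marks started from `(0, x)` with strictly increasing times. -/
def IsRegularChain (x : E) (ξ : ℕ → ℝ≥0∞ × E) : Prop :=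
  ξ 0 = (0, x) ∧ ∀ n, (ξ n).1 < (ξ (n + 1)).1 ∨ (ξ (n + 1)).1 = ⊤

lemma IsRegularChain.time_toPath {x : E} {ξ : ℕ → ℝ≥0∞ × E} (h : IsRegularChain x ξ) (n : ℕ) :
    (toPath x ξ).time n = (ξ n).1 := by
  classical
  cases n with
  | zero => simp [h.1]
  | succ n =>
    rw [time_toPath_succ]
    split_ifs with h'
    · rfl
    · push Not at h'
      obtain ⟨k, hk, hlt⟩ := h'
      -- In a regular chain the times can fail to increase only by reaching `⊤`, and they remain
      -- there.
      have hk1 : (ξ (k + 1)).1 = ⊤ := (h.2 k).resolve_left (not_lt.2 hlt)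
      have : ∀ m, (ξ (k + 1 + m)).1 = ⊤ := by
        intro m
        induction m with
        | zero => exact hk1
        | succ m ih => exact (h.2 (k + 1 + m)).resolve_left (by simp [ih])
      have h1 := this (n - k)
      rw [show k + 1 + (n - k) = n + 1 by omega] at h1
      exact h1.symm

lemma IsRegularChain.markD_toPath {x : E} {ξ : ℕ → ℝ≥0∞ × E} (h : IsRegularChain x ξ) {n : ℕ}
    (hn : (ξ n).1 < ⊤) : (toPath x ξ).markD n = (ξ n).2 := by
  cases n with
  | zero => simp [h.1]
  | succ n => exact markD_toPath_succ (by rwa [h.time_toPath])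

lemma jump_toPath_truncate (x : E) (z : ℝ≥0∞ × E) (ξ : ℕ → ℝ≥0∞ × E) {n k : ℕ} (hk : k < n) :
    (toPath x (truncate z n ξ)).jump k = (toPath x ξ).jump k := by
  have h1 : ∀ j ≤ k + 1, truncate z n ξ j = ξ j := fun j hj => by
    simp [truncate, show j ≤ n by omega]
  have h2 : (∀ j ≤ k, (truncate z n ξ j).1 < (truncate z n ξ (j + 1)).1) ↔
      ∀ j ≤ k, (ξ j).1 < (ξ (j + 1)).1 :=
    forall₂_congr fun j hj => by rw [h1 j (by omega), h1 (j + 1) (by omega)]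
  simp only [toPath, h2, h1 (k + 1) le_rfl]

/-- The filler `⊤` makes the truncated path wait forever, so it satisfies `r ≤ T_{n+1}` for every
`r` and predictable integrands can be transferred to it. -/
lemma time_toPath_truncate (x y : E) (ξ : ℕ → ℝ≥0∞ × E) (n : ℕ) :
    (toPath x (truncate (⊤, y) n ξ)).time (n + 1) = ⊤ := by
  classical
  rw [time_toPath_succ]
  simp [truncate]

variable [MeasurableSpace E]

lemma measurable_toPath (x : E) : Measurable (toPath x) := by
  classical
  rw [measurable_iff_le_map]
  refine iSup_le fun t => sup_le ?_ (iSup₂_le fun s _ => iSup₂_le fun B hB => ?_)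
  · rintro _ ⟨D, _, rfl⟩
    have : (toPath x) ⁻¹' (JumpPath.init ⁻¹' D) = {_ξ | x ∈ D} := rfl
    rw [MeasurableSpace.map_def, this]
    exact MeasurableSet.const _
  · rintro _ ⟨D, hD, rfl⟩
    have hm : Measurable fun ξ : ℕ → ℝ≥0∞ × E =>
        (toPath x ξ).jumpMeasure (Ioc 0 s ×ˢ B) := by
      simp_rw [JumpPath.jumpMeasure_Ioc_prod _ s hB]
      refine Measurable.tsum fun n => Measurable.ite ?_ measurable_const measurable_const
      have heq : {ξ : ℕ → ℝ≥0∞ × E | (toPath x ξ).time (n + 1) ≤ s ∧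
          (toPath x ξ).markD (n + 1) ∈ B} =
          (⋂ k ∈ Iic n, {ξ : ℕ → ℝ≥0∞ × E | (ξ k).1 < (ξ (k + 1)).1}) ∩
            ({ξ | (ξ (n + 1)).1 ≤ s} ∩ {ξ | (ξ (n + 1)).2 ∈ B}) := by
        ext ξ
        simp only [mem_ofPred_eq, mem_inter_iff, mem_iInter, mem_Iic]
        constructor
        · rintro ⟨h1, h2⟩
          rw [markD_toPath_succ (h1.trans_lt ENNReal.coe_lt_top)] at h2
          rw [time_toPath_succ] at h1
          split_ifs at h1 with h
          · exact ⟨h, h1, h2⟩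
          · simp at h1
        · rintro ⟨h, h1, h2⟩
          have h3 : (toPath x ξ).time (n + 1) ≤ s := by rwa [time_toPath_succ, if_pos h]
          exact ⟨h3, by rwa [markD_toPath_succ (h3.trans_lt ENNReal.coe_lt_top)]⟩
      rw [heq]
      have hB' : MeasurableSet {ξ : ℕ → ℝ≥0∞ × E | (ξ (n + 1)).2 ∈ B} :=
        (measurable_snd.comp (measurable_pi_apply (n + 1))) hB
      refine MeasurableSet.inter (MeasurableSet.biInter (to_countable _) fun k _ => ?_)
        (MeasurableSet.inter ?_ hB')
      · exact measurableSet_lt (by fun_prop) (by fun_prop)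
      · exact measurableSet_le (by fun_prop) (by fun_prop)
    exact hm hD

end ChainPath

/-! ### Sums over jumps and compensators -/

section Sums

variable {E : Type*}

lemma measurable_of_predictable_prod [MeasurableSpace E] {H : (ℝ≥0 × JumpPath E) × E → ℝ≥0∞}
    (hH : @Measurable _ _ ((JumpPath.filtration E).predictable.prod inferInstance) _ H) :
    Measurable H :=
  hH.mono (sup_le_sup (MeasurableSpace.comap_mono JumpPath.predictable_le) le_rfl) le_rfl

open Classical in
lemma lintegral_jumpMeasure [MeasurableSpace E] (ω : JumpPath E) {F : ℝ≥0 × E → ℝ≥0∞} (hF : Measurable F) :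
    ∫⁻ q, F q ∂ω.jumpMeasure = ∑' n, if ω.time (n + 1) < ⊤ then
      F ((ω.time (n + 1)).toNNReal, ω.markD (n + 1)) else 0 := by
  rw [JumpPath.jumpMeasure, lintegral_sum_measure]
  refine tsum_congr fun n => ?_
  rcases eq_or_ne (ω.time (n + 1)) ⊤ with h | h
  · simp [JumpPath.jump_eq_none_of_time h, h]
  · rw [if_pos h.lt_top, JumpPath.jump_eq_some_of_time h.lt_top, Option.elim_some,
      lintegral_dirac' _ hF]

open Classical in
-- The compensator side is cut along the intervals between jumps, to be matched term by term with
-- the sum over jumps. Time `0`, which belongs only to the first left interval, is null.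
lemma lintegral_leftState (t : ℝ≥0) (ω : JumpPath E) {G : ℝ≥0 → E → ℝ≥0∞}
    (hG : ∀ y, Measurable fun r => G r y) :
    ∫⁻ s in {s : ℝ | (t : ℝ) ≤ s ∧ ENNReal.ofReal s < ω.explosionTime},
      (ω.leftState s.toNNReal).elim 0 (G s.toNNReal) =
    ∑' n, ∫⁻ r : ℝ≥0, (if ω.time n < r ∧ (r : ℝ≥0∞) ≤ ω.time (n + 1) then
      G r (ω.markD n) else 0) ∂timeMeasure t := by
  have hI : ∀ n, MeasurableSet
      {r : ℝ≥0 | (n = 0 ∨ ω.time n < r) ∧ (r : ℝ≥0∞) ≤ ω.time (n + 1)} := fun n =>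
    ((MeasurableSet.const (n = 0)).union
      (measurableSet_lt measurable_const measurable_coe_nnreal_ennreal)).inter
      (measurableSet_le measurable_coe_nnreal_ennreal measurable_const)
  have hm : ∀ n, Measurable fun r : ℝ≥0 =>
      if (n = 0 ∨ ω.time n < r) ∧ (r : ℝ≥0∞) ≤ ω.time (n + 1) then
      G r (ω.markD n) else 0 := fun n => Measurable.ite (hI n) (hG _) measurable_const
  have hmE : MeasurableSet {s : ℝ | (t : ℝ) ≤ s ∧ ENNReal.ofReal s < ω.explosionTime} :=
    measurableSet_Ici.inter (measurableSet_lt ENNReal.measurable_ofReal measurable_const)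
  have hsum : ∀ r : ℝ≥0, (ω.leftState r).elim 0 (G r) =
      ∑' n, if (n = 0 ∨ ω.time n < r) ∧ (r : ℝ≥0∞) ≤ ω.time (n + 1) then
        G r (ω.markD n) else 0 := by
    intro r
    by_cases h : ∃ n, (n = 0 ∨ ω.time n < r) ∧ (r : ℝ≥0∞) ≤ ω.time (n + 1)
    · obtain ⟨n, hn⟩ := h
      rw [tsum_eq_single n, if_pos hn, JumpPath.leftState_eq hn, Option.elim_some]
      intro m hm
      rw [if_neg]
      exact fun hm' => hm (JumpPath.eq_of_mem_interval_left hm' hn)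
    · have : ω.leftState r = none := by rw [JumpPath.leftState, dif_neg h]
      rw [this, Option.elim_none, eq_comm, ENNReal.tsum_eq_zero]
      exact fun n => if_neg fun hn => h ⟨n, hn⟩
  calc _ = ∫⁻ s in Ici (t : ℝ), ∑' n,
        if (n = 0 ∨ ω.time n < (s.toNNReal : ℝ≥0∞)) ∧ (s.toNNReal : ℝ≥0∞) ≤ ω.time (n + 1) then
          G s.toNNReal (ω.markD n) else 0 := by
        rw [← lintegral_indicator hmE, ← lintegral_indicator measurableSet_Ici]
        refine lintegral_congr fun s => ?_
        by_cases hs : (t : ℝ) ≤ s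
        · by_cases hs' : ENNReal.ofReal s < ω.explosionTime
          · simp [indicator, hs, hs', hsum]
          · have h2 := hsum s.toNNReal
            have h3 : ω.leftState s.toNNReal = none := by
              rw [JumpPath.leftState, dif_neg]
              exact fun h => hs' (JumpPath.lt_explosionTime_iff.2 h)
            rw [h3] at h2
            simp only [indicator, mem_ofPred_eq, mem_Ici, hs, hs', and_false, if_false, if_true]
            exact h2
        · simp [indicator, hs]
    _ = ∫⁻ r, ∑' n, (if (n = 0 ∨ ω.time n < r) ∧ (r : ℝ≥0∞) ≤ ω.time (n + 1) then
          G r (ω.markD n) else 0) ∂timeMeasure t :=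
        (lintegral_timeMeasure t (Measurable.tsum hm)).symm
    _ = _ := by
        rw [lintegral_tsum fun n => (hm n).aemeasurable]
        refine tsum_congr fun n => lintegral_congr_ae ?_
        filter_upwards [Measure.ae_ne (timeMeasure t) 0] with r hr
        have : n = 0 → ω.time n < r := by
          rintro rfl
          simpa using pos_of_ne_zero hr
        congr 1
        simp only [eq_iff_iff]
        tauto

end Sums

/-! ### Existence of jump processes with bounded rates -/

section Existence

variable {E : Type*} [MeasurableSpace E] (t : ℝ≥0) {ν : Kernel (ℝ≥0 × E) E}

open Classical in
-- The law is the image of the chain of times and marks. For each `n` the expected contribution of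
-- jump `n + 1` equals that of the compensator on `(Tₙ, Tₙ₊₁]`, conditionally on the first `n`
-- jumps.
theorem exists_isJumpLaw [MeasurableSingletonClass E] {L : ℝ≥0} (hν : ∀ p, ν p univ ≤ L)
    (x : E) : ∃ P, IsJumpLaw t (Measure.dirac x) ν P := by
  have hfin : IsFiniteKernel ν := ⟨⟨L, ENNReal.coe_lt_top, hν⟩⟩
  have hmk := isMarkovKernel_chainKernel t hν
  set κ := chainKernel t ν with hκ
  -- The chain starts at time `0` rather than `t`; since `timeMeasure t` ignores earlier times, no
  -- jump is produced before `t`.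
  set Q := chainMeasure κ ((0 : ℝ≥0∞), x) with hQ
  have hreg : ∀ᵐ ξ ∂Q, IsRegularChain x ξ := by
    refine (ae_chainMeasure_zero κ _).and (ae_all_iff.2 fun n => ?_)
    have hm : MeasurableSet {q : (ℕ → ℝ≥0∞ × E) × (ℝ≥0∞ × E) |
        ¬ ((q.1 n).1 < q.2.1 ∨ q.2.1 = ⊤)} := by
      have h1 : MeasurableSet {q : (ℕ → ℝ≥0∞ × E) × (ℝ≥0∞ × E) | (q.1 n).1 < q.2.1} :=
        measurableSet_lt (by fun_prop) (by fun_prop)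
      have h2 : MeasurableSet {q : (ℕ → ℝ≥0∞ × E) × (ℝ≥0∞ × E) | q.2.1 = ⊤} :=
        (measurable_fst.comp measurable_snd) (measurableSet_singleton ⊤)
      exact (h1.union h2).compl
    have hm' : MeasurableSet {ξ : ℕ → ℝ≥0∞ × E |
        ¬ ((ξ n).1 < (ξ (n + 1)).1 ∨ (ξ (n + 1)).1 = ⊤)} :=
      (show Measurable fun ξ : ℕ → ℝ≥0∞ × E => (ξ, ξ (n + 1)) by fun_prop) hm
    have h := lintegral_chainMeasure κ ((0 : ℝ≥0∞), x) (⊤, x) n (measurable_one.indicator hm)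
    rw [ae_iff, ← lintegral_indicator_one hm']
    have htr : ∀ ξ : ℕ → ℝ≥0∞ × E, truncate (⊤, x) n ξ n = ξ n := fun ξ => by simp [truncate]
    simp only [indicator, mem_ofPred_eq, htr, Pi.one_apply] at h ⊢
    rw [h]
    refine (lintegral_congr fun ξ => ?_).trans lintegral_zero
    refine lintegral_eq_zero_of_ae_eq_zero ?_
    filter_upwards [ae_chainKernel t (ξ n)] with p hp
    simp [hp]
  refine ⟨Q.map (toPath x), ⟨Measure.isProbabilityMeasure_map
    (measurable_toPath x).aemeasurable, ?_, ?_⟩⟩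
  · rw [Measure.map_map JumpPath.measurable_init (measurable_toPath x)]
    have : JumpPath.init ∘ toPath x = fun _ => x := rfl
    rw [this, Measure.map_const]
    simp
  · intro H hH
    have hH' := measurable_of_predictable_prod hH
    have hpath := measurable_toPath x
    let Φ : JumpPath E × ℝ≥0 × E → ℝ≥0∞ := fun q => ∫⁻ y, H ((q.2.1, q.1), y) ∂ν q.2
    have hΦ : Measurable Φ := by
      have : Measurable fun q : (JumpPath E × ℝ≥0 × E) × E => H ((q.1.2.1, q.1.1), q.2) :=
        hH'.comp (by fun_prop)
      exact Measurable.lintegral_kernel_prod_right'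
        (κ := ν.comap (fun q : JumpPath E × ℝ≥0 × E => q.2) measurable_snd) this
    -- `F` is the contribution of one jump and `G n` that of the compensator between two jumps, both
    -- as functions of the past and of the next pair alone.
    let F : (ℕ → ℝ≥0∞ × E) × (ℝ≥0∞ × E) → ℝ≥0∞ := fun q =>
      if q.2.1 < ⊤ then H ((q.2.1.toNNReal, toPath x q.1), q.2.2) else 0
    have hF : Measurable F := by
      refine Measurable.ite (measurableSet_lt (by fun_prop) (by fun_prop)) ?_ measurable_const
      refine hH'.comp (((ENNReal.measurable_toNNReal.comp
        (measurable_fst.comp measurable_snd)).prodMk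
        (hpath.comp measurable_fst)).prodMk (measurable_snd.comp measurable_snd))
    let G₀ : ℕ → ((ℕ → ℝ≥0∞ × E) × (ℝ≥0∞ × E)) × ℝ≥0 → ℝ≥0∞ := fun n q =>
      if (q.1.1 n).1 < q.2 ∧ (q.2 : ℝ≥0∞) ≤ q.1.2.1 then
        Φ (toPath x q.1.1, q.2, (q.1.1 n).2) else 0
    have hG₀ : ∀ n, Measurable (G₀ n) := fun n => by
      have h1 : MeasurableSet {q : ((ℕ → ℝ≥0∞ × E) × (ℝ≥0∞ × E)) × ℝ≥0 |
          (q.1.1 n).1 < q.2} := measurableSet_lt (by fun_prop) (by fun_prop)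
      have h2 : MeasurableSet {q : ((ℕ → ℝ≥0∞ × E) × (ℝ≥0∞ × E)) × ℝ≥0 |
          (q.2 : ℝ≥0∞) ≤ q.1.2.1} := measurableSet_le (by fun_prop) (by fun_prop)
      refine Measurable.ite (h1.inter h2) ?_ measurable_const
      exact hΦ.comp ((hpath.comp (by fun_prop)).prodMk (by fun_prop))
    let G : ℕ → (ℕ → ℝ≥0∞ × E) × (ℝ≥0∞ × E) → ℝ≥0∞ := fun n q =>
      ∫⁻ r, G₀ n (q, r) ∂timeMeasure t
    have hG : ∀ n, Measurable (G n) := fun n => (hG₀ n).lintegral_prod_right'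
    have hsec : ∀ ω : JumpPath E, Measurable fun q : ℝ≥0 × E => H ((q.1, ω), q.2) := fun ω =>
      hH'.comp (by fun_prop)
    have hleft : ∀ ω : JumpPath E, ∫⁻ q, H ((q.1, ω), q.2) ∂ω.jumpMeasure =
        ∑' n, if ω.time (n + 1) < ⊤ then
          H (((ω.time (n + 1)).toNNReal, ω), ω.markD (n + 1)) else 0 := fun ω =>
      lintegral_jumpMeasure ω (hsec ω)
    have hright : ∀ ω : JumpPath E,
        (∫⁻ s in {s : ℝ | (t : ℝ) ≤ s ∧ ENNReal.ofReal s < ω.explosionTime},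
          (ω.leftState s.toNNReal).elim 0
            fun x => ∫⁻ y, H ((s.toNNReal, ω), y) ∂ν (s.toNNReal, x)) =
        ∑' n, ∫⁻ r : ℝ≥0, (if ω.time n < r ∧ (r : ℝ≥0∞) ≤ ω.time (n + 1) then
          Φ (ω, r, ω.markD n) else 0) ∂timeMeasure t := fun ω =>
      lintegral_leftState t ω (G := fun r y' => ∫⁻ y, H ((r, ω), y) ∂ν (r, y'))
        fun y => hΦ.comp (by fun_prop : Measurable fun r : ℝ≥0 => (ω, r, y))
    simp_rw [hleft, hright]
    have hmt : ∀ n, Measurable fun ω : JumpPath E => ω.time n := JumpPath.measurable_time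
    have hmm : ∀ n, Measurable fun ω : JumpPath E => ω.markD n := JumpPath.measurable_markD
    rw [lintegral_map _ hpath, lintegral_map _ hpath]
    · -- term by term comparison
      -- Predictability enters only here: up to the next jump the integrand cannot tell the path
      -- from its truncation.
      have hmono : ∀ (ξ : ℕ → ℝ≥0∞ × E) (n : ℕ) (r : ℝ≥0) (y : E),
          (r : ℝ≥0∞) ≤ (toPath x ξ).time (n + 1) →
          H ((r, toPath x ξ), y) = H ((r, toPath x (truncate (⊤, x) n ξ)), y) := by
        intro ξ n r y hr
        refine JumpPath.apply_eq_of_predictable (n := n)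
          (ω := toPath x ξ) (ω' := toPath x (truncate (⊤, x) n ξ)) rfl
          (fun k hk => (jump_toPath_truncate x _ ξ hk).symm) hr ?_ hH y
        rw [time_toPath_truncate]
        exact le_top
      have hl : ∀ᵐ ξ ∂Q, (∑' n, if (toPath x ξ).time (n + 1) < ⊤ then
          H ((((toPath x ξ).time (n + 1)).toNNReal, toPath x ξ), (toPath x ξ).markD (n + 1))
          else 0) = ∑' n, F (truncate (⊤, x) n ξ, ξ (n + 1)) := by
        filter_upwards [hreg] with ξ hξ
        refine tsum_congr fun n => ?_
        simp only [F]
        rw [hξ.time_toPath]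
        split_ifs with h
        · rw [hξ.markD_toPath h, hmono ξ n]
          rw [hξ.time_toPath, ENNReal.coe_toNNReal h.ne]
        · rfl
      have hr : ∀ᵐ ξ ∂Q, (∑' n, ∫⁻ r : ℝ≥0, (if (toPath x ξ).time n < r ∧
          (r : ℝ≥0∞) ≤ (toPath x ξ).time (n + 1) then
          Φ (toPath x ξ, r, (toPath x ξ).markD n) else 0) ∂timeMeasure t) =
          ∑' n, G n (truncate (⊤, x) n ξ, ξ (n + 1)) := by
        filter_upwards [hreg] with ξ hξ
        refine tsum_congr fun n => lintegral_congr fun r => ?_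
        have htr : truncate (⊤, x) n ξ n = ξ n := by simp [truncate]
        simp only [G₀, hξ.time_toPath, htr]
        split_ifs with h
        · rw [hξ.markD_toPath (h.1.trans ENNReal.coe_lt_top)]
          refine lintegral_congr fun y => hmono ξ n r y ?_
          rw [hξ.time_toPath]
          exact h.2
        · rfl
      have htrm : ∀ n, Measurable fun ξ : ℕ → ℝ≥0∞ × E =>
          (truncate (⊤, x) n ξ, ξ (n + 1)) := fun n => by
        refine Measurable.prodMk (measurable_pi_lambda _ fun k => ?_) (measurable_pi_apply _)
        by_cases h : k ≤ n <;> simp only [truncate, h, if_true, if_false] <;> fun_prop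
      have hFt : ∀ n, Measurable fun ξ : ℕ → ℝ≥0∞ × E => F (truncate (⊤, x) n ξ, ξ (n + 1)) :=
        fun n => hF.comp (htrm n)
      have hGt : ∀ n, Measurable fun ξ : ℕ → ℝ≥0∞ × E => G n (truncate (⊤, x) n ξ, ξ (n + 1)) :=
        fun n => (hG n).comp (htrm n)
      rw [lintegral_congr_ae hl, lintegral_congr_ae hr,
        lintegral_tsum fun n => (hFt n).aemeasurable,
        lintegral_tsum fun n => (hGt n).aemeasurable]
      refine tsum_congr fun n => ?_
      rw [lintegral_chainMeasure κ _ (⊤, x) n hF, lintegral_chainMeasure κ _ (⊤, x) n (hG n)]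
      refine lintegral_congr fun ξ => ?_
      set η := truncate (⊤, x) n ξ with hη
      have hηn : η n = ξ n := by simp [hη, truncate]
      have hFη : Measurable fun p => F (η, p) := hF.comp measurable_prodMk_left
      rw [lintegral_chainKernel t ν (ξ n) hFη, lintegral_jumpKernel t ν (ξ n)
        (F := fun p => F (η, ((p.1 : ℝ≥0∞), p.2)))
        (hFη.comp (g := fun p => F (η, p)) (f := fun p : ℝ≥0 × E => ((p.1 : ℝ≥0∞), p.2))
          (by fun_prop))]
      simp only [G]
      -- After Fubini, the time `r` is counted with the probability that the next jump is at `r` or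
      -- later, which is `survival`.
      rw [lintegral_lintegral_swap]
      · simp only [F, lt_self_iff_false, if_false, mul_zero, add_zero, ENNReal.coe_lt_top,
          if_true, ENNReal.toNNReal_coe]
        refine lintegral_congr fun r => ?_
        by_cases h : (ξ n).1 < r
        · have hmr : MeasurableSet {p : ℝ≥0∞ × E | (r : ℝ≥0∞) ≤ p.1} :=
            measurableSet_le measurable_const measurable_fst
          rw [if_pos h, ← chainKernel_le t hν (ξ n) h, ← lintegral_indicator_one hmr,
            ← lintegral_mul_const _ (measurable_one.indicator hmr)]
          refine lintegral_congr fun p => ?_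
          simp only [G₀, hηn, h, true_and, indicator, mem_ofPred_eq, Pi.one_apply]
          split_ifs
          · simp only [one_mul]
            rfl
          · simp
        · rw [if_neg h]
          simp [G₀, hηn, h]
      · exact ((hG₀ n).comp (by fun_prop :
          Measurable fun z : (ℝ≥0∞ × E) × ℝ≥0 => ((η, z.1), z.2))).aemeasurable
    · refine Measurable.tsum fun n => ?_
      refine Measurable.lintegral_prod_right' (f := fun q : JumpPath E × ℝ≥0 =>
        if q.1.time n < q.2 ∧ (q.2 : ℝ≥0∞) ≤ q.1.time (n + 1) then
          Φ (q.1, q.2, q.1.markD n) else 0) ?_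
      have h1 : MeasurableSet {q : JumpPath E × ℝ≥0 | q.1.time n < q.2} :=
        measurableSet_lt ((hmt n).comp measurable_fst) (by fun_prop)
      have h2 : MeasurableSet {q : JumpPath E × ℝ≥0 | (q.2 : ℝ≥0∞) ≤ q.1.time (n + 1)} :=
        measurableSet_le (by fun_prop) ((hmt (n + 1)).comp measurable_fst)
      refine Measurable.ite (h1.inter h2) ?_ measurable_const
      exact hΦ.comp (measurable_fst.prodMk (measurable_snd.prodMk ((hmm n).comp measurable_fst)))
    · refine Measurable.tsum fun n => Measurable.ite
        (measurableSet_lt (hmt _) measurable_const) ?_ measurable_const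
      exact hH'.comp (((ENNReal.measurable_toNNReal.comp (hmt _)).prodMk measurable_id).prodMk
        (hmm _))

end Existence

end JumpControl

namespace JumpControl

/-! ### Telescoping along a path -/

section Pathwise

variable {E : Type*}

open Classical in
-- Telescoping: the jumps up to `r` stop exactly at the state occupied at time `r`.
lemma sum_jumps_eq_stateMark_sub (ω : JumpPath E) {r : ℝ≥0} {m : ℕ}
    (hm : (r : ℝ≥0∞) < ω.time (m + 1)) (φ : E → ℝ) :
    ∑ n ∈ Finset.range m, (if ω.time (n + 1) ≤ r then
      φ (ω.markD (n + 1)) - φ (ω.markD n) else 0) = φ (ω.stateMark r) - φ ω.init := by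
  obtain ⟨k, hk, hkr⟩ := JumpPath.exists_interval_right hm
  have h1 : ω.stateMark r = ω.markD k := by simp [JumpPath.stateMark, JumpPath.state_eq hkr]
  rw [h1, ← JumpPath.markD_zero, ← Finset.sum_range_sub (fun n => φ (ω.markD n)),
    ← Finset.sum_subset (Finset.range_subset_range.2 (Nat.le_of_lt_succ hk))]
  · refine Finset.sum_congr rfl fun n hn => if_pos ?_
    exact (ω.time_monotone (Finset.mem_range.1 hn)).trans hkr.1
  · intro n _ hn
    rw [Finset.mem_range, not_lt] at hn
    exact if_neg (not_le.2 (hkr.2.trans_le (ω.time_monotone (by omega))))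

open Classical in
-- The chain rule along a path. Writing `w` as its terminal value plus the integral of `h` splits
-- each jump of `w` into a jump of `w T` and an integral of jumps of `h`; both telescope. With no
-- jump up to `t`, the representation of `w` applies at every jump time.
lemma sum_jumps_of_integral (ω : JumpPath E) {t T : ℝ≥0} (htT : t ≤ T) {m : ℕ}
    (hm : (T : ℝ≥0∞) < ω.time (m + 1)) (ht : (t : ℝ≥0∞) < ω.time 1) {w h : ℝ → E → ℝ}
    (hh : ∀ y, Measurable fun r => h r y) {C : ℝ} (hC : ∀ r y, |h r y| ≤ C)
    (hwh : ∀ s ∈ Icc (t : ℝ) T, ∀ y, w s y = w T y + ∫ r in s..T, h r y) :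
    ∑ n ∈ Finset.range m, (if ω.time (n + 1) ≤ T then
      w (ω.time (n + 1)).toNNReal (ω.markD (n + 1)) - w (ω.time (n + 1)).toNNReal (ω.markD n)
      else 0) =
    w T (ω.stateMark T) + (∫ r in (t : ℝ)..T, h r (ω.stateMark r.toNNReal)) - w t ω.init := by
  have htT' : (t : ℝ) ≤ T := htT
  have hi : ∀ y a b, IntervalIntegrable (fun r => h r y) volume a b := fun y =>
    intervalIntegrable_of_measurable_bounded (hh y) (hC · y)
  have hI : ∀ n, MeasurableSet {r : ℝ | ω.time (n + 1) ≤ (r.toNNReal : ℝ≥0∞)} := fun n =>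
    measurableSet_le measurable_const (by fun_prop)
  -- A jump at time `τ` changes the integrand `h r` for all `r ≥ τ`; extending by zero puts all
  -- these integrals on the same interval.
  let D : ℕ → ℝ → ℝ := fun n r => if ω.time (n + 1) ≤ (r.toNNReal : ℝ≥0∞) then
    h r (ω.markD (n + 1)) - h r (ω.markD n) else 0
  have hD : ∀ n, IntervalIntegrable (D n) volume t T := fun n => by
    refine intervalIntegrable_of_measurable_bounded
      (Measurable.ite (hI n) ((hh _).sub (hh _)) measurable_const) (L := C + C) (fun r => ?_) _ _
    have h0 : 0 ≤ C := (abs_nonneg _).trans (hC 0 ω.init)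
    split_ifs
    · exact (abs_sub _ _).trans (add_le_add (hC _ _) (hC _ _))
    · simpa using h0
  have key : ∀ n, (if ω.time (n + 1) ≤ T then
      w (ω.time (n + 1)).toNNReal (ω.markD (n + 1)) - w (ω.time (n + 1)).toNNReal (ω.markD n)
      else 0) = (if ω.time (n + 1) ≤ T then w T (ω.markD (n + 1)) - w T (ω.markD n) else 0) +
        ∫ r in (t : ℝ)..T, D n r := by
    intro n
    have htn : (t : ℝ≥0∞) < ω.time (n + 1) := ht.trans_le (ω.time_monotone (by omega))
    by_cases hle : ω.time (n + 1) ≤ T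
    · obtain ⟨τ, hτ⟩ : ∃ τ : ℝ≥0, (τ : ℝ≥0∞) = ω.time (n + 1) :=
        ⟨_, ENNReal.coe_toNNReal (hle.trans_lt ENNReal.coe_lt_top).ne⟩
      simp only [D, ← hτ] at hle htn ⊢
      have hle' : (τ : ℝ) ≤ T := by exact_mod_cast hle
      have htn' : (t : ℝ) < τ := by exact_mod_cast htn
      rw [if_pos hle, if_pos hle, ENNReal.toNNReal_coe, hwh τ ⟨htn'.le, hle'⟩,
        hwh τ ⟨htn'.le, hle'⟩]
      have hint : ∫ r in (t : ℝ)..T, (if (τ : ℝ≥0∞) ≤ (r.toNNReal : ℝ≥0∞) then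
          h r (ω.markD (n + 1)) - h r (ω.markD n) else 0) =
          ∫ r in (τ : ℝ)..T, (h r (ω.markD (n + 1)) - h r (ω.markD n)) := by
        rw [intervalIntegral.integral_of_le htT', intervalIntegral.integral_of_le hle',
          ← integral_indicator measurableSet_Ioc, ← integral_indicator measurableSet_Ioc]
        refine integral_congr_ae ?_
        filter_upwards [Measure.ae_ne volume (τ : ℝ)] with r hr
        simp only [indicator, mem_Ioc, ENNReal.coe_le_coe]
        rcases lt_or_gt_of_ne hr with hr' | hr'
        · have h1 : ¬ τ ≤ r.toNNReal := by
            have h2 := (Real.toNNReal_lt_toNNReal_iff (t.2.trans_lt htn')).2 hr'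
            rw [Real.toNNReal_coe] at h2
            exact not_le.2 h2
          simp [h1, not_lt.2 hr'.le]
        · have h1 : τ ≤ r.toNNReal := (Real.le_toNNReal_iff_coe_le (τ.2.trans hr'.le)).2 hr'.le
          simp [h1, hr', htn'.trans hr']
      rw [hint, intervalIntegral.integral_sub (hi _ _ _) (hi _ _ _)]
      ring
    · rw [if_neg hle, if_neg hle, zero_add, eq_comm]
      refine intervalIntegral.integral_zero_ae (Filter.Eventually.of_forall fun r hr => ?_)
      rw [uIoc_of_le htT'] at hr
      simp only [D]
      rw [if_neg]
      intro hle'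
      refine hle (hle'.trans ?_)
      exact_mod_cast Real.toNNReal_le_iff_le_coe.2 hr.2
  rw [Finset.sum_congr rfl fun n _ => key n, Finset.sum_add_distrib,
    sum_jumps_eq_stateMark_sub ω hm (w T), ← intervalIntegral.integral_finsetSum fun n _ => hD n]
  have hDs : IntervalIntegrable (fun r => ∑ n ∈ Finset.range m, D n r) volume t T := by
    have := IntervalIntegrable.sum (Finset.range m) fun n _ => hD n
    simpa only [Finset.sum_fn] using this
  -- Telescoping at each fixed time `r` reassembles `h` along the path from its initial value and
  -- its jumps.
  have hsplit : ∫ r in (t : ℝ)..T, h r (ω.stateMark r.toNNReal) =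
      (∫ r in (t : ℝ)..T, ∑ n ∈ Finset.range m, D n r) + ∫ r in (t : ℝ)..T, h r ω.init := by
    rw [← intervalIntegral.integral_add hDs (hi _ _ _)]
    refine intervalIntegral.integral_congr fun r hr => ?_
    rw [uIcc_of_le htT'] at hr
    have hrT : (r.toNNReal : ℝ≥0∞) ≤ T := by exact_mod_cast Real.toNNReal_le_iff_le_coe.2 hr.2
    have := sum_jumps_eq_stateMark_sub ω (hrT.trans_lt hm) (h r)
    simp only [D]
    rw [this]
    ring
  rw [hsplit, hwh t ⟨le_rfl, htT'⟩ ω.init]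
  ring

end Pathwise

/-! ### Consequences of the compensator formula -/

section Expectation

variable {E : Type*} [MeasurableSpace E] {t : ℝ≥0} {μ : Measure E} {ν : Kernel (ℝ≥0 × E) E}
  {P : Measure (JumpPath E)} {L : ℝ≥0}

lemma measurable_tsum_jumps (T : ℝ≥0) {K : ℝ≥0 × E × E → ℝ≥0∞} (hK : Measurable K)
    [∀ (ω : JumpPath E) (n : ℕ), Decidable (ω.time (n + 1) ≤ T)] :
    Measurable fun ω : JumpPath E => ∑' n, if ω.time (n + 1) ≤ T then
      K ((ω.time (n + 1)).toNNReal, ω.markD n, ω.markD (n + 1)) else 0 := by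
  refine Measurable.tsum fun n => Measurable.ite
    (measurableSet_le (JumpPath.measurable_time _) measurable_const) ?_ measurable_const
  exact hK.comp ((ENNReal.measurable_toNNReal.comp (JumpPath.measurable_time _)).prodMk
    ((JumpPath.measurable_markD _).prodMk (JumpPath.measurable_markD _)))

open Classical in
lemma lintegral_tsum_jumps (hP : IsJumpLaw t μ ν P) (T : ℝ≥0) {K : ℝ≥0 × E × E → ℝ≥0∞}
    (hK : Measurable K) :
    ∫⁻ ω, (∑' n, if ω.time (n + 1) ≤ T then
      K ((ω.time (n + 1)).toNNReal, ω.markD n, ω.markD (n + 1)) else 0) ∂P =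
    ∫⁻ ω, (∫⁻ s in {s : ℝ | (t : ℝ) ≤ s ∧ ENNReal.ofReal s < ω.explosionTime},
      if s ≤ T then ∫⁻ y, K (s.toNNReal, ω.leftMark s.toNNReal, y)
        ∂ν (s.toNNReal, ω.leftMark s.toNNReal) else 0) ∂P := by
  -- Evaluated at a jump time, the left limit is the mark before the jump, so this predictable
  -- integrand reproduces both marks.
  let H : (ℝ≥0 × JumpPath E) × E → ℝ≥0∞ := fun q =>
    if q.1.1 ≤ T then K (q.1.1, q.1.2.leftMark q.1.1, q.2) else 0
  have hH : @Measurable _ _ ((JumpPath.filtration E).predictable.prod inferInstance) _ H := by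
    let _ : MeasurableSpace (ℝ≥0 × JumpPath E) := (JumpPath.filtration E).predictable
    have h1 : Measurable fun q : (ℝ≥0 × JumpPath E) × E => q.1.1 :=
      JumpPath.measurable_fst_predictable.comp measurable_fst
    have h2 : Measurable fun q : (ℝ≥0 × JumpPath E) × E => q.1.2.leftMark q.1.1 :=
      JumpPath.measurable_leftMark.comp measurable_fst
    exact Measurable.ite (measurableSet_le h1 measurable_const)
      (hK.comp (h1.prodMk (h2.prodMk measurable_snd))) measurable_const
  have hH' := measurable_of_predictable_prod hH
  have h := hP.compensator H hH
  convert h using 1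
  · refine lintegral_congr fun ω => ?_
    rw [lintegral_jumpMeasure ω (F := fun q => H ((q.1, ω), q.2))
      (hH'.comp (by fun_prop : Measurable fun q : ℝ≥0 × E => ((q.1, ω), q.2)))]
    refine tsum_congr fun n => ?_
    by_cases htop : ω.time (n + 1) = ⊤
    · simp [htop]
    · have hcoe := ENNReal.coe_toNNReal htop
      have hl : ω.leftMark (ω.time (n + 1)).toNNReal = ω.markD n := by
        rw [JumpPath.leftMark, JumpPath.leftState_eq (n := n)]
        · rfl
        · rw [hcoe]
          exact ⟨Or.inr (ω.time_lt_time_succ ((ω.time_le_time_succ n).trans_lt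
            (lt_top_iff_ne_top.2 htop))), le_rfl⟩
      have hle : (ω.time (n + 1)).toNNReal ≤ T ↔ ω.time (n + 1) ≤ T := by
        rw [← ENNReal.coe_le_coe, hcoe]
      simp only [H, lt_top_iff_ne_top.2 htop, if_true, hle, hl]
  · refine lintegral_congr fun ω => ?_
    refine setLIntegral_congr_fun
      (measurableSet_Ici.inter (measurableSet_lt ENNReal.measurable_ofReal measurable_const))
      fun s hs => ?_
    have hs' : ((s.toNNReal : ℝ≥0) : ℝ≥0∞) < ω.explosionTime := hs.2
    rw [JumpPath.leftState_eq_some hs', Option.elim_some]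
    have : s.toNNReal ≤ T ↔ s ≤ T := Real.toNNReal_le_iff_le_coe
    simp only [H, this]
    split_ifs <;> simp

/-- The compensator formula with integrand `1`: jumps occur at rate at most `L`, and only from time
`t` on. -/
lemma lintegral_count_le (hP : IsJumpLaw t μ ν P) (hν : ∀ p, ν p univ ≤ L) (T : ℝ≥0)
    [∀ (ω : JumpPath E) (n : ℕ), Decidable (ω.time (n + 1) ≤ T)] :
    ∫⁻ ω, (∑' n, if ω.time (n + 1) ≤ T then 1 else 0) ∂P ≤ L * ENNReal.ofReal (T - t) := by
  classical
  have := hP.isProbability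
  have h := lintegral_tsum_jumps hP T (K := fun _ => 1) measurable_const
  calc _ = ∫⁻ ω, (∫⁻ s in {s : ℝ | (t : ℝ) ≤ s ∧ ENNReal.ofReal s < ω.explosionTime},
        if s ≤ T then ∫⁻ _, 1 ∂ν (s.toNNReal, ω.leftMark s.toNNReal) else 0) ∂P := by
        convert h
    _ ≤ ∫⁻ _, L * ENNReal.ofReal (T - t) ∂P := by
        refine lintegral_mono fun ω => ?_
        have h1 : ∀ s : ℝ, (if s ≤ T then ∫⁻ _, 1 ∂ν (s.toNNReal, ω.leftMark s.toNNReal) else 0) ≤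
            (Iic (T : ℝ)).indicator (fun _ => (L : ℝ≥0∞)) s := fun s => by
          simp only [lintegral_one, indicator, mem_Iic]
          split_ifs
          · exact hν _
          · exact le_rfl
        calc _ ≤ ∫⁻ s in Ici (t : ℝ), (Iic (T : ℝ)).indicator (fun _ => (L : ℝ≥0∞)) s :=
              (lintegral_mono h1).trans (lintegral_mono_set fun s hs => hs.1)
          _ = _ := by
              rw [lintegral_indicator measurableSet_Iic, lintegral_const,
                Measure.restrict_restrict measurableSet_Iic, inter_comm, Ici_inter_Iic]
              simp
    _ = _ := by simp

/-- The mean number of jumps up to time `t` is at most `L * 0`. -/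
lemma ae_lt_time_one (hP : IsJumpLaw t μ ν P) (hν : ∀ p, ν p univ ≤ L) :
    ∀ᵐ ω ∂P, (t : ℝ≥0∞) < ω.time 1 := by
  classical
  have h := lintegral_count_le hP hν t
  rw [sub_self, ENNReal.ofReal_zero, mul_zero, nonpos_iff_eq_zero,
    lintegral_eq_zero_iff (measurable_tsum_jumps t (K := fun _ => 1) measurable_const)] at h
  filter_upwards [h] with ω hω
  have := ENNReal.tsum_eq_zero.1 hω 0
  by_contra hlt
  rw [not_lt] at hlt
  simp [hlt] at this

/-- Non-explosion: the number of jumps up to `T` has finite mean, hence is almost surely finite. -/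
lemma ae_exists_lt_time (hP : IsJumpLaw t μ ν P) (hν : ∀ p, ν p univ ≤ L) (T : ℝ≥0) :
    ∀ᵐ ω ∂P, ∃ m, (T : ℝ≥0∞) < ω.time (m + 1) := by
  classical
  have h := lintegral_count_le hP hν T
  have h2 := ae_lt_top (measurable_tsum_jumps T (K := fun _ => 1) measurable_const)
    (ne_top_of_le_ne_top (ENNReal.mul_ne_top ENNReal.coe_ne_top ENNReal.ofReal_ne_top) h)
  filter_upwards [h2] with ω hω
  by_contra! hle
  simp only [hle, if_true] at hω
  rw [ENNReal.tsum_const_eq_top_of_ne_zero one_ne_zero] at hω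
  exact lt_irrefl _ hω

lemma measurable_stateMark_real :
    Measurable fun q : JumpPath E × ℝ => q.1.stateMark q.2.toNNReal :=
  JumpPath.measurable_stateMark.comp (by fun_prop :
    Measurable fun q : JumpPath E × ℝ => (q.2.toNNReal, q.1))

open Classical in
-- Left limits may be replaced by states because the jump times are countable, hence null, and the
-- explosion constraint disappears on `[t, T]`.
lemma lintegral_tsum_jumps_eq (hP : IsJumpLaw t μ ν P) (hν : ∀ p, ν p univ ≤ L) (T : ℝ≥0)
    {K : ℝ≥0 × E × E → ℝ≥0∞} (hK : Measurable K) :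
    ∫⁻ ω, (∑' n, if ω.time (n + 1) ≤ T then
      K ((ω.time (n + 1)).toNNReal, ω.markD n, ω.markD (n + 1)) else 0) ∂P =
    ∫⁻ ω, (∫⁻ s in Icc (t : ℝ) T, ∫⁻ y, K (s.toNNReal, ω.stateMark s.toNNReal, y)
        ∂ν (s.toNNReal, ω.stateMark s.toNNReal)) ∂P := by
  rw [lintegral_tsum_jumps hP T hK]
  refine lintegral_congr_ae ?_
  filter_upwards [ae_exists_lt_time hP hν T] with ω ⟨m, hm⟩
  have hexp : (T : ℝ≥0∞) < ω.explosionTime := hm.trans_le (le_iSup ω.time _)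
  have hmE : MeasurableSet {s : ℝ | (t : ℝ) ≤ s ∧ ENNReal.ofReal s < ω.explosionTime} :=
    measurableSet_Ici.inter (measurableSet_lt ENNReal.measurable_ofReal measurable_const)
  rw [← lintegral_indicator hmE,
    ← lintegral_indicator measurableSet_Icc]
  refine lintegral_congr_ae ?_
  have hcount : ∀ᵐ s : ℝ, ∀ n, s ≠ (ω.time n).toReal :=
    ae_all_iff.2 fun n => Measure.ae_ne volume _
  filter_upwards [hcount] with s hs
  by_cases hsT : s ≤ T
  · by_cases hst : (t : ℝ) ≤ s
    · have h0 : 0 ≤ s := t.2.trans hst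
      have h1 : ENNReal.ofReal s < ω.explosionTime := by
        refine lt_of_le_of_lt ?_ hexp
        exact ENNReal.ofReal_le_of_le_toReal hsT
      have h2 : ω.leftMark s.toNNReal = ω.stateMark s.toNNReal := by
        refine JumpPath.leftMark_eq_stateMark h1 fun n hn => hs n ?_
        rw [hn, ENNReal.coe_toReal, Real.coe_toNNReal s h0]
      simp [indicator, hst, hsT, h1, h2]
    · simp [indicator, hst]
  · simp [indicator, hsT]

end Expectation

end JumpControl

namespace JumpControl

/-! ### Dynkin's formula -/

section Dynkin

variable {E : Type*} [MeasurableSpace E] {t : ℝ≥0} {μ : Measure E} {ν : Kernel (ℝ≥0 × E) E}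
  {P : Measure (JumpPath E)} {L : ℝ≥0}

lemma measurable_stateMark_rate [IsFiniteKernel ν] {K : ℝ≥0 × E × E → ℝ≥0∞}
    (hK : Measurable K) :
    Measurable fun q : JumpPath E × ℝ =>
      ∫⁻ y, K (q.2.toNNReal, q.1.stateMark q.2.toNNReal, y)
        ∂ν (q.2.toNNReal, q.1.stateMark q.2.toNNReal) := by
  have hX : Measurable fun q : JumpPath E × ℝ => (q.2.toNNReal, q.1.stateMark q.2.toNNReal) :=
    (by fun_prop : Measurable fun q : JumpPath E × ℝ => q.2.toNNReal).prodMk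
      measurable_stateMark_real
  refine Measurable.lintegral_kernel_prod_right'
    (κ := ν.comap (fun q : JumpPath E × ℝ => (q.2.toNNReal, q.1.stateMark q.2.toNNReal)) hX)
    (f := fun q => K (q.1.2.toNNReal, q.1.1.stateMark q.1.2.toNNReal, q.2)) ?_
  exact hK.comp ((measurable_fst.comp (hX.comp measurable_fst)).prodMk
    ((measurable_snd.comp (hX.comp measurable_fst)).prodMk measurable_snd))

open Classical in
-- Bounded rates make the compensator side finite, hence also the sum over jumps, so the extended
-- identity passes to real integrals.
lemma integral_tsum_jumps_of_nonneg (hP : IsJumpLaw t μ ν P) (hν : ∀ p, ν p univ ≤ L)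
    {T : ℝ≥0} (htT : t ≤ T) {K : ℝ≥0 × E × E → ℝ} (hK : Measurable K) {C : ℝ}
    (hK0 : ∀ q, 0 ≤ K q) (hKC : ∀ q, K q ≤ C) :
    Integrable (fun ω : JumpPath E => ∑' n, if ω.time (n + 1) ≤ T then
      K ((ω.time (n + 1)).toNNReal, ω.markD n, ω.markD (n + 1)) else 0) P ∧
    Integrable (fun ω : JumpPath E => ∫ s in (t : ℝ)..T, ∫ y, K (s.toNNReal, ω.stateMark s.toNNReal, y)
        ∂ν (s.toNNReal, ω.stateMark s.toNNReal)) P ∧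
    ∫ ω, (∑' n, if ω.time (n + 1) ≤ T then
      K ((ω.time (n + 1)).toNNReal, ω.markD n, ω.markD (n + 1)) else 0) ∂P =
    ∫ ω, (∫ s in (t : ℝ)..T, ∫ y, K (s.toNNReal, ω.stateMark s.toNNReal, y)
        ∂ν (s.toNNReal, ω.stateMark s.toNNReal)) ∂P := by
  have := hP.isProbability
  have hfin : IsFiniteKernel ν := ⟨⟨L, ENNReal.coe_lt_top, hν⟩⟩
  have hKe : Measurable fun q => ENNReal.ofReal (K q) := hK.ennreal_ofReal
  let a : JumpPath E → ℝ → ℝ≥0∞ := fun ω s =>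
    ∫⁻ y, ENNReal.ofReal (K (s.toNNReal, ω.stateMark s.toNNReal, y))
      ∂ν (s.toNNReal, ω.stateMark s.toNNReal)
  let A : JumpPath E → ℝ≥0∞ := fun ω => ∫⁻ s in Icc (t : ℝ) T, a ω s
  let J : JumpPath E → ℝ≥0∞ := fun ω : JumpPath E => ∑' n, if ω.time (n + 1) ≤ T then
    ENNReal.ofReal (K ((ω.time (n + 1)).toNNReal, ω.markD n, ω.markD (n + 1))) else 0
  have ha : Measurable (Function.uncurry a) := measurable_stateMark_rate hKe
  have hA : Measurable A := ha.lintegral_prod_right'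
  have hJ : Measurable J := measurable_tsum_jumps T hKe
  have hJA : ∫⁻ ω, J ω ∂P = ∫⁻ ω, A ω ∂P := lintegral_tsum_jumps_eq hP hν T hKe
  have hale : ∀ ω s, a ω s ≤ ENNReal.ofReal C * L := fun ω s =>
    calc a ω s ≤ ∫⁻ _, ENNReal.ofReal C ∂ν (s.toNNReal, ω.stateMark s.toNNReal) :=
          lintegral_mono fun y => ENNReal.ofReal_le_ofReal (hKC _)
      _ ≤ _ := by
          rw [lintegral_const]
          exact mul_le_mul_right (hν _) _
  have hafin : ∀ ω s, a ω s < ⊤ := fun ω s => (hale ω s).trans_lt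
    (ENNReal.mul_lt_top ENNReal.ofReal_lt_top ENNReal.coe_lt_top)
  have hAle : ∀ ω, A ω ≤ ENNReal.ofReal C * L * ENNReal.ofReal (T - t) := fun ω =>
    (lintegral_mono (hale ω)).trans (by simp)
  have hbd : ENNReal.ofReal C * L * ENNReal.ofReal (T - t) < ⊤ := ENNReal.mul_lt_top
    (ENNReal.mul_lt_top ENNReal.ofReal_lt_top ENNReal.coe_lt_top) ENNReal.ofReal_lt_top
  have hAint : ∫⁻ ω, A ω ∂P ≠ ⊤ := by
    refine ne_top_of_le_ne_top hbd.ne ((lintegral_mono hAle).trans ?_)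
    simp
  have hJint : ∫⁻ ω, J ω ∂P ≠ ⊤ := hJA ▸ hAint
  have hJreal : (fun ω : JumpPath E => ∑' n, if ω.time (n + 1) ≤ T then
      K ((ω.time (n + 1)).toNNReal, ω.markD n, ω.markD (n + 1)) else 0) =
      fun ω => (J ω).toReal := by
    ext ω
    rw [ENNReal.tsum_toReal_eq fun n => by split_ifs <;> simp]
    refine tsum_congr fun n => ?_
    split_ifs
    · rw [ENNReal.toReal_ofReal (hK0 _)]
    · simp
  have hAreal : (fun ω : JumpPath E => ∫ s in (t : ℝ)..T,
      ∫ y, K (s.toNNReal, ω.stateMark s.toNNReal, y)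
        ∂ν (s.toNNReal, ω.stateMark s.toNNReal)) = fun ω => (A ω).toReal := by
    ext ω
    have h1 : ∀ s : ℝ, ∫ y, K (s.toNNReal, ω.stateMark s.toNNReal, y)
        ∂ν (s.toNNReal, ω.stateMark s.toNNReal) = (a ω s).toReal := fun s =>
      integral_eq_lintegral_of_nonneg_ae (Filter.Eventually.of_forall fun y => hK0 _)
        (hK.comp (measurable_const.prodMk
          (measurable_const.prodMk measurable_id))).aestronglyMeasurable
    simp only [h1]
    rw [intervalIntegral.integral_of_le (by exact_mod_cast htT), ← integral_Icc_eq_integral_Ioc,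
      integral_toReal]
    · exact (ha.comp measurable_prodMk_left).aemeasurable
    · exact Filter.Eventually.of_forall (hafin ω)
  rw [hJreal, hAreal]
  refine ⟨integrable_toReal_of_lintegral_ne_top hJ.aemeasurable hJint,
    integrable_toReal_of_lintegral_ne_top hA.aemeasurable hAint, ?_⟩
  rw [integral_toReal hJ.aemeasurable (ae_lt_top hJ hJint),
    integral_toReal hA.aemeasurable (ae_lt_top hA hAint), hJA]

lemma integrable_of_bounded {α : Type*} [MeasurableSpace α] {m : Measure α} [IsFiniteMeasure m]
    {φ : α → ℝ} (hφ : Measurable φ) {C : ℝ} (hC : ∀ a, |φ a| ≤ C) : Integrable φ m :=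
  Integrable.of_bound hφ.aestronglyMeasurable C (Filter.Eventually.of_forall hC)

lemma measurable_integral_rate [IsFiniteKernel ν] {K : ℝ≥0 × E × E → ℝ} (hK : Measurable K)
    (ω : JumpPath E) :
    Measurable fun s : ℝ => ∫ y, K (s.toNNReal, ω.stateMark s.toNNReal, y)
        ∂ν (s.toNNReal, ω.stateMark s.toNNReal) := by
  have hX : Measurable fun s : ℝ => (s.toNNReal, ω.stateMark s.toNNReal) :=
    measurable_real_toNNReal.prodMk (measurable_stateMark_real.comp measurable_prodMk_left)
  have hf : Measurable fun q : ℝ × E => K (q.1.toNNReal, ω.stateMark q.1.toNNReal, q.2) :=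
    hK.comp ((measurable_fst.comp (hX.comp measurable_fst)).prodMk
      ((measurable_snd.comp (hX.comp measurable_fst)).prodMk measurable_snd))
  exact (hf.stronglyMeasurable.integral_kernel_prod_right'
    (κ := ν.comap (fun s : ℝ => (s.toNNReal, ω.stateMark s.toNNReal)) hX)).measurable

lemma abs_integral_le_of_bounded {α : Type*} [MeasurableSpace α] {m : Measure α}
    (hm : m univ ≤ L) {φ : α → ℝ} {C : ℝ} (hC0 : 0 ≤ C) (hC : ∀ a, |φ a| ≤ C) :
    |∫ a, φ a ∂m| ≤ C * L := by
  have : IsFiniteMeasure m := ⟨hm.trans_lt ENNReal.coe_lt_top⟩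
  refine (norm_integral_le_of_norm_le_const (μ := m) (f := φ) (C := C)
    (Filter.Eventually.of_forall hC)).trans ?_
  exact mul_le_mul_of_nonneg_left (ENNReal.toReal_le_coe_of_le_coe hm) hC0

open Classical in
/-- The compensator formula for bounded real integrands. -/
lemma integral_tsum_jumps_eq (hP : IsJumpLaw t μ ν P) (hν : ∀ p, ν p univ ≤ L)
    {T : ℝ≥0} (htT : t ≤ T) {K : ℝ≥0 × E × E → ℝ} (hK : Measurable K) {C : ℝ}
    (hKC : ∀ q, |K q| ≤ C) :
    Integrable (fun ω : JumpPath E => ∑' n, if ω.time (n + 1) ≤ T then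
      K ((ω.time (n + 1)).toNNReal, ω.markD n, ω.markD (n + 1)) else 0) P ∧
    Integrable (fun ω : JumpPath E => ∫ s in (t : ℝ)..T, ∫ y, K (s.toNNReal, ω.stateMark s.toNNReal, y)
        ∂ν (s.toNNReal, ω.stateMark s.toNNReal)) P ∧
    ∫ ω, (∑' n, if ω.time (n + 1) ≤ T then
      K ((ω.time (n + 1)).toNNReal, ω.markD n, ω.markD (n + 1)) else 0) ∂P =
    ∫ ω, (∫ s in (t : ℝ)..T, ∫ y, K (s.toNNReal, ω.stateMark s.toNNReal, y)
        ∂ν (s.toNNReal, ω.stateMark s.toNNReal)) ∂P := by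
  have hfin : IsFiniteKernel ν := ⟨⟨L, ENNReal.coe_lt_top, hν⟩⟩
  rcases isEmpty_or_nonempty E with hE | ⟨⟨x⟩⟩
  · have : IsEmpty (JumpPath E) := ⟨fun ω => hE.elim ω.init⟩
    simp [Integrable, HasFiniteIntegral, Measure.eq_zero_of_isEmpty P]
  have hC0 : 0 ≤ C := (abs_nonneg _).trans (hKC (0, x, x))
  -- Shifting by the bound makes the integrand nonnegative; the constant integrand is then
  -- subtracted.
  obtain ⟨h1, h2, h3⟩ := integral_tsum_jumps_of_nonneg hP hν htT (hK.add_const C) (C := C + C)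
    (fun q => by linarith [neg_abs_le (K q), hKC q]) fun q => by linarith [le_abs_self (K q), hKC q]
  obtain ⟨k1, k2, k3⟩ := integral_tsum_jumps_of_nonneg hP hν htT (K := fun _ => C)
    measurable_const (C := C) (fun _ => hC0) fun _ => le_rfl
  have hS : (fun ω : JumpPath E => ∑' n, if ω.time (n + 1) ≤ T then
      K ((ω.time (n + 1)).toNNReal, ω.markD n, ω.markD (n + 1)) else 0) =ᵐ[P]
      (fun ω : JumpPath E => (∑' n, if ω.time (n + 1) ≤ T then
        K ((ω.time (n + 1)).toNNReal, ω.markD n, ω.markD (n + 1)) + C else 0) -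
        ∑' n, if ω.time (n + 1) ≤ T then C else 0) := by
    -- Non-explosion makes the sums finite, so they may be subtracted term by term.
    filter_upwards [ae_exists_lt_time hP hν T] with ω ⟨m, hm⟩
    have hz : ∀ n ∉ Finset.range m, ¬ ω.time (n + 1) ≤ T := fun n hn => by
      rw [Finset.mem_range, not_lt] at hn
      exact not_le.2 (hm.trans_le (ω.time_monotone (by omega)))
    rw [tsum_eq_sum (s := Finset.range m) fun n hn => if_neg (hz n hn),
      tsum_eq_sum (s := Finset.range m) fun n hn => if_neg (hz n hn),
      tsum_eq_sum (s := Finset.range m) fun n hn => if_neg (hz n hn),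
      ← Finset.sum_sub_distrib]
    refine Finset.sum_congr rfl fun n _ => ?_
    split_ifs <;> ring
  have hI : (fun ω : JumpPath E => ∫ s in (t : ℝ)..T,
      ∫ y, K (s.toNNReal, ω.stateMark s.toNNReal, y)
        ∂ν (s.toNNReal, ω.stateMark s.toNNReal)) =
      fun ω : JumpPath E => (∫ s in (t : ℝ)..T, ∫ y, (K (s.toNNReal, ω.stateMark s.toNNReal, y) + C)
        ∂ν (s.toNNReal, ω.stateMark s.toNNReal)) -
        ∫ s in (t : ℝ)..T, ∫ _, C ∂ν (s.toNNReal, ω.stateMark s.toNNReal) := by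
    ext ω
    rw [← intervalIntegral.integral_sub]
    · refine intervalIntegral.integral_congr fun s _ => ?_
      rw [← integral_sub]
      · simp
      · exact (integrable_of_bounded (hK.comp (by fun_prop : Measurable fun y : E =>
          (s.toNNReal, ω.stateMark s.toNNReal, y))) fun _ => hKC _).add (integrable_const C)
      · exact integrable_const C
    · refine intervalIntegrable_of_measurable_bounded
        (measurable_integral_rate (hK.add_const C) ω) (L := (C + C) * L) (fun s => ?_) _ _
      exact abs_integral_le_of_bounded (hν _) (by linarith) fun y =>
        (abs_add_le _ _).trans (add_le_add (hKC _) (abs_of_nonneg hC0).le)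
    · refine intervalIntegrable_of_measurable_bounded
        (measurable_integral_rate (K := fun _ => C) measurable_const ω) (L := C * L)
        (fun s => ?_) _ _
      exact abs_integral_le_of_bounded (hν _) hC0 fun y => (abs_of_nonneg hC0).le
  rw [hI, integral_congr_ae hS]
  refine ⟨(h1.sub k1).congr hS.symm, h2.sub k2, ?_⟩
  rw [integral_sub h1 k1, integral_sub h2 k2, h3, k3]

lemma integrable_terminal [IsFiniteMeasure P] (T : ℝ≥0) {φ : E → ℝ} (hφ : Measurable φ) {C : ℝ}
    (hC : ∀ y, |φ y| ≤ C) : Integrable (fun ω => φ (ω.stateMark T)) P :=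
  integrable_of_bounded (hφ.comp (JumpPath.measurable_stateMark.comp measurable_prodMk_left))
    fun _ => hC _

lemma measurable_running (ω : JumpPath E) {h : ℝ → E → ℝ}
    (hh : Measurable (Function.uncurry h)) :
    Measurable fun s : ℝ => h s (ω.stateMark s.toNNReal) :=
  hh.comp (measurable_id.prodMk (measurable_stateMark_real.comp measurable_prodMk_left))

lemma integrable_running [IsFiniteMeasure P] {T : ℝ≥0} (htT : t ≤ T) {h : ℝ → E → ℝ}
    (hh : Measurable (Function.uncurry h)) {C : ℝ} (hC : ∀ s y, |h s y| ≤ C) :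
    Integrable (fun ω : JumpPath E => ∫ s in (t : ℝ)..T, h s (ω.stateMark s.toNNReal)) P := by
  have hm : Measurable fun q : JumpPath E × ℝ => h q.2 (q.1.stateMark q.2.toNNReal) :=
    hh.comp (measurable_snd.prodMk measurable_stateMark_real)
  have htT' : (t : ℝ) ≤ T := htT
  refine integrable_of_bounded (C := C * |(T : ℝ) - t|) ?_ fun ω =>
    intervalIntegral.norm_integral_le_of_norm_le_const
      (f := fun s => h s (ω.stateMark s.toNNReal)) fun s _ => hC _ _
  simp_rw [intervalIntegral.integral_of_le htT']
  exact (hm.stronglyMeasurable.integral_prod_right' (ν := volume.restrict (Ioc (t : ℝ) T))).measurable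

/-- Dynkin's formula for functions that are absolutely continuous in time. -/
theorem dynkin_formula [MeasurableSingletonClass E] {x : E}
    (hP : IsJumpLaw t (Measure.dirac x) ν P) (hν : ∀ p, ν p univ ≤ L) {T : ℝ≥0} (htT : t ≤ T)
    {w h : ℝ → E → ℝ} (hw : Measurable (Function.uncurry w))
    (hh : Measurable (Function.uncurry h)) {C : ℝ} (hwC : ∀ s y, |w s y| ≤ C)
    (hhC : ∀ s y, |h s y| ≤ C)
    (hwh : ∀ s ∈ Icc (t : ℝ) T, ∀ y, w s y = w T y + ∫ r in s..T, h r y) :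
    Integrable (fun ω : JumpPath E => w T (ω.stateMark T) + ∫ s in (t : ℝ)..T,
      (h s (ω.stateMark s.toNNReal) - ∫ y, (w s.toNNReal y - w s.toNNReal (ω.stateMark s.toNNReal))
        ∂ν (s.toNNReal, ω.stateMark s.toNNReal))) P ∧
    w t x = ∫ ω, (w T (ω.stateMark T) + ∫ s in (t : ℝ)..T,
      (h s (ω.stateMark s.toNNReal) - ∫ y, (w s.toNNReal y - w s.toNNReal (ω.stateMark s.toNNReal))
        ∂ν (s.toNNReal, ω.stateMark s.toNNReal))) ∂P := by
  classical
  have := hP.isProbability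
  have hfin : IsFiniteKernel ν := ⟨⟨L, ENNReal.coe_lt_top, hν⟩⟩
  have hC0 : 0 ≤ C := (abs_nonneg _).trans (hwC 0 x)
  -- The jump of `w`. Its sum along the path is known pathwise by telescoping, its mean by the
  -- compensator; equating the two gives the formula.
  let K : ℝ≥0 × E × E → ℝ := fun q => w q.1 q.2.2 - w q.1 q.2.1
  have hK : Measurable K :=
    (hw.comp (by fun_prop : Measurable fun q : ℝ≥0 × E × E => ((q.1 : ℝ), q.2.2))).sub
      (hw.comp (by fun_prop : Measurable fun q : ℝ≥0 × E × E => ((q.1 : ℝ), q.2.1)))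
  have hKC : ∀ q, |K q| ≤ C + C := fun q =>
    (abs_sub _ _).trans (add_le_add (hwC _ _) (hwC _ _))
  obtain ⟨h1, h2, h3⟩ := integral_tsum_jumps_eq hP hν htT hK hKC
  have hinit : ∀ᵐ ω ∂P, ω.init = x := by
    have h4 : ∀ᵐ y ∂P.map JumpPath.init, y = x := by
      rw [hP.init_law, ae_dirac_eq]; simp
    exact ae_of_ae_map JumpPath.measurable_init.aemeasurable h4
  have hpath : ∀ᵐ ω : JumpPath E ∂P, (∑' n, if ω.time (n + 1) ≤ T then
      K ((ω.time (n + 1)).toNNReal, ω.markD n, ω.markD (n + 1)) else 0) =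
      w T (ω.stateMark T) + (∫ r in (t : ℝ)..T, h r (ω.stateMark r.toNNReal)) - w t x := by
    filter_upwards [hinit, ae_lt_time_one hP hν, ae_exists_lt_time hP hν T] with ω hi ht ⟨m, hm⟩
    rw [tsum_eq_sum (s := Finset.range m) fun n hn => if_neg ?_, ← hi]
    · exact sum_jumps_of_integral ω htT hm ht
        (fun y => hh.comp measurable_prodMk_right) hhC hwh
    · rw [Finset.mem_range, not_lt] at hn
      exact not_le.2 (hm.trans_le (ω.time_monotone (by omega)))
  have hsplit : ∀ ω : JumpPath E, (∫ s in (t : ℝ)..T, (h s (ω.stateMark s.toNNReal) -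
      ∫ y, (w s.toNNReal y - w s.toNNReal (ω.stateMark s.toNNReal))
        ∂ν (s.toNNReal, ω.stateMark s.toNNReal))) =
      (∫ s in (t : ℝ)..T, h s (ω.stateMark s.toNNReal)) - ∫ s in (t : ℝ)..T,
        ∫ y, K (s.toNNReal, ω.stateMark s.toNNReal, y)
          ∂ν (s.toNNReal, ω.stateMark s.toNNReal) := fun ω => by
    rw [← intervalIntegral.integral_sub]
    · exact intervalIntegrable_of_measurable_bounded (measurable_running ω hh)
        (fun s => hhC _ _) _ _
    · exact intervalIntegrable_of_measurable_bounded (measurable_integral_rate hK ω)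
        (fun s => abs_integral_le_of_bounded (hν _) (by linarith) fun y => hKC _) _ _
  have hterm : Integrable (fun ω : JumpPath E => w T (ω.stateMark T)) P :=
    integrable_terminal T (hw.comp measurable_prodMk_left) (hwC _)
  have hrun := integrable_running (P := P) htT hh hhC
  simp_rw [hsplit]
  have hadd : Integrable (fun ω : JumpPath E => w T (ω.stateMark T) +
      ∫ s in (t : ℝ)..T, h s (ω.stateMark s.toNNReal)) P := hterm.add hrun
  have hsub : Integrable (fun ω : JumpPath E =>
      (∫ s in (t : ℝ)..T, h s (ω.stateMark s.toNNReal)) - ∫ s in (t : ℝ)..T,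
        ∫ y, K (s.toNNReal, ω.stateMark s.toNNReal, y)
          ∂ν (s.toNNReal, ω.stateMark s.toNNReal)) P := hrun.sub h2
  refine ⟨hterm.add hsub, ?_⟩
  rw [integral_congr_ae hpath, integral_sub hadd (integrable_const _),
    integral_add hterm hrun] at h3
  rw [integral_add hterm hsub, integral_sub hrun h2, ← h3]
  simp only [integral_const, probReal_univ, one_smul]
  ring

end Dynkin

end JumpControl

namespace JumpControl

open Filter Topology

/-! ### Bounded upper semicontinuous functions -/

section Semicontinuity

/-- Sup-convolution: `φ n z` is the supremum over `w` of `v w - n * dist z w`. Lipschitz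
approximants matter later, since they give continuity in time uniformly in space. -/
theorem IsUSCBounded.exists_lipschitz_approx {S : Type*} [PseudoMetricSpace S] {v : S → ℝ}
    (hv : IsUSCBounded v) : ∃ (C : ℝ) (φ : ℕ → S → ℝ), (∀ n : ℕ, LipschitzWith n (φ n)) ∧
      (∀ n z, |φ n z| ≤ C) ∧ (∀ n z, v z ≤ φ n z) ∧
      ∀ z, Tendsto (fun n => φ n z) atTop (𝓝 (v z)) := by
  obtain ⟨hv, C, hC⟩ := hv
  have hbdd (n : ℕ) (z : S) : BddAbove (range fun w => v w - n * dist z w) := by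
    refine ⟨C, ?_⟩
    rintro _ ⟨w, rfl⟩
    have h1 := (abs_le.1 (hC w)).2
    have h2 : 0 ≤ (n : ℝ) * dist z w := by positivity
    simp only
    linarith
  have hle (n : ℕ) (z : S) : v z ≤ ⨆ w, (v w - n * dist z w) := by
    simpa using le_ciSup (hbdd n z) z
  have hge (n : ℕ) (z : S) : ⨆ w, (v w - n * dist z w) ≤ C := by
    have : Nonempty S := ⟨z⟩
    refine ciSup_le fun w => ?_
    have h1 := (abs_le.1 (hC w)).2
    have h2 : 0 ≤ (n : ℝ) * dist z w := by positivity
    linarith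
  refine ⟨C, fun n z => ⨆ w, (v w - n * dist z w), fun n : ℕ => ?_, fun n z => ?_, hle, fun z => ?_⟩
  · refine LipschitzWith.of_le_add_mul _ fun x y => ?_
    have : Nonempty S := ⟨x⟩
    refine ciSup_le fun w => ?_
    have h1 := le_ciSup (hbdd n y) w
    have h2 : (n : ℝ) * dist y w ≤ n * (dist x y + dist x w) := by
      gcongr
      rw [dist_comm x y]
      exact dist_triangle _ _ _
    simp only [NNReal.coe_natCast]
    linarith
  · exact abs_le.2 ⟨(abs_le.1 (hC z)).1.trans (hle n z), hge n z⟩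
  · refine tendsto_order.2 ⟨fun a ha => Eventually.of_forall fun n => ha.trans_le (hle n z),
      fun a ha => ?_⟩
    obtain ⟨b, hb, hba⟩ := exists_between ha
    obtain ⟨δ, hδ, hball⟩ := Metric.eventually_nhds_iff.1 (hv z b hb)
    -- Within `δ` of `z` the function stays below `b`; farther away the penalty `n δ` exceeds `C -
    -- b`, so distant points cannot raise the supremum above `b`.
    obtain ⟨N, hN⟩ := exists_nat_ge ((C - b) / δ)
    filter_upwards [eventually_ge_atTop N] with n hn
    refine lt_of_le_of_lt ?_ hba
    have : Nonempty S := ⟨z⟩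
    refine ciSup_le fun w => ?_
    by_cases hw : dist w z < δ
    · have h1 := hball hw
      have h2 : 0 ≤ (n : ℝ) * dist z w := by positivity
      linarith
    · have h1 := (abs_le.1 (hC w)).2
      have h2 : (C - b) / δ * δ ≤ n * dist z w := by
        rw [dist_comm] at hw
        have h3 : (C - b) / δ ≤ n := hN.trans (by exact_mod_cast hn)
        calc (C - b) / δ * δ ≤ n * δ := by gcongr
          _ ≤ n * dist z w := by gcongr; exact not_lt.1 hw
      rw [div_mul_cancel₀ _ hδ.ne'] at h2
      linarith

theorem IsUSCBounded.integrable {S : Type*} [TopologicalSpace S] [MeasurableSpace S]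
    [OpensMeasurableSpace S] {v : S → ℝ} (hv : IsUSCBounded v) (μ : Measure S)
    [IsFiniteMeasure μ] : Integrable v μ := by
  obtain ⟨hv, C, hC⟩ := hv
  exact Integrable.of_bound hv.measurable.aestronglyMeasurable C
    (Eventually.of_forall fun z => by simpa using hC z)

/-- Integrals of a bounded upper semicontinuous function with respect to a family of measures
that depends weakly continuously on a parameter are upper semicontinuous. -/
theorem upperSemicontinuous_integral {S Z : Type*} [PseudoMetricSpace S] [MeasurableSpace S]
    [OpensMeasurableSpace S] [TopologicalSpace Z] {κ : Z → Measure S}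
    [∀ z, IsFiniteMeasure (κ z)]
    (hκ : ∀ (φ : S → ℝ) (K : ℝ≥0) (C : ℝ), LipschitzWith K φ → (∀ q, |φ q| ≤ C) →
      Continuous fun z => ∫ q, φ q ∂κ z)
    {v : S → ℝ} (hv : IsUSCBounded v) : UpperSemicontinuous fun z => ∫ q, v q ∂κ z := by
  obtain ⟨C, φ, hL, hC, hle, hlim⟩ := hv.exists_lipschitz_approx
  have hint (n : ℕ) (z : Z) : Integrable (φ n) (κ z) :=
    Integrable.of_bound (hL n).continuous.measurable.aestronglyMeasurable C
      (Eventually.of_forall fun q => by simpa using hC n q)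
  intro z y hy
  -- A majorant `φ n` is chosen whose integral at the point `z` is already below `y`; its integral
  -- stays below `y` nearby and, the measures being positive, dominates that of `v`.
  have h1 : Tendsto (fun n => ∫ q, φ n q ∂κ z) atTop (𝓝 (∫ q, v q ∂κ z)) :=
    tendsto_integral_of_dominated_convergence (fun _ => C)
      (fun n => (hint n z).aestronglyMeasurable) (integrable_const _)
      (fun n => Eventually.of_forall fun q => by simpa using hC n q)
      (Eventually.of_forall hlim)
  obtain ⟨n, hn⟩ := (h1.eventually (gt_mem_nhds hy)).exists
  filter_upwards [(hκ (φ n) n C (hL n) (hC n)).continuousAt.eventually (gt_mem_nhds hn)] with z' hz'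
  exact (integral_mono (hv.integrable _) (hint n z') (hle n)).trans_lt hz'

theorem IsUSCBounded.continuous_mul {S : Type*} [TopologicalSpace S]
    {c v : S → ℝ} (hv : IsUSCBounded v) (hc : Continuous c) (hc0 : ∀ z, 0 < c z)
    {B : ℝ} (hcB : ∀ z, c z ≤ B) : IsUSCBounded fun z => c z * v z := by
  refine ⟨fun z y hy => ?_, ?_⟩
  · have h1 : v z < y / c z := by rwa [lt_div_iff₀ (hc0 z), mul_comm]
    obtain ⟨b, hb, hby⟩ := exists_between h1
    have h2 : ContinuousAt (fun z => y / c z) z :=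
      continuousAt_const.div hc.continuousAt (hc0 z).ne'
    filter_upwards [hv.1 z b hb, h2.eventually (lt_mem_nhds hby)] with q hq1 hq2
    have h3 := hq1.trans hq2
    rwa [lt_div_iff₀ (hc0 q), mul_comm] at h3
  · obtain ⟨C, hC⟩ := hv.2
    refine ⟨B * C, fun z => ?_⟩
    rw [abs_mul, abs_of_pos (hc0 z)]
    exact mul_le_mul (hcB z) (hC z) (abs_nonneg _) ((hc0 z).le.trans (hcB z))

theorem IsUSCBounded.add {S : Type*} [TopologicalSpace S] {v w : S → ℝ} (hv : IsUSCBounded v)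
    (hw : IsUSCBounded w) : IsUSCBounded fun z => v z + w z := by
  obtain ⟨C, hC⟩ := hv.2
  obtain ⟨D, hD⟩ := hw.2
  exact ⟨hv.1.add hw.1, C + D, fun z => (abs_add_le _ _).trans (add_le_add (hC z) (hD z))⟩

theorem IsUSCBounded.comp {S Z : Type*} [TopologicalSpace S] [TopologicalSpace Z] {v : S → ℝ}
    (hv : IsUSCBounded v) {i : Z → S} (hi : Continuous i) : IsUSCBounded fun z => v (i z) := by
  obtain ⟨C, hC⟩ := hv.2
  exact ⟨hv.1.comp hi, C, fun z => hC _⟩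

/-- A uniform limit of upper semicontinuous functions is upper semicontinuous. -/
theorem upperSemicontinuous_of_abs_sub_le {S : Type*} [TopologicalSpace S] {v : S → ℝ}
    {φ : ℕ → S → ℝ} {ε : ℕ → ℝ} (hφ : ∀ n, UpperSemicontinuous (φ n))
    (hε : Tendsto ε atTop (𝓝 0)) (h : ∀ n z, |φ n z - v z| ≤ ε n) : UpperSemicontinuous v := by
  intro z y hy
  have h0 : 0 < (y - v z) / 2 := by linarith
  obtain ⟨n, hn⟩ := (hε.eventually (gt_mem_nhds h0)).exists
  have h1 := abs_le.1 (h n z)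
  filter_upwards [hφ n z (y - (y - v z) / 2) (by linarith)] with q hq
  have h2 := abs_le.1 (h n q)
  linarith

theorem exists_eq_iSup_of_upperSemicontinuous {A Z : Type*} [TopologicalSpace A]
    [CompactSpace A] [Nonempty A] [TopologicalSpace Z] {F : Z × A → ℝ}
    (hF : UpperSemicontinuous F) (z : Z) :
    BddAbove (range fun a => F (z, a)) ∧ ∃ a, F (z, a) = ⨆ b, F (z, b) := by
  have h : UpperSemicontinuous fun a => F (z, a) := hF.comp (by fun_prop)
  obtain ⟨a, -, ha⟩ := UpperSemicontinuousOn.exists_isMaxOn univ_nonempty isCompact_univ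
    (h.upperSemicontinuousOn univ)
  have hb : BddAbove (range fun a => F (z, a)) :=
    ⟨F (z, a), by rintro _ ⟨b, rfl⟩; exact ha (mem_univ b)⟩
  exact ⟨hb, a, le_antisymm (le_ciSup hb a) (ciSup_le fun b => ha (mem_univ b))⟩

/-- Each point of `A` keeps the function below `y` on a product neighbourhood; compactness extracts
one neighbourhood of `z` valid for all `a`, and attainment keeps the supremum strictly below `y`. -/
theorem IsUSCBounded.iSup {A Z : Type*} [TopologicalSpace A] [CompactSpace A]
    [Nonempty A] [TopologicalSpace Z] {F : Z × A → ℝ} (hF : IsUSCBounded F) :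
    IsUSCBounded fun z => ⨆ a, F (z, a) := by
  refine ⟨fun z y hy => ?_, ?_⟩
  · have h1 : ∀ᶠ q in 𝓝 z, ∀ a ∈ (univ : Set A), F (q, a) < y := by
      refine isCompact_univ.eventually_forall_of_forall_eventually fun a _ => ?_
      exact hF.1 (z, a) y
        ((le_ciSup (exists_eq_iSup_of_upperSemicontinuous hF.1 z).1 a).trans_lt hy)
    filter_upwards [h1] with q hq
    obtain ⟨a, ha⟩ := (exists_eq_iSup_of_upperSemicontinuous hF.1 q).2
    exact ha ▸ hq a trivial
  · obtain ⟨C, hC⟩ := hF.2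
    refine ⟨C, fun z => ?_⟩
    obtain ⟨a, ha⟩ := (exists_eq_iSup_of_upperSemicontinuous hF.1 z).2
    simp only [← ha]
    exact hC _

end Semicontinuity

/-! ### Measurable selection of maximizers -/

section Selection

/-- Parametrizing `A` by a compact set of reals gives an order: the maximizers form a nonempty
closed set, whose least element is selected. -/
theorem exists_measurable_isMax_of_isCompact {A Z : Type*} [TopologicalSpace A] [CompactSpace A]
    [Nonempty A] [MeasurableSpace A] [BorelSpace A] [TopologicalSpace Z] [MeasurableSpace Z]
    [OpensMeasurableSpace Z] {K : Set ℝ} (hK : IsCompact K) {ψ : K → A} (hψ : Continuous ψ)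
    (hψs : Function.Surjective ψ) {F : Z × A → ℝ} (hF : IsUSCBounded F) :
    ∃ α : Z → A, Measurable α ∧ ∀ z, F (z, α z) = ⨆ a, F (z, a) := by
  have : CompactSpace K := isCompact_iff_compactSpace.1 hK
  have hmin (z : Z) : ∃ c : K, F (z, ψ c) = ⨆ a, F (z, a) ∧
      ∀ c', F (z, ψ c') = ⨆ a, F (z, a) → c ≤ c' := by
    obtain ⟨hb, a, ha⟩ := exists_eq_iSup_of_upperSemicontinuous hF.1 z
    have husc : UpperSemicontinuous fun c : K => F (z, ψ c) := hF.1.comp (by fun_prop)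
    have hcl : IsClosed {c : K | ⨆ a, F (z, a) ≤ F (z, ψ c)} := husc.isClosed_preimage _
    obtain ⟨c, hc⟩ := hψs a
    obtain ⟨c₀, hc₀, hle⟩ := hcl.isCompact.exists_isLeast ⟨c, by simp [hc, ha]⟩
    exact ⟨c₀, le_antisymm (le_ciSup hb _) hc₀, fun c' hc' => hle hc'.ge⟩
  choose c hc hcmin using hmin
  have hcm : Measurable fun z => (c z : ℝ) := by
    refine measurable_of_Iic fun r => ?_
    rcases isEmpty_or_nonempty {q : K // (q : ℝ) ≤ r} with h | h
    · convert MeasurableSet.empty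
      ext z
      simp only [mem_preimage, mem_Iic, mem_empty_iff_false, iff_false]
      exact fun hz => h.elim ⟨c z, hz⟩
    · have hcl : IsClosed {q : K | (q : ℝ) ≤ r} :=
        isClosed_le continuous_subtype_val continuous_const
      have : CompactSpace {q : K // (q : ℝ) ≤ r} := isCompact_iff_compactSpace.1 hcl.isCompact
      have hG : IsUSCBounded fun p : Z × {q : K // (q : ℝ) ≤ r} => F (p.1, ψ p.2) :=
        hF.comp (i := fun p : Z × {q : K // (q : ℝ) ≤ r} => (p.1, ψ p.2)) (by fun_prop)
      -- The least maximizer is at most `r` exactly when the supremum over parameters up to `r`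
      -- reaches the full supremum; both suprema are usc in `z`, hence Borel.
      have hset : (fun z => (c z : ℝ)) ⁻¹' Iic r =
          {z | ⨆ a, F (z, a) ≤ ⨆ q : {q : K // (q : ℝ) ≤ r}, F (z, ψ q)} := by
        ext z
        obtain ⟨hb, q, hq⟩ := exists_eq_iSup_of_upperSemicontinuous hG.1 z
        constructor
        · intro hz
          rw [mem_ofPred_eq, ← hc z]
          exact le_ciSup hb ⟨c z, hz⟩
        · intro hz
          rw [mem_ofPred_eq] at hz
          simp only at hq
          rw [← hq] at hz
          have h1 := hcmin z q (le_antisymm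
            (le_ciSup (exists_eq_iSup_of_upperSemicontinuous hF.1 z).1 _) hz)
          exact (Subtype.coe_le_coe.2 h1).trans q.2
      rw [hset]
      exact measurableSet_le hF.iSup.1.measurable hG.iSup.1.measurable
  exact ⟨fun z => ψ (c z), hψ.measurable.comp (hcm.subtype_mk (h := fun z => (c z).2)), hc⟩

/-- Measurable selection of maximizers of a bounded upper semicontinuous function. -/
theorem exists_measurable_isMax {A Z : Type*} [MetricSpace A] [CompactSpace A] [Nonempty A]
    [MeasurableSpace A] [BorelSpace A] [TopologicalSpace Z] [MeasurableSpace Z]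
    [OpensMeasurableSpace Z] {F : Z × A → ℝ} (hF : IsUSCBounded F) :
    ∃ α : Z → A, Measurable α ∧ ∀ z, F (z, α z) = ⨆ a, F (z, a) := by
  obtain ⟨ψ, hψ, hψs⟩ := exists_nat_bool_continuous_surjective_of_compact A
  exact exists_measurable_isMax_of_isCompact isCompact_cantorSet
    (hψ.comp cantorSetHomeomorphNatToBool.continuous)
    (hψs.comp cantorSetHomeomorphNatToBool.surjective) hF

end Selection

end JumpControl

namespace JumpControl

open Filter Topology

/-! ### Uniformization of the jump rate -/

section UniformizedRate

variable {E A : Type*} [MeasurableSpace E] [MeasurableSpace A] {T : ℝ}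

/-- The transition measure `lam(x, a, dy)`, completed at `x` to have total mass `L`, at a fixed
time. -/
noncomputable def uniformizedRate (lam : Kernel (E × A) E) (L : ℝ≥0)
    (z : (Icc (0 : ℝ) T × E) × A) : Measure (Icc (0 : ℝ) T × E) :=
  (lam (z.1.2, z.2)).map (fun y => (z.1.1, y)) +
    (L - lam (z.1.2, z.2) univ) • Measure.dirac z.1

variable {lam : Kernel (E × A) E} {L : ℝ≥0}

theorem uniformizedRate_univ (hL : ∀ p, lam p univ ≤ L) (z : (Icc (0 : ℝ) T × E) × A) :
    uniformizedRate lam L z univ = L := by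
  simp only [uniformizedRate, Measure.coe_add, Measure.coe_smul, Pi.add_apply, Pi.smul_apply,
    measure_univ, smul_eq_mul, mul_one]
  rw [Measure.map_apply measurable_prodMk_left MeasurableSet.univ, preimage_univ]
  exact add_tsub_cancel_of_le (hL _)

theorem isFiniteMeasure_uniformizedRate (hL : ∀ p, lam p univ ≤ L)
    (z : (Icc (0 : ℝ) T × E) × A) : IsFiniteMeasure (uniformizedRate lam L z) :=
  ⟨by rw [uniformizedRate_univ hL]; exact ENNReal.coe_lt_top⟩

/-- The kernel does not move time, so factors depending only on time pass through its integrals. -/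
theorem ae_uniformizedRate_fst (z : (Icc (0 : ℝ) T × E) × A) :
    ∀ᵐ q ∂uniformizedRate lam L z, q.1 = z.1.1 := by
  have hm : MeasurableSet {q : Icc (0 : ℝ) T × E | q.1 = z.1.1} :=
    measurable_fst (measurableSet_singleton _)
  rw [uniformizedRate, ae_add_measure_iff]
  refine ⟨(ae_map_iff measurable_prodMk_left.aemeasurable hm).2 (by simp), ?_⟩
  refine Measure.ae_smul_measure ?_ _
  exact (ae_dirac_iff hm).2 rfl

theorem integral_uniformizedRate (hL : ∀ p, lam p univ ≤ L) {φ : Icc (0 : ℝ) T × E → ℝ}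
    (hφ : Measurable φ) {C : ℝ} (hC : ∀ q, |φ q| ≤ C) (z : (Icc (0 : ℝ) T × E) × A) :
    ∫ q, φ q ∂uniformizedRate lam L z = ∫ y, φ (z.1.1, y) ∂lam (z.1.2, z.2) +
      (L - (lam (z.1.2, z.2)).real univ) * φ z.1 := by
  have hfin : IsFiniteMeasure (lam (z.1.2, z.2)) := ⟨(hL _).trans_lt ENNReal.coe_lt_top⟩
  have hb (μ : Measure (Icc (0 : ℝ) T × E)) [IsFiniteMeasure μ] : Integrable φ μ :=
    Integrable.of_bound hφ.aestronglyMeasurable C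
      (Eventually.of_forall fun z => by simpa using hC z)
  have hne : (L : ℝ≥0∞) - lam (z.1.2, z.2) univ ≠ ⊤ :=
    ENNReal.sub_ne_top ENNReal.coe_ne_top
  rw [uniformizedRate, integral_add_measure (hb _) ((hb _).smul_measure hne),
    integral_smul_measure, integral_dirac' _ _ hφ.stronglyMeasurable,
    integral_map measurable_prodMk_left.aemeasurable hφ.aestronglyMeasurable,
    ENNReal.toReal_sub_of_le (hL _) ENNReal.coe_ne_top]
  rfl

/-- The total rate `lam(x,a,E)` in front of `v(t,x)` is traded for the constant `L`; the
compensating atom has nonnegative mass `L - lam(x,a,E)`, so the remaining integral is against a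
positive measure. -/
theorem hamiltonian_eq (hL : ∀ p, lam p univ ≤ L) (f : Icc (0 : ℝ) T × E × A → ℝ)
    {v : Icc (0 : ℝ) T × E → ℝ} (hv : Measurable v) {C : ℝ} (hC : ∀ q, |v q| ≤ C)
    (t : Icc (0 : ℝ) T) (x : E) (a : A) :
    hamiltonian lam f v t x a =
      (∫ q, v q ∂uniformizedRate lam L ((t, x), a)) + f (t, x, a) - L * v (t, x) := by
  have hfin : IsFiniteMeasure (lam (x, a)) := ⟨(hL _).trans_lt ENNReal.coe_lt_top⟩
  have hi : Integrable (fun y => v (t, y)) (lam (x, a)) :=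
    Integrable.of_bound (hv.comp measurable_prodMk_left).aestronglyMeasurable C
      (Eventually.of_forall fun z => by simpa using hC _)
  rw [integral_uniformizedRate hL hv hC, hamiltonian, integral_sub hi (integrable_const _),
    integral_const, smul_eq_mul]
  ring

end UniformizedRate

/-! ### The Bellman operator -/

section Bellman

variable {E A : Type*} [PseudoMetricSpace E] [SecondCountableTopology E] [MeasurableSpace E]
  [BorelSpace E] [MetricSpace A] [MeasurableSpace A] {T : ℝ} {lam : Kernel (E × A) E} {L : ℝ≥0}

/-- The Feller property gives continuity in `(x, a)` for frozen time; the Lipschitz bound controls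
the change of time uniformly in `(x, a)`. -/
theorem continuous_integral_uniformizedRate (hL : ∀ p, lam p univ ≤ L) (hF : IsFeller lam)
    {φ : Icc (0 : ℝ) T × E → ℝ} {K : ℝ≥0} (hK : LipschitzWith K φ) {C : ℝ}
    (hC : ∀ q, |φ q| ≤ C) :
    Continuous fun z : (Icc (0 : ℝ) T × E) × A => ∫ q, φ q ∂uniformizedRate lam L z := by
  have hfin (p : E × A) : IsFiniteMeasure (lam p) := ⟨(hL _).trans_lt ENNReal.coe_lt_top⟩
  simp_rw [integral_uniformizedRate hL hK.continuous.measurable hC]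
  have hmass : Continuous fun p : E × A => (lam p).real univ := by
    simpa using hF (BoundedContinuousFunction.const E 1)
  refine Continuous.add ?_ ((continuous_const.sub (hmass.comp (by fun_prop))).mul
    (hK.continuous.comp continuous_fst))
  have hφc (t : Icc (0 : ℝ) T) : Continuous fun y => φ (t, y) := hK.continuous.comp (by fun_prop)
  have hsec (t : Icc (0 : ℝ) T) : Continuous fun p : E × A => ∫ y, φ (t, y) ∂lam p :=
    hF (BoundedContinuousFunction.ofNormedAddCommGroup (fun y => φ (t, y)) (hφc t) C
      fun y => by simpa using hC _)
  have hi (t : Icc (0 : ℝ) T) (p : E × A) : Integrable (fun y => φ (t, y)) (lam p) :=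
    Integrable.of_bound (hφc t).measurable.aestronglyMeasurable C
      (Eventually.of_forall fun z => by simpa using hC _)
  have hlip (s t : Icc (0 : ℝ) T) (p : E × A) :
      |∫ y, φ (s, y) ∂lam p - ∫ y, φ (t, y) ∂lam p| ≤ K * dist s t * L := by
    rw [← integral_sub (hi s p) (hi t p)]
    refine abs_integral_le_of_bounded (hL p) (by positivity) fun y => ?_
    have h1 := hK.dist_le_mul (s, y) (t, y)
    rwa [Real.dist_eq, Prod.dist_eq, dist_self, max_eq_left dist_nonneg] at h1
  rw [continuous_iff_continuousAt]
  rintro ⟨⟨t, x⟩, a⟩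
  have h1 : Tendsto (fun z : (Icc (0 : ℝ) T × E) × A => ∫ y, φ (t, y) ∂lam (z.1.2, z.2))
      (𝓝 ((t, x), a)) (𝓝 (∫ y, φ (t, y) ∂lam (x, a))) :=
    ((hsec t).comp (by fun_prop : Continuous fun z : (Icc (0 : ℝ) T × E) × A =>
      (z.1.2, z.2))).tendsto ((t, x), a)
  have h2 : Tendsto (fun z : (Icc (0 : ℝ) T × E) × A => (K : ℝ) * dist z.1.1 t * L)
      (𝓝 ((t, x), a)) (𝓝 0) := by
    have h3 : Continuous fun z : (Icc (0 : ℝ) T × E) × A => (K : ℝ) * dist z.1.1 t * L := by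
      fun_prop
    simpa using h3.tendsto ((t, x), a)
  have h3 := squeeze_zero_norm (fun z : (Icc (0 : ℝ) T × E) × A =>
    (Real.norm_eq_abs _).trans_le (hlip z.1.1 t (z.1.2, z.2))) h2
  rw [ContinuousAt]
  simpa using h3.add h1

theorem isUSCBounded_integral_uniformizedRate (hL : ∀ p, lam p univ ≤ L) (hF : IsFeller lam)
    {v : Icc (0 : ℝ) T × E → ℝ} (hv : IsUSCBounded v) :
    IsUSCBounded fun z : (Icc (0 : ℝ) T × E) × A => ∫ q, v q ∂uniformizedRate lam L z := by
  have hfin := isFiniteMeasure_uniformizedRate (T := T) hL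
  refine ⟨upperSemicontinuous_integral (fun φ K C hφ hC =>
    continuous_integral_uniformizedRate hL hF hφ hC) hv, ?_⟩
  obtain ⟨C, hC⟩ := hv.2
  refine ⟨|C| * L, fun z => abs_integral_le_of_bounded (uniformizedRate_univ hL z).le
    (abs_nonneg C) fun q => (hC q).trans (le_abs_self C)⟩

/-- The Bellman operator attached to the uniformized rate and to a running reward. -/
noncomputable def bellman (lam : Kernel (E × A) E) (L : ℝ≥0) (r : (Icc (0 : ℝ) T × E) × A → ℝ)
    (v : Icc (0 : ℝ) T × E → ℝ) (z : Icc (0 : ℝ) T × E) : ℝ :=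
  ⨆ a, (∫ q, v q ∂uniformizedRate lam L (z, a) + r (z, a))

variable [CompactSpace A] [Nonempty A] {r : (Icc (0 : ℝ) T × E) × A → ℝ}

theorem isUSCBounded_bellman (hL : ∀ p, lam p univ ≤ L) (hF : IsFeller lam) (hr : IsUSCBounded r)
    {v : Icc (0 : ℝ) T × E → ℝ} (hv : IsUSCBounded v) : IsUSCBounded (bellman lam L r v) :=
  ((isUSCBounded_integral_uniformizedRate hL hF hv).add hr).iSup

/-- The bound may depend on time because the kernel keeps time fixed; this is what permits a
weighted contraction. -/
theorem bellman_le_add (hL : ∀ p, lam p univ ≤ L) (hF : IsFeller lam) (hr : IsUSCBounded r)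
    {v w : Icc (0 : ℝ) T × E → ℝ} (hv : IsUSCBounded v) (hw : IsUSCBounded w)
    {b : Icc (0 : ℝ) T → ℝ} (hb : ∀ q, |v q - w q| ≤ b q.1) (z : Icc (0 : ℝ) T × E) :
    |bellman lam L r v z - bellman lam L r w z| ≤ L * b z.1 := by
  have key {v w : Icc (0 : ℝ) T × E → ℝ} (hv : IsUSCBounded v) (hw : IsUSCBounded w)
      (hb : ∀ q, |v q - w q| ≤ b q.1) :
      bellman lam L r v z ≤ bellman lam L r w z + L * b z.1 := by
    refine ciSup_le fun a => ?_
    have hfin := isFiniteMeasure_uniformizedRate (T := T) hL (z, a)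
    have h1 := le_ciSup (exists_eq_iSup_of_upperSemicontinuous
      ((isUSCBounded_integral_uniformizedRate hL hF hw).add hr).1 z).1 a
    have h2 : ∫ q, (v q - w q) ∂uniformizedRate lam L (z, a) ≤
        ∫ q, b z.1 ∂uniformizedRate lam L (z, a) := by
      refine integral_mono_ae ((hv.integrable _).sub (hw.integrable _)) (integrable_const _) ?_
      filter_upwards [ae_uniformizedRate_fst (lam := lam) (L := L) (z, a)] with q hq
      rw [← hq]
      exact (abs_le.1 (hb q)).2
    rw [integral_sub (hv.integrable _) (hw.integrable _), integral_const, Measure.real,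
      uniformizedRate_univ hL, ENNReal.coe_toReal, smul_eq_mul] at h2
    rw [bellman]
    linarith
  rw [abs_le]
  have h1 := key hv hw hb
  have h2 := key hw hv fun q => by rw [abs_sub_comm]; exact hb q
  constructor <;> linarith

end Bellman

end JumpControl

namespace JumpControl

open Filter Topology

/-! ### Fixed point of the integrated Bellman operator -/

section FixedPoint

variable {E A : Type*} [PseudoMetricSpace E] [SecondCountableTopology E] [MeasurableSpace E]
  [BorelSpace E] {T : ℝ} (hT : 0 < T)

theorem continuous_clamp : Continuous (clamp hT) :=
  continuous_projIcc (h := hT.le)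

theorem clamp_coe (t : Icc (0 : ℝ) T) : clamp hT t = t := projIcc_val _ t

theorem coe_clamp {s : ℝ} (hs : s ∈ Icc (0 : ℝ) T) : (clamp hT s : ℝ) = s := by
  rw [clamp, projIcc_of_mem hT.le hs]

theorem intervalIntegrable_of_isUSCBounded {m : Icc (0 : ℝ) T × E → ℝ} (hm : IsUSCBounded m)
    (x : E) (a b : ℝ) : IntervalIntegrable (fun s => m (clamp hT s, x)) volume a b := by
  obtain ⟨C, hC⟩ := hm.2
  exact intervalIntegrable_of_measurable_bounded
    (hm.1.measurable.comp ((continuous_clamp hT).measurable.prodMk measurable_const))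
    (fun _ => hC _) a b

/-- A second use of `upperSemicontinuous_integral`: the measures are the images of Lebesgue measure
on `(t, T]` under `s ↦ (s, x)`, which vary continuously on Lipschitz functions. -/
theorem isUSCBounded_integral_Ioc {m : Icc (0 : ℝ) T × E → ℝ} (hm : IsUSCBounded m) :
    IsUSCBounded fun z : Icc (0 : ℝ) T × E => ∫ s in (z.1 : ℝ)..T, m (clamp hT s, z.2) := by
  have hmeas (x : E) : Measurable fun s => (clamp hT s, x) :=
    (continuous_clamp hT).measurable.prodMk measurable_const
  have heq {φ : Icc (0 : ℝ) T × E → ℝ} (hφ : Measurable φ) (z : Icc (0 : ℝ) T × E) :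
      ∫ s in (z.1 : ℝ)..T, φ (clamp hT s, z.2) =
        ∫ q, φ q ∂((volume.restrict (Ioc (z.1 : ℝ) T)).map fun s => (clamp hT s, z.2)) := by
    rw [intervalIntegral.integral_of_le z.1.2.2,
      integral_map (hmeas _).aemeasurable hφ.aestronglyMeasurable]
  refine ⟨?_, ?_⟩
  · simp_rw [heq hm.1.measurable]
    refine upperSemicontinuous_integral (fun φ K C hφ hC => ?_) hm
    simp_rw [← heq hφ.continuous.measurable]
    have h1 : Continuous fun z : Icc (0 : ℝ) T × E =>
        ∫ s in T..(z.1 : ℝ), φ (clamp hT s, z.2) := by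
      refine intervalIntegral.continuous_parametric_intervalIntegral_of_continuous
        (f := fun (z : Icc (0 : ℝ) T × E) s => φ (clamp hT s, z.2))
        (s := fun z => (z.1 : ℝ)) ?_ (by fun_prop)
      have := continuous_clamp hT
      have := hφ.continuous
      unfold Function.uncurry
      fun_prop
    simp_rw [intervalIntegral.integral_symm T]
    exact h1.neg
  · obtain ⟨C, hC⟩ := hm.2
    refine ⟨|C| * T, fun z => ?_⟩
    have h1 := intervalIntegral.norm_integral_le_of_norm_le_const (a := (z.1 : ℝ)) (b := T)
      (f := fun s => m (clamp hT s, z.2)) (C := |C|) fun s _ => (hC _).trans (le_abs_self C)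
    rw [Real.norm_eq_abs, abs_of_nonneg (sub_nonneg.2 z.1.2.2)] at h1
    refine h1.trans (mul_le_mul_of_nonneg_left ?_ (abs_nonneg _))
    have := z.1.2.1
    linarith

/-- The weight for which one integration with constant `L` gains a factor one half. The factor `2 *
L` stays inside, so `L = 0` needs no separate treatment. -/
theorem integral_exp_weight (L : ℝ) (t : ℝ) :
    ∫ s in t..T, 2 * L * Real.exp (2 * L * (T - s)) = Real.exp (2 * L * (T - t)) - 1 := by
  have h (s : ℝ) (_ : s ∈ uIcc t T) : HasDerivAt (fun s => - Real.exp (2 * L * (T - s)))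
      (2 * L * Real.exp (2 * L * (T - s))) s := by
    have h1 : HasDerivAt (fun s => 2 * L * (T - s)) (2 * L * -1) s :=
      ((hasDerivAt_id s).const_sub T).const_mul _
    exact h1.exp.neg.congr_deriv (by ring)
  rw [intervalIntegral.integral_eq_sub_of_hasDerivAt h
    (Continuous.intervalIntegrable (by fun_prop) _ _)]
  simp
  ring

variable [MetricSpace A] [CompactSpace A] [Nonempty A] [MeasurableSpace A]
  {lam : Kernel (E × A) E} {L : ℝ≥0} {r : (Icc (0 : ℝ) T × E) × A → ℝ}

theorem abs_integral_bellman_sub_le (hL : ∀ p, lam p univ ≤ L) (hF : IsFeller lam)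
    (hr : IsUSCBounded r) {v w : Icc (0 : ℝ) T × E → ℝ} (hv : IsUSCBounded v)
    (hw : IsUSCBounded w) {b : ℝ → ℝ} (hb : Continuous b)
    (hvw : ∀ q, |v q - w q| ≤ b q.1) (z : Icc (0 : ℝ) T × E) :
    |(∫ s in (z.1 : ℝ)..T, bellman lam L r v (clamp hT s, z.2)) -
      ∫ s in (z.1 : ℝ)..T, bellman lam L r w (clamp hT s, z.2)| ≤
        ∫ s in (z.1 : ℝ)..T, L * b s := by
  rw [← intervalIntegral.integral_sub
    (intervalIntegrable_of_isUSCBounded hT (isUSCBounded_bellman hL hF hr hv) _ _ _)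
    (intervalIntegrable_of_isUSCBounded hT (isUSCBounded_bellman hL hF hr hw) _ _ _)]
  have hint : IntervalIntegrable (fun s => L * b s) volume z.1 T :=
    (continuous_const.mul hb).intervalIntegrable _ _
  rw [← Real.norm_eq_abs]
  refine intervalIntegral.norm_integral_le_of_norm_le z.1.2.2 (ae_of_all _ fun s hs => ?_) hint
  have h1 := bellman_le_add hL hF hr hv hw (b := fun t => b t) hvw
    (clamp hT s, z.2)
  rwa [coe_clamp hT ⟨z.1.2.1.trans hs.1.le, hs.2⟩] at h1

/-- Picard iteration from zero. It contracts in the weighted norm without any smallness of `T`, so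
the iterates converge uniformly and the limit stays usc. -/
theorem exists_bellman_fixedPoint (hL : ∀ p, lam p univ ≤ L) (hF : IsFeller lam)
    (hr : IsUSCBounded r) {G : E → ℝ} (hG : IsUSCBounded G) :
    ∃ v : Icc (0 : ℝ) T × E → ℝ, IsUSCBounded v ∧
      ∀ z, v z = G z.2 + ∫ s in (z.1 : ℝ)..T, bellman lam L r v (clamp hT s, z.2) := by
  set Ψ : (Icc (0 : ℝ) T × E → ℝ) → Icc (0 : ℝ) T × E → ℝ := fun v z =>
    G z.2 + ∫ s in (z.1 : ℝ)..T, bellman lam L r v (clamp hT s, z.2) with hΨ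
  have hΨusc {v} (hv : IsUSCBounded v) : IsUSCBounded (Ψ v) :=
    (hG.comp continuous_snd).add
      (isUSCBounded_integral_Ioc hT (isUSCBounded_bellman hL hF hr hv))
  have hΨsub {v w} (hv : IsUSCBounded v) (hw : IsUSCBounded w) {b : ℝ → ℝ} (hb : Continuous b)
      (hvw : ∀ q, |v q - w q| ≤ b q.1) (z) :
      |Ψ v z - Ψ w z| ≤ ∫ s in (z.1 : ℝ)..T, L * b s := by
    simp only [hΨ, add_sub_add_left_eq_sub]
    exact abs_integral_bellman_sub_le hT hL hF hr hv hw hb hvw z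
  set u : ℕ → Icc (0 : ℝ) T × E → ℝ := fun n => Ψ^[n] 0 with hu
  have hsucc (n : ℕ) : u (n + 1) = Ψ (u n) := Function.iterate_succ_apply' Ψ n 0
  have husc (n : ℕ) : IsUSCBounded (u n) := by
    induction n with
    | zero => exact ⟨upperSemicontinuous_const, 0, fun z => by simp [hu]⟩
    | succ n ih => rw [hsucc]; exact hΨusc ih
  obtain ⟨C, hC⟩ := (husc 1).2
  have hexp (t : Icc (0 : ℝ) T) : 1 ≤ Real.exp (2 * L * (T - t)) :=
    Real.one_le_exp (mul_nonneg (by positivity) (sub_nonneg.2 t.2.2))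
  -- Successive differences halve once measured against `exp(2L(T - t))`.
  have hgeom (n : ℕ) : ∀ z, |u n z - u (n + 1) z| ≤
      |C| / 2 ^ n * Real.exp (2 * L * (T - z.1)) := by
    induction n with
    | zero =>
      intro z
      have h1 : |u 0 z - u (0 + 1) z| ≤ |C| := by
        simpa [hu] using (hC z).trans (le_abs_self C)
      simpa using h1.trans (le_mul_of_one_le_right (abs_nonneg C) (hexp z.1))
    | succ n ih =>
      intro z
      rw [hsucc n, hsucc (n + 1)]
      refine (hΨsub (husc n) (husc (n + 1))
        (b := fun s => |C| / 2 ^ n * Real.exp (2 * L * (T - s))) (by fun_prop)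
        ih z).trans ?_
      have h1 (s : ℝ) : (L : ℝ) * (|C| / 2 ^ n * Real.exp (2 * L * (T - s))) =
          |C| / 2 ^ (n + 1) * (2 * L * Real.exp (2 * L * (T - s))) := by
        rw [pow_succ]; field_simp
      simp_rw [h1]
      rw [intervalIntegral.integral_const_mul, integral_exp_weight]
      gcongr
      linarith
  set D := |C| * Real.exp (2 * L * T) with hD
  -- The form `2 * D / 2 / 2 ^ n` is the one expected by the lemmas on geometric series of ratio one
  -- half.
  have hdist (z) (n : ℕ) : dist (u n z) (u (n + 1) z) ≤ 2 * D / 2 / 2 ^ n := by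
    rw [Real.dist_eq]
    refine (hgeom n z).trans ?_
    rw [mul_div_cancel_left₀ _ two_ne_zero, hD, mul_div_right_comm]
    have := z.1.2.1
    gcongr
    linarith
  choose v hv using fun z => cauchySeq_tendsto_of_complete (cauchySeq_of_le_geometric_two (hdist z))
  have hclose (n : ℕ) (z) : |u n z - v z| ≤ 2 * D / 2 ^ n :=
    dist_le_of_le_geometric_two_of_tendsto (hdist z) (hv z) n
  have hε : Tendsto (fun n : ℕ => 2 * D / 2 ^ n) atTop (𝓝 0) :=
    tendsto_const_nhds.div_atTop (tendsto_pow_atTop_atTop_of_one_lt one_lt_two)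
  have hvusc : IsUSCBounded v := by
    refine ⟨upperSemicontinuous_of_abs_sub_le (fun n => (husc n).1) hε hclose, 2 * D, fun z => ?_⟩
    simpa [hu] using hclose 0 z
  refine ⟨v, hvusc, fun z => tendsto_nhds_unique ((hv z).comp (tendsto_add_atTop_nat 1)) ?_⟩
  rw [tendsto_iff_norm_sub_tendsto_zero]
  have hbound (n : ℕ) : ‖u (n + 1) z - Ψ v z‖ ≤ (T - z.1) * (L * (2 * D / 2 ^ n)) := by
    rw [hsucc]
    have h1 := hΨsub (husc n) hvusc (b := fun _ => 2 * D / 2 ^ n) continuous_const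
      (hclose n) z
    rwa [intervalIntegral.integral_const, smul_eq_mul] at h1
  refine squeeze_zero (fun _ => norm_nonneg _) hbound ?_
  simpa using (hε.const_mul (L : ℝ)).const_mul (T - z.1)

end FixedPoint

end JumpControl

/-! ### Solution of the HJB equation -/

namespace JumpControl

open Filter Topology

theorem absolutelyContinuousOnInterval_congr {φ ψ : ℝ → ℝ} {a b : ℝ}
    (hφ : AbsolutelyContinuousOnInterval φ a b) (h : EqOn φ ψ (uIcc a b)) :
    AbsolutelyContinuousOnInterval ψ a b := by
  rw [absolutelyContinuousOnInterval_iff] at hφ ⊢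
  intro ε hε
  obtain ⟨δ, hδ, H⟩ := hφ ε hε
  refine ⟨δ, hδ, fun I hI hlen => ?_⟩
  have h1 := H I hI hlen
  rwa [Finset.sum_congr rfl fun i hi => by rw [h (hI.1 i hi).1, h (hI.1 i hi).2]] at h1

theorem IsUSCBounded.reassoc {X Y A : Type*} [TopologicalSpace X] [TopologicalSpace Y]
    [TopologicalSpace A] {f : X × Y × A → ℝ} (hf : IsUSCBounded f) :
    IsUSCBounded fun p : (X × Y) × A => f (p.1.1, p.1.2, p.2) :=
  hf.comp (i := fun p : (X × Y) × A => (p.1.1, p.1.2, p.2)) (by fun_prop)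

/-- The exponential depends only on time, which the kernel preserves, so it leaves the integral;
being positive, it also leaves the supremum. -/
theorem bellman_exp_mul {E A : Type*} [MeasurableSpace E] [MeasurableSpace A] {T : ℝ}
    {lam : Kernel (E × A) E} {L : ℝ≥0} {f : Icc (0 : ℝ) T × E × A → ℝ}
    (u : Icc (0 : ℝ) T × E → ℝ) (z : Icc (0 : ℝ) T × E) :
    bellman lam L (fun p => f (p.1.1, p.1.2, p.2)) (fun q => Real.exp (L * q.1) * u q) z =
      Real.exp (L * z.1) *
        bellman lam L (fun p => Real.exp (-(L * p.1.1)) * f (p.1.1, p.1.2, p.2)) u z := by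
  rw [bellman, bellman, Real.mul_iSup_of_nonneg (Real.exp_pos _).le]
  refine iSup_congr fun a => ?_
  have h1 : ∫ q, Real.exp (L * q.1) * u q ∂uniformizedRate lam L (z, a) =
      ∫ q, Real.exp (L * z.1) * u q ∂uniformizedRate lam L (z, a) := by
    refine integral_congr_ae ?_
    filter_upwards [ae_uniformizedRate_fst (lam := lam) (L := L) (z, a)] with q hq
    rw [hq]
  rw [h1, integral_const_mul, mul_add, ← mul_assoc, ← Real.exp_add, add_neg_cancel, Real.exp_zero,
    one_mul]

section Solution

variable {E A : Type*} [PseudoMetricSpace E] [SecondCountableTopology E] [MeasurableSpace E]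
  [BorelSpace E] [MetricSpace A] [CompactSpace A] [Nonempty A] [MeasurableSpace A]
  {T : ℝ} {lam : Kernel (E × A) E} {L : ℝ≥0} {f : Icc (0 : ℝ) T × E × A → ℝ} {g : E → ℝ}

theorem iSup_hamiltonian (hL : ∀ p, lam p univ ≤ L) (hF : IsFeller lam) (hf : IsUSCBounded f)
    {v : Icc (0 : ℝ) T × E → ℝ} (hv : IsUSCBounded v) (t : Icc (0 : ℝ) T) (x : E) :
    ⨆ a, hamiltonian lam f v t x a =
      bellman lam L (fun p => f (p.1.1, p.1.2, p.2)) v (t, x) - L * v (t, x) := by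
  obtain ⟨C, hC⟩ := hv.2
  simp_rw [hamiltonian_eq hL f hv.1.measurable hC]
  exact (Monotone.map_ciSup_of_continuousAt (f := fun r : ℝ => r - L * v (t, x))
    (by fun_prop) (fun a b hab => sub_le_sub_right hab _)
    (exists_eq_iSup_of_upperSemicontinuous
      ((isUSCBounded_integral_uniformizedRate hL hF hv).add hf.reassoc).1 (t, x)).1).symm

/-- The solution is `v = exp(Lt) u`, where `u` is the fixed point for the discounted data `exp(-Lt)
f` and `exp(-LT) g`. Differentiating the exponential produces precisely the term `L v` separated off
by uniformization. -/
theorem exists_isHJBSolution (hT : 0 < T) (hL : ∀ p, lam p univ ≤ L) (hF : IsFeller lam)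
    (hf : IsUSCBounded f) (hg : IsUSCBounded g) :
    ∃ v : Icc (0 : ℝ) T × E → ℝ, IsUSCBounded v ∧ IsHJBSolution hT lam f g v := by
  have hr : IsUSCBounded fun p : (Icc (0 : ℝ) T × E) × A =>
      Real.exp (-(L * p.1.1)) * f (p.1.1, p.1.2, p.2) := by
    refine hf.reassoc.continuous_mul (by fun_prop) (fun _ => Real.exp_pos _) (B := 1) fun z => ?_
    have := z.1.1.2.1
    exact Real.exp_le_one_iff.2 (neg_nonpos.2 (by positivity))
  have hG : IsUSCBounded fun x => Real.exp (-(L * T)) * g x :=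
    hg.continuous_mul continuous_const (fun _ => Real.exp_pos _) (fun _ => le_rfl)
  obtain ⟨u, hu, hfix⟩ := exists_bellman_fixedPoint hT hL hF hr hG
  set m := bellman lam L (fun p : (Icc (0 : ℝ) T × E) × A =>
      Real.exp (-(L * p.1.1)) * f (p.1.1, p.1.2, p.2)) u with hm
  have hmusc : IsUSCBounded m := isUSCBounded_bellman hL hF hr hu
  have hv : IsUSCBounded fun q : Icc (0 : ℝ) T × E => Real.exp (L * q.1) * u q := by
    refine hu.continuous_mul (by fun_prop) (fun _ => Real.exp_pos _) (B := Real.exp (L * T))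
      fun z => ?_
    have := z.1.2.2
    gcongr
  have hsup (t : Icc (0 : ℝ) T) (x : E) :
      ⨆ a, hamiltonian lam f (fun q => Real.exp (L * q.1) * u q) t x a =
        Real.exp (L * t) * m (t, x) - L * (Real.exp (L * t) * u (t, x)) := by
    rw [iSup_hamiltonian hL hF hf hv, bellman_exp_mul]
  -- On `[0, T]` the fixed point agrees with this primitive, from which absolute continuity and the
  -- derivative almost everywhere are read off.
  let I : E → ℝ → ℝ := fun x s =>
    Real.exp (-(L * T)) * g x - ∫ r in T..s, m (clamp hT r, x)
  have hI (x : E) {s : ℝ} (hs : s ∈ Icc (0 : ℝ) T) : u (clamp hT s, x) = I x s := by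
    rw [hfix]
    simp only [coe_clamp hT hs, I, intervalIntegral.integral_symm T s]
    ring
  have hint (x : E) := intervalIntegrable_of_isUSCBounded hT hmusc x 0 T
  refine ⟨_, hv, hv.1.measurable, hv.2, ?_, fun x => ?_, fun x => ?_, fun x => ?_⟩
  · simp_rw [hsup]
    have h1 : Measurable fun z : Icc (0 : ℝ) T × E => Real.exp (L * z.1) := by fun_prop
    exact (h1.mul hmusc.1.measurable).sub ((h1.mul hu.1.measurable).const_mul _)
  · have h1 := hI x (right_mem_Icc.2 hT.le)
    rw [clamp, projIcc_right] at h1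
    simp only [h1, I, intervalIntegral.integral_same, sub_zero]
    rw [← mul_assoc, ← Real.exp_add, add_neg_cancel, Real.exp_zero, one_mul]
  · have hexp : AbsolutelyContinuousOnInterval (fun s => Real.exp (L * s)) 0 T :=
      ContDiffOn.absolutelyContinuousOnInterval (by fun_prop)
    have hconst : AbsolutelyContinuousOnInterval (fun _ : ℝ => Real.exp (-(L * T)) * g x) 0 T :=
      ContDiffOn.absolutelyContinuousOnInterval (by fun_prop)
    have h1 := hexp.mul (hconst.sub
      ((hint x).absolutelyContinuousOnInterval_intervalIntegral (c := T) right_mem_uIcc))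
    refine absolutelyContinuousOnInterval_congr h1 fun s hs => ?_
    rw [uIcc_of_le hT.le] at hs
    simp only [coe_clamp hT hs, hI x hs]
    rfl
  -- The endpoints are discarded: `clamp` is the identity near interior points only.
  · rw [restrict_Ioo_eq_restrict_Icc.symm, ae_restrict_iff' measurableSet_Ioo]
    filter_upwards [(hint x).ae_hasDerivAt_integral] with s hs hs'
    have hsI : s ∈ Icc (0 : ℝ) T := Ioo_subset_Icc_self hs'
    have h1 := hs (by rwa [uIcc_of_le hT.le]) T right_mem_uIcc
    have h2 : HasDerivAt (fun s => Real.exp (L * s)) (Real.exp (L * s) * (L * 1)) s :=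
      ((hasDerivAt_id s).const_mul (L : ℝ)).exp
    have h3 := h2.mul (h1.const_sub (Real.exp (-(L * T)) * g x))
    refine (h3.congr_of_eventuallyEq ?_).congr_deriv ?_
    · filter_upwards [Ioo_mem_nhds hs'.1 hs'.2] with r hr
      have hrI := Ioo_subset_Icc_self hr
      simp only [coe_clamp hT hrI, hI x hrI]
      rfl
    · rw [hsup, hI x hsI, coe_clamp hT hsI]
      simp only [I]
      ring

/-- The Hamiltonian itself need not be usc, but it differs by `L v(t,x)`, which does not involve
`a`, from a function that is; the maximizers are the same. -/
theorem exists_attainsHamiltonian [BorelSpace A] (hL : ∀ p, lam p univ ≤ L) (hF : IsFeller lam)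
    (hf : IsUSCBounded f) {v : Icc (0 : ℝ) T × E → ℝ} (hv : IsUSCBounded v) :
    ∃ α : Control E A T, AttainsHamiltonian lam f v α := by
  obtain ⟨α, hα, hmax⟩ := exists_measurable_isMax
    ((isUSCBounded_integral_uniformizedRate hL hF hv).add hf.reassoc)
  refine ⟨⟨α, hα⟩, fun t x => ?_⟩
  obtain ⟨C, hC⟩ := hv.2
  rw [iSup_hamiltonian hL hF hf hv, hamiltonian_eq hL f hv.1.measurable hC]
  exact congrArg (· - (L : ℝ) * v (t, x)) (hmax (t, x))

end Solution

end JumpControl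

namespace JumpControl

open Filter Topology

/-! ### Controlled laws and the representation of solutions -/

section ControlledLaw

variable {E A : Type*} [MeasurableSpace E] [MeasurableSpace A] {T : ℝ} (hT : 0 < T)
  {lam : Kernel (E × A) E} {L : ℝ≥0}

theorem controlledRate_univ_le (hL : ∀ p, lam p univ ≤ L) (α : Control E A T) (p : ℝ≥0 × E) :
    controlledRate hT lam α p univ ≤ L := by
  rw [controlledRate, Kernel.comap_apply]
  exact hL _

theorem isControlledLaw_controlledLaw [MeasurableSingletonClass E] (hL : ∀ p, lam p univ ≤ L)
    (t : Icc (0 : ℝ) T) (x : E) (α : Control E A T) :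
    IsControlledLaw hT lam t x α (controlledLaw hT lam t x α) := by
  have h : ∃ P, IsControlledLaw hT lam t x α P :=
    exists_isJumpLaw _ (controlledRate_univ_le hT hL α) x
  rw [controlledLaw, dif_pos h]
  exact h.choose_spec

/-- Almost surely there is no explosion up to `T`, so the cemetery value never enters the gain. -/
theorem gain_eq [MeasurableSingletonClass E] (hL : ∀ p, lam p univ ≤ L)
    (f : Icc (0 : ℝ) T × E × A → ℝ) (g : E → ℝ) (t : Icc (0 : ℝ) T) (x : E)
    (α : Control E A T) :
    gain hT lam f g t x α = ∫ ω : JumpPath E, (g (ω.stateMark T.toNNReal) +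
      ∫ s in (t : ℝ)..T, f (clamp hT s, ω.stateMark s.toNNReal,
        α (clamp hT s, ω.stateMark s.toNNReal))) ∂controlledLaw hT lam t x α := by
  refine integral_congr_ae ?_
  filter_upwards [ae_exists_lt_time (isControlledLaw_controlledLaw hT hL t x α)
    (controlledRate_univ_le hT hL α) T.toNNReal] with ω ⟨m, hm⟩
  have hstate (s : ℝ) (hs : s ≤ T) :
      ω.state s.toNNReal = some (ω.stateMark s.toNNReal) := by
    refine JumpPath.state_eq_some (lt_of_le_of_lt ?_ (hm.trans_le (le_iSup ω.time (m + 1))))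
    exact_mod_cast Real.toNNReal_le_toNNReal hs
  rw [hstate T le_rfl, add_comm]
  congr 1
  refine intervalIntegral.integral_congr fun s hs => ?_
  rw [uIcc_of_le t.2.2] at hs
  simp only [hstate s hs.2]
  rfl

theorem IsHJBSolution.eq_add_integral {f : Icc (0 : ℝ) T × E × A → ℝ} {g : E → ℝ}
    {w : Icc (0 : ℝ) T × E → ℝ}
    (hsol : IsHJBSolution hT lam f g w) {s : ℝ} (hs : s ∈ Icc (0 : ℝ) T) (y : E) :
    w (clamp hT s, y) = w (clamp hT T, y) +
      ∫ r in s..T, ⨆ a, hamiltonian lam f w (clamp hT r) y a := by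
  have h1 := (hsol.absolutelyContinuous y).mono (c := s) (d := T) (by
    rw [uIcc_of_le hs.2, uIcc_of_le hT.le]; exact Icc_subset_Icc_left hs.1)
  have h2 := (ae_restrict_iff' measurableSet_Icc).1 (hsol.equation y)
  have h3 := integral_eq_sub_of_absolutelyContinuousOnInterval h1 (by
    filter_upwards [h2] with r hr hr'
    rw [uIoc_of_le hs.2] at hr'
    exact hr ⟨hs.1.trans hr'.1.le, hr'.2⟩)
  rw [intervalIntegral.integral_neg] at h3
  linarith

theorem abs_gain_le [MeasurableSingletonClass E] (hL : ∀ p, lam p univ ≤ L) {f : Icc (0 : ℝ) T × E × A → ℝ}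
    {g : E → ℝ} {C D : ℝ} (hC : ∀ z, |f z| ≤ C)
    (hD : ∀ y, |g y| ≤ D) (t : Icc (0 : ℝ) T) (x : E) (α : Control E A T) :
    |gain hT lam f g t x α| ≤ D + C * |T - t| := by
  have := (isControlledLaw_controlledLaw hT hL t x α).isProbability
  rw [gain_eq hT hL]
  have h (ω : JumpPath E) : ‖g (ω.stateMark T.toNNReal) +
      ∫ s in (t : ℝ)..T, f (clamp hT s, ω.stateMark s.toNNReal,
        α (clamp hT s, ω.stateMark s.toNNReal))‖ ≤ D + C * |T - t| :=
    (norm_add_le _ _).trans (add_le_add (hD _)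
      (intervalIntegral.norm_integral_le_of_norm_le_const fun s _ => hC _))
  simpa using norm_integral_le_of_norm_le_const (ae_of_all (controlledLaw hT lam t x α) h)

theorem integrable_terminal_add_running [TopologicalSpace E] [BorelSpace E]
    [MeasurableSingletonClass E] (hL : ∀ p, lam p univ ≤ L) {g : E → ℝ} (hg : IsUSCBounded g)
    {k : ℝ → E → ℝ} (hk : Measurable (Function.uncurry k)) {C : ℝ} (hkC : ∀ s y, |k s y| ≤ C)
    (t : Icc (0 : ℝ) T) (x : E) (α : Control E A T) :
    Integrable (fun ω : JumpPath E => g (ω.stateMark T.toNNReal) +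
      ∫ s in (t : ℝ)..T, k s (ω.stateMark s.toNNReal)) (controlledLaw hT lam t x α) := by
  have hP := isControlledLaw_controlledLaw hT hL t x α
  have := hP.isProbability
  obtain ⟨D, hD⟩ := hg.2
  have h1 := integrable_running (P := controlledLaw hT lam t x α) (t := (t : ℝ).toNNReal)
    (T := T.toNNReal) (Real.toNNReal_le_toNNReal t.2.2) hk hkC
  rw [Real.coe_toNNReal _ hT.le, Real.coe_toNNReal _ t.2.1] at h1
  exact (integrable_terminal T.toNNReal hg.1.measurable hD).add h1

theorem exists_abs_hamiltonian_le [TopologicalSpace E] [TopologicalSpace A] (hL : ∀ p, lam p univ ≤ L)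
    {f : Icc (0 : ℝ) T × E × A → ℝ} {w : Icc (0 : ℝ) T × E → ℝ} (hw : IsUSCBounded w) (hf : IsUSCBounded f) :
    ∃ C, ∀ t x a, |hamiltonian lam f w t x a| ≤ C := by
  obtain ⟨C, hC⟩ := hw.2
  obtain ⟨D, hD⟩ := hf.2
  refine ⟨(|C| + |C|) * L + D, fun t x a => (abs_add_le _ _).trans (add_le_add ?_ (hD _))⟩
  exact abs_integral_le_of_bounded (hL _) (by positivity) fun y => (abs_sub _ _).trans
    (add_le_add ((hC _).trans (le_abs_self C)) ((hC _).trans (le_abs_self C)))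

theorem hamiltonian_le_iSup [TopologicalSpace E] [TopologicalSpace A] (hL : ∀ p, lam p univ ≤ L)
    {f : Icc (0 : ℝ) T × E × A → ℝ} {w : Icc (0 : ℝ) T × E → ℝ} (hw : IsUSCBounded w) (hf : IsUSCBounded f)
    (t : Icc (0 : ℝ) T) (x : E) (a : A) :
    hamiltonian lam f w t x a ≤ ⨆ a, hamiltonian lam f w t x a := by
  obtain ⟨C, hC⟩ := exists_abs_hamiltonian_le hL hw hf
  exact le_ciSup (f := fun a => hamiltonian lam f w t x a)
    ⟨C, by rintro _ ⟨a, rfl⟩; exact (abs_le.1 (hC t x a)).2⟩ a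

theorem exists_abs_iSup_hamiltonian_le [TopologicalSpace E] [TopologicalSpace A] [Nonempty A] (hL : ∀ p, lam p univ ≤ L)
    {f : Icc (0 : ℝ) T × E × A → ℝ} {w : Icc (0 : ℝ) T × E → ℝ} (hw : IsUSCBounded w) (hf : IsUSCBounded f) :
    ∃ C, (∀ t x a, |hamiltonian lam f w t x a| ≤ C) ∧
      ∀ t x, |⨆ a, hamiltonian lam f w t x a| ≤ C := by
  obtain ⟨C, hC⟩ := exists_abs_hamiltonian_le hL hw hf
  refine ⟨C, hC, fun t x => abs_le.2 ⟨?_, ciSup_le fun a => (abs_le.1 (hC t x a)).2⟩⟩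
  let a : A := Classical.arbitrary A
  exact (abs_le.1 (hC t x a)).1.trans (hamiltonian_le_iSup hL hw hf t x a)

/-- The difference between the running reward and the loss from using a nonoptimal action. -/
noncomputable def verificationReward (lam : Kernel (E × A) E) (f : Icc (0 : ℝ) T × E × A → ℝ)
    (w : Icc (0 : ℝ) T × E → ℝ) (α : Control E A T) (s : ℝ) (y : E) : ℝ :=
  (⨆ a, hamiltonian lam f w (clamp hT s) y a) -
    hamiltonian lam f w (clamp hT s) y (α (clamp hT s, y)) +
      f (clamp hT s, y, α (clamp hT s, y))

theorem exists_abs_verificationReward_le [TopologicalSpace E] [TopologicalSpace A] [Nonempty A] (hL : ∀ p, lam p univ ≤ L)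
    {f : Icc (0 : ℝ) T × E × A → ℝ} {w : Icc (0 : ℝ) T × E → ℝ} (hw : IsUSCBounded w) (hf : IsUSCBounded f)
    (α : Control E A T) : ∃ C, ∀ s y, |verificationReward hT lam f w α s y| ≤ C := by
  obtain ⟨C, h1, h2⟩ := exists_abs_iSup_hamiltonian_le hL hw hf
  obtain ⟨D, hD⟩ := hf.2
  exact ⟨C + C + D, fun s y => (abs_add_le _ _).trans
    (add_le_add ((abs_sub _ _).trans (add_le_add (h2 _ _) (h1 _ _ _))) (hD _))⟩

/-- Dynkin's formula applied to a solution of the HJB equation. -/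
theorem IsHJBSolution.eq_integral [MetricSpace E] [SecondCountableTopology E] [BorelSpace E]
    [TopologicalSpace A] [Nonempty A] (hL : ∀ p, lam p univ ≤ L) {f : Icc (0 : ℝ) T × E × A → ℝ} {g : E → ℝ}
    (hf : IsUSCBounded f) {w : Icc (0 : ℝ) T × E → ℝ} (hw : IsUSCBounded w) (hsol : IsHJBSolution hT lam f g w)
    (t : Icc (0 : ℝ) T) (x : E) (α : Control E A T) :
    w (t, x) = ∫ ω : JumpPath E, (g (ω.stateMark T.toNNReal) + ∫ s in (t : ℝ)..T,
      verificationReward hT lam f w α s (ω.stateMark s.toNNReal))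
        ∂controlledLaw hT lam t x α := by
  obtain ⟨C, -, hC⟩ := exists_abs_iSup_hamiltonian_le hL hw hf
  obtain ⟨D, hD⟩ := hw.2
  have h1 : Measurable fun p : ℝ × E => (clamp hT p.1, p.2) :=
    ((continuous_clamp hT).measurable.comp measurable_fst).prodMk measurable_snd
  have h2 := (dynkin_formula (isControlledLaw_controlledLaw hT hL t x α)
    (controlledRate_univ_le hT hL α) (T := T.toNNReal) (Real.toNNReal_le_toNNReal t.2.2)
    (w := fun s y => w (clamp hT s, y))
    (h := fun s y => ⨆ a, hamiltonian lam f w (clamp hT s) y a)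
    (hsol.measurable.comp h1) (hsol.measurable_sup.comp h1) (C := max C D)
    (fun s y => (hD _).trans (le_max_right _ _)) (fun s y => (hC _ _).trans (le_max_left _ _))
    (by
      rw [Real.coe_toNNReal _ hT.le, Real.coe_toNNReal _ t.2.1]
      exact fun s hs y => hsol.eq_add_integral hT ⟨t.2.1.trans hs.1, hs.2⟩ y)).2
  rw [Real.coe_toNNReal _ hT.le, Real.coe_toNNReal _ t.2.1, clamp_coe] at h2
  rw [h2]
  congr 1
  ext ω
  congr 1
  · rw [clamp, projIcc_right]
    exact hsol.terminal _
  · refine intervalIntegral.integral_congr fun s hs => ?_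
    rw [uIcc_of_le t.2.2] at hs
    -- Dynkin's integrand, the supremum minus the generator at `α` applied to `w`, equals
    -- `verificationReward`, where `f` has been added and subtracted.
    simp only [verificationReward, hamiltonian, controlledRate, Kernel.comap_apply,
      Real.coe_toNNReal _ (t.2.1.trans hs.1)]
    ring

/-- The gap between supremum and Hamiltonian vanishes identically, so the reward in the
representation of `w` is `f` itself. -/
theorem IsHJBSolution.gain_eq_of_attains [MetricSpace E] [SecondCountableTopology E] [BorelSpace E]
    [TopologicalSpace A] [Nonempty A] (hL : ∀ p, lam p univ ≤ L) {f : Icc (0 : ℝ) T × E × A → ℝ} {g : E → ℝ}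
    (hf : IsUSCBounded f) {w : Icc (0 : ℝ) T × E → ℝ}
    (hw : IsUSCBounded w) (hsol : IsHJBSolution hT lam f g w) {α : Control E A T}
    (hα : AttainsHamiltonian lam f w α) (t : Icc (0 : ℝ) T) (x : E) :
    gain hT lam f g t x α = w (t, x) := by
  rw [gain_eq hT hL, hsol.eq_integral hT hL hf hw t x α]
  have h (s : ℝ) (y : E) : verificationReward hT lam f w α s y =
      f (clamp hT s, y, α (clamp hT s, y)) := by
    rw [verificationReward, hα, sub_self, zero_add]
  simp_rw [h]

end ControlledLaw

/-! ### Verification -/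

section Verification

variable {E A : Type*} [MetricSpace E] [SecondCountableTopology E] [MeasurableSpace E]
  [BorelSpace E] [MetricSpace A] [CompactSpace A] [MeasurableSpace A]
  [BorelSpace A] {T : ℝ} (hT : 0 < T) {lam : Kernel (E × A) E} {L : ℝ≥0}
  {f : Icc (0 : ℝ) T × E × A → ℝ} {g : E → ℝ}

theorem measurable_reward (hf : IsUSCBounded f) (α : Control E A T) :
    Measurable (Function.uncurry fun (s : ℝ) (y : E) =>
      f (clamp hT s, y, α (clamp hT s, y))) := by
  have h1 : Measurable fun p : ℝ × E => (clamp hT p.1, p.2) :=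
    ((continuous_clamp hT).measurable.comp measurable_fst).prodMk measurable_snd
  have h2 : Measurable fun p : ℝ × E => (clamp hT p.1, p.2, α (clamp hT p.1, p.2)) :=
    h1.fst.prodMk (h1.snd.prodMk (α.2.comp h1))
  exact hf.1.measurable.comp h2

theorem measurable_hamiltonian (hL : ∀ p, lam p univ ≤ L) (hF : IsFeller lam)
    {w : Icc (0 : ℝ) T × E → ℝ} (hw : IsUSCBounded w) (hf : IsUSCBounded f) :
    Measurable fun p : (Icc (0 : ℝ) T × E) × A => hamiltonian lam f w p.1.1 p.1.2 p.2 := by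
  obtain ⟨C, hC⟩ := hw.2
  simp_rw [hamiltonian_eq hL f hw.1.measurable hC]
  exact ((isUSCBounded_integral_uniformizedRate hL hF hw).add hf.reassoc).1.measurable.sub
    ((hw.1.measurable.comp measurable_fst).const_mul _)

theorem measurable_verificationReward (hL : ∀ p, lam p univ ≤ L) (hF : IsFeller lam)
    {w : Icc (0 : ℝ) T × E → ℝ} (hw : IsUSCBounded w) (hsol : IsHJBSolution hT lam f g w)
    (hf : IsUSCBounded f) (α : Control E A T) :
    Measurable (Function.uncurry (verificationReward hT lam f w α)) := by
  have h1 : Measurable fun p : ℝ × E => (clamp hT p.1, p.2) :=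
    ((continuous_clamp hT).measurable.comp measurable_fst).prodMk measurable_snd
  exact ((hsol.measurable_sup.comp h1).sub ((measurable_hamiltonian hL hF hw hf).comp
    (h1.prodMk (α.2.comp h1)))).add (measurable_reward hT hf α)

variable [Nonempty A]

/-- The reward representing `w` exceeds `f` by a nonnegative gap, and expectation is monotone. -/
theorem IsHJBSolution.gain_le (hL : ∀ p, lam p univ ≤ L) (hF : IsFeller lam)
    (hf : IsUSCBounded f) (hg : IsUSCBounded g) {w : Icc (0 : ℝ) T × E → ℝ}
    (hw : IsUSCBounded w) (hsol : IsHJBSolution hT lam f g w) (t : Icc (0 : ℝ) T) (x : E)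
    (α : Control E A T) : gain hT lam f g t x α ≤ w (t, x) := by
  obtain ⟨C, hC⟩ := exists_abs_verificationReward_le hT hL hw hf α
  obtain ⟨D, hD⟩ := hf.2
  have h1 := measurable_verificationReward hT hL hF hw hsol hf α
  have h2 := measurable_reward hT hf α
  rw [gain_eq hT hL, hsol.eq_integral hT hL hf hw t x α]
  refine integral_mono (integrable_terminal_add_running hT hL hg h2 (fun _ _ => hD _) t x α)
    (integrable_terminal_add_running hT hL hg h1 hC t x α) fun ω => ?_
  refine add_le_add_right (intervalIntegral.integral_mono_on t.2.2
    (intervalIntegrable_of_measurable_bounded (measurable_running ω h2) (fun _ => hD _) _ _)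
    (intervalIntegrable_of_measurable_bounded (measurable_running ω h1) (fun _ => hC _ _) _ _)
    fun s _ => ?_) _
  have h3 := hamiltonian_le_iSup hL hw hf (clamp hT s) (ω.stateMark s.toNNReal)
    (α (clamp hT s, ω.stateMark s.toNNReal))
  simp only [verificationReward]
  linarith

/-- Every gain is at most `w`, and a selected maximizer of the Hamiltonian of `w` attains it.
Applied to an arbitrary usc solution, this also gives uniqueness. -/
theorem IsHJBSolution.eq_value (hL : ∀ p, lam p univ ≤ L) (hF : IsFeller lam)
    (hf : IsUSCBounded f) (hg : IsUSCBounded g) {w : Icc (0 : ℝ) T × E → ℝ}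
    (hw : IsUSCBounded w) (hsol : IsHJBSolution hT lam f g w) (t : Icc (0 : ℝ) T) (x : E) :
    w (t, x) = value hT lam f g t x := by
  obtain ⟨α, hα⟩ := exists_attainsHamiltonian hL hF hf hw
  have hle := hsol.gain_le hT hL hF hf hg hw t x
  have : Nonempty (Control E A T) := ⟨α⟩
  refine le_antisymm ?_ (ciSup_le hle)
  rw [← hsol.gain_eq_of_attains hT hL hf hw hα]
  exact le_ciSup (f := fun β => gain hT lam f g t x β)
    ⟨w (t, x), by rintro _ ⟨β, rfl⟩; exact hle β⟩ α

end Verification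

end JumpControl
theorem mainTheorem5 {E A : Type*}
    [TopologicalSpace E] [MeasurableSpace E] [BorelSpace E]
    (hE : JumpControl.IsTopologicalBorelSpace E)
    [MetricSpace A] [CompactSpace A] [Nonempty A] [MeasurableSpace A] [BorelSpace A]
    {T : ℝ} (hT : 0 < T)
    (lam : Kernel (E × A) E)
    (hlam : ∃ C : ℝ≥0, ∀ p : E × A, lam p Set.univ ≤ C)
    (hFeller : JumpControl.IsFeller lam)
    (f : Set.Icc (0 : ℝ) T × E × A → ℝ) (hf : JumpControl.IsUSCBounded f)
    (g : E → ℝ) (hg : JumpControl.IsUSCBounded g) :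
    (∀ (t : Set.Icc (0 : ℝ) T) (x : E) (α : JumpControl.Control E A T),
      JumpControl.IsControlledLaw hT lam t x α (JumpControl.controlledLaw hT lam t x α)) ∧
    (∀ (t : Set.Icc (0 : ℝ) T) (x : E),
      BddAbove (Set.range fun α : JumpControl.Control E A T =>
        JumpControl.gain hT lam f g t x α)) ∧
    ∃ v : Set.Icc (0 : ℝ) T × E → ℝ,
      (JumpControl.IsUSCBounded v ∧ JumpControl.IsHJBSolution hT lam f g v) ∧
      (∀ w : Set.Icc (0 : ℝ) T × E → ℝ, JumpControl.IsUSCBounded w →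
        JumpControl.IsHJBSolution hT lam f g w → w = v) ∧
      (∀ (t : Set.Icc (0 : ℝ) T) (x : E), v (t, x) = JumpControl.value hT lam f g t x) ∧
      (∀ α : JumpControl.Control E A T, JumpControl.AttainsHamiltonian lam f v α →
        JumpControl.IsOptimalControl hT lam f g α) ∧
      ∃ α : JumpControl.Control E A T, JumpControl.AttainsHamiltonian lam f v α := by
  obtain ⟨L, hL⟩ := hlam
  obtain ⟨K, _, _, e, he, -⟩ := hE
  -- The embedding into a compact metric space makes `E` metrizable and second countable; any
  -- compatible metric serves for the Lipschitz approximations.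
  have : TopologicalSpace.MetrizableSpace E := he.metrizableSpace
  have : SecondCountableTopology E := he.secondCountableTopology
  let : MetricSpace E := TopologicalSpace.metrizableSpaceMetric E
  obtain ⟨v, hv, hsol⟩ := JumpControl.exists_isHJBSolution hT hL hFeller hf hg
  refine ⟨JumpControl.isControlledLaw_controlledLaw hT hL, fun t x => ?_, v, ⟨hv, hsol⟩,
    fun w hw hw' => ?_, hsol.eq_value hT hL hFeller hf hg hv, fun α hα t x => ?_,
    JumpControl.exists_attainsHamiltonian hL hFeller hf hv⟩
  · obtain ⟨C, hC⟩ := hf.2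
    obtain ⟨D, hD⟩ := hg.2
    refine ⟨D + C * |T - t|, ?_⟩
    rintro _ ⟨α, rfl⟩
    exact (le_abs_self _).trans (JumpControl.abs_gain_le hT hL hC hD t x α)
  -- Two usc solutions coincide because both are the value function.
  · funext z
    exact (hw'.eq_value hT hL hFeller hf hg hw z.1 z.2).trans
      (hsol.eq_value hT hL hFeller hf hg hv z.1 z.2).symm
  · rw [hsol.gain_eq_of_attains hT hL hf hv hα, hsol.eq_value hT hL hFeller hf hg hv]
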